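/- Let $n\ge 1$ and let $K\subset\mathbb R^n_q$ and $T\subset\mathbb R^n_p$ be smooth strictly convex bodies, i.e. compact convex sets with non-empty interior and $C^\infty$ boundary whose Gauss curvature is strictly positive at every boundary point. Fix $a\in\operatorname{int}K$ and $b\in\operatorname{int}T$, and let $g_K$, $g_T$ be the gauge functions centred at $a$ and $b$: $g_K(x)=\inf\{r>0: x-a\in r(K-a)\}$, and similarly for $T$ (for $a=b=0$ these are the usual gauge functions). Let $h_T(u)=\sup_{x\in T}\langle x,u\rangle$. On $\mathbb R^{2n}=\mathbb R^n_q\times\mathbb R^n_p$ put $J(q,p)=(-p,q)$ and $\omega(u,v)=\langle Ju,v\rangle$ (that is, $\omega=\sum dq_i\wedge dp_i$), and for a closed curve $\gamma:S^1=\mathbb R/2\pi\mathbb Z\to\mathbb R^{2n}$ let $A(\gamma)=\frac12\int_0^{2\pi}\langle J\gamma(t),\dot\gamma(t)\rangle\,dt$. Capacity. For a convex body $\Sigma\subset\mathbb R^{2n}$ with $C^\infty$ boundary, a closed characteristic on $\partial\Sigma$ is an embedded circle in $\partial\Sigma$ tangent to the line bundle $\{(x,\xi)\in T\partial\Sigma:\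 \omega(\xi,\eta)=0\ \text{for all}\ \eta\in T_x\partial\Sigma\}$, and $c_{EHZ}(\Sigma)\in[0,\infty]$ is the infimum of $|A(\gamma)|$ over all closed characteristics $\gamma$ on $\partial\Sigma$. The extended Ekeland–Hofer–Zehnder capacity of a convex body $\Sigma\subset\mathbb R^{2n}$ is $\tilde c_{EHZ}(\Sigma)=\inf\{c_{EHZ}(\Sigma'):\ \Sigma'\supseteq\Sigma \text{ a convex body with } C^\infty \text{ boundary}\}$. Trajectories. A closed $(K,T)$-billiard trajectory is a map $\gamma=(\gamma_q,\gamma_p):S^1\to\partial(K\times T)$ that is piecewise smooth (continuous, with left and right derivatives at every point, and $C^\infty$ off a set of measure zero) such that, for some constant $d>0$, $\dot\gamma(t)=d\,(-\nabla g_T(\gamma_p(t)),0)$ whenever $\gamma(t)\in\operatorname{int}K\times\partial T$, and $\dot\gamma(t)=d\,(0,\nabla g_K(\gamma_q(t)))$ whenever $\gamma(t)\in\partial K\times\operatorname{int}T$, while at every $t$ with $\gamma(t)\in\partial K\times\partial T$ the left and the right derivative of $\gamma$ both belong to $$\{\alpha(-\nabla g_T(\gamma_p(t)),0)+\beta(0,\nabla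 g_K(\gamma_q(t))):\ \alpha,\beta\ge0,\ (\alpha,\beta)\neq(0,0)\}.$$ Its projection $q=\gamma_q$ is called a closed $T$-billiard trajectory in $K$. Since $q$ moves in the directions $-\nabla g_T$, its $h_T$-length is $\ell_T(q)=\int_0^{2\pi}h_T(-\dot q(t))\,dt$; for a closed polygon with vertices $q_1,\dots,q_m$ and $q_{m+1}=q_1$ this is $\sum_j h_T(q_j-q_{j+1})$, and the sign is immaterial if $T=-T$. Theorem. The number $\xi_T(K):=\tilde c_{EHZ}(K\times T)$ is finite, there is a closed $(K,T)$-billiard trajectory $\gamma^*$ with $$\tilde c_{EHZ}(K\times T)=A(\gamma^*)=\min\{A(\gamma):\ \gamma\text{ is a closed }(K,T)\text{-billiard trajectory}\},$$ and $\xi_T(K)$ is also the $h_T$-length of the shortest closed $T$-billiard trajectory in $K$: $$\xi_T(K)=\min\{\ell_T(q):\ q\text{ is a closed }T\text{-billiard trajectory in }K\}.$$ -/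

import Mathlib

open Set MeasureTheory
open scoped ContDiff ENNReal Real

namespace MinkowskiBilliard

noncomputable section

/-- The Euclidean space `ℝⁿ`. -/
abbrev E (n : ℕ) : Type := EuclideanSpace ℝ (Fin n)

/-- The phase space `ℝ²ⁿ = ℝⁿ_q × ℝⁿ_p`. Only its topology, its smooth structure and the
symplectic form below are used, so the choice of a norm on the product is irrelevant. -/
abbrev Phase (n : ℕ) : Type := E n × E n

/-- A convex body: a compact convex set with non-empty interior. -/
structure IsConvexBody {V : Type*} [NormedAddCommGroup V] [NormedSpace ℝ V] (C : Set V) :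
    Prop where
  isCompact : IsCompact C
  convex : Convex ℝ C
  interior_nonempty : (interior C).Nonempty

/-- `H` is a smooth defining function of `C`: the set `C` is the sublevel set `{H ≤ 0}` and `0` is
a regular value of `H`, so that `frontier C = {H = 0}` is a smooth hypersurface. -/
structure IsDefiningFunction {V : Type*} [NormedAddCommGroup V] [NormedSpace ℝ V]
    (C : Set V) (H : V → ℝ) : Prop where
  contDiff : ContDiff ℝ ∞ H
  mem_iff : ∀ x, x ∈ C ↔ H x ≤ 0
  regular : ∀ x, H x = 0 → fderiv ℝ H x ≠ 0

/-- A convex body with smooth boundary. -/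
def IsSmoothConvexBody {V : Type*} [NormedAddCommGroup V] [NormedSpace ℝ V] (C : Set V) : Prop :=
  IsConvexBody C ∧ ∃ H : V → ℝ, IsDefiningFunction C H

/-- The Gauss curvature at `x` of the level hypersurface of `H` through `x`: the determinant, in an
orthonormal basis of the tangent space `ker dH(x)`, of the second fundamental form
`D²H(x)(u, v) / ‖dH(x)‖` (with the sign for which spheres have positive curvature). -/
def gaussCurvature {n : ℕ} (H : E n → ℝ) (x : E n) : ℝ :=
  let b := stdOrthonormalBasis ℝ (LinearMap.ker (fderiv ℝ H x).toLinearMap)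
  Matrix.det (Matrix.of fun i j =>
    fderiv ℝ (fderiv ℝ H) x (b i : E n) (b j : E n) / ‖fderiv ℝ H x‖)

/-- A smooth strictly convex body: a convex body with smooth boundary whose Gauss curvature is
strictly positive at every boundary point. -/
def IsSmoothStrictlyConvexBody {n : ℕ} (C : Set (E n)) : Prop :=
  IsConvexBody C ∧
    ∃ H : E n → ℝ, IsDefiningFunction C H ∧ ∀ x ∈ frontier C, 0 < gaussCurvature H x

/-- The support function `h_C(u) = sup {⟨x, u⟩ : x ∈ C}`. -/
def supportFunction {n : ℕ} (C : Set (E n)) (u : E n) : ℝ :=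
  sSup ((fun x => inner ℝ x u) '' C)

/-- The gauge function of `C` with respect to the centre `a`; for `a = 0` it is the usual
gauge function `inf {r > 0 : x ∈ r C}`. -/
def gaugeAt {n : ℕ} (C : Set (E n)) (a : E n) (x : E n) : ℝ :=
  gauge ((fun y => y - a) '' C) (x - a)

/-! ### Symplectic notions -/

/-- The standard symplectic form `ω = ∑ dqᵢ ∧ dpᵢ`. With `J (q, p) = (-p, q)` one has
`ω(u, v) = ⟨J u, v⟩`. -/
def omega {n : ℕ} (u v : Phase n) : ℝ := inner ℝ u.1 v.2 - inner ℝ u.2 v.1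

/-- The action `A(γ) = ½ ∫₀^{2π} ⟨J γ(t), γ'(t)⟩ dt` of a `2π`-periodic curve. -/
def action {n : ℕ} (γ : ℝ → Phase n) : ℝ :=
  (1 / 2) * ∫ t in (0 : ℝ)..(2 * π), omega (γ t) (deriv γ t)

/-- The tangent space at `x` of the boundary of a body with smooth boundary. -/
def boundaryTangentSpace {n : ℕ} (C : Set (Phase n)) (x : Phase n) : Set (Phase n) :=
  {η | ∃ H : Phase n → ℝ, IsDefiningFunction C H ∧ fderiv ℝ H x η = 0}

/-- The fibre at `x` of the characteristic line bundle of the boundary of `C`. -/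
def characteristicLine {n : ℕ} (C : Set (Phase n)) (x : Phase n) : Set (Phase n) :=
  {ξ | ξ ∈ boundaryTangentSpace C x ∧ ∀ η ∈ boundaryTangentSpace C x, omega ξ η = 0}

/-- A closed characteristic on the boundary of `C`: an embedded circle in `frontier C`,
parametrised by `ℝ / 2πℤ`, which is tangent to the characteristic line bundle. -/
structure IsClosedCharacteristic {n : ℕ} (C : Set (Phase n)) (γ : ℝ → Phase n) : Prop where
  contDiff : ContDiff ℝ ∞ γ
  periodic : Function.Periodic γ (2 * π)
  injOn : InjOn γ (Ico 0 (2 * π))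
  deriv_ne_zero : ∀ t, deriv γ t ≠ 0
  mem_frontier : ∀ t, γ t ∈ frontier C
  tangent : ∀ t, deriv γ t ∈ characteristicLine C (γ t)

/-- The action spectrum `{|A(γ)| : γ a closed characteristic on the boundary of C}`. -/
def actionSpectrum {n : ℕ} (C : Set (Phase n)) : Set ℝ :=
  {s | ∃ γ : ℝ → Phase n, IsClosedCharacteristic C γ ∧ s = |action γ|}

/-- The Ekeland-Hofer-Zehnder capacity of a smooth convex body: the minimal action of a closed
characteristic on its boundary. -/
def smoothCapacity {n : ℕ} (C : Set (Phase n)) : ℝ≥0∞ :=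
  sInf (ENNReal.ofReal '' actionSpectrum C)

/-- The extended Ekeland-Hofer-Zehnder capacity: the infimum of the capacities of all smooth convex
bodies containing `C`. -/
def extendedCapacity {n : ℕ} (C : Set (Phase n)) : ℝ≥0∞ :=
  ⨅ (C' : Set (Phase n)) (_ : IsSmoothConvexBody C') (_ : C ⊆ C'), smoothCapacity C'

/-! ### Billiard trajectories -/

/-- Piecewise smooth curves: continuous, with left and right derivatives at every point, and smooth
off a set of measure zero. -/
structure IsPiecewiseSmooth {n : ℕ} (γ : ℝ → Phase n) : Prop where
  continuous : Continuous γ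
  left_deriv : ∀ t, ∃ v, HasDerivWithinAt γ v (Iic t) t
  right_deriv : ∀ t, ∃ v, HasDerivWithinAt γ v (Ici t) t
  smooth_off_null : ∃ F : Set ℝ, volume F = 0 ∧ ∀ t, t ∉ F → ContDiffAt ℝ ∞ γ t

/-- The cone of admissible velocities at `(q, p)`, `q` and `p` both boundary points: all
`α (-∇g_T(p), 0) + β (0, ∇g_K(q))` with `α, β ≥ 0` not both zero. The gauges are taken with respect
to the centres `a` and `b`. -/
def velocityCone {n : ℕ} (K T : Set (E n)) (a b : E n) (x : Phase n) : Set (Phase n) :=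
  {v | ∃ α β : ℝ, 0 ≤ α ∧ 0 ≤ β ∧ (α, β) ≠ (0, 0) ∧
    v = α • (-gradient (gaugeAt T b) x.2, (0 : E n))
      + β • ((0 : E n), gradient (gaugeAt K a) x.1)}

/-- `γ : ℝ / 2πℤ → ∂(K × T)` parametrises a closed `(K, T)`-billiard trajectory, where the gauge
functions of `K` and `T` are taken with respect to the interior points `a` and `b`. -/
structure IsBilliardTrajectory {n : ℕ} (K T : Set (E n)) (a b : E n) (γ : ℝ → Phase n) :
    Prop where
  periodic : Function.Periodic γ (2 * π)
  piecewiseSmooth : IsPiecewiseSmooth γ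
  mem_frontier : ∀ t, γ t ∈ frontier (K ×ˢ T)
  /-- Away from `∂K × ∂T` the curve follows the billiard vector field, up to a constant factor. -/
  flow : ∃ d : ℝ, 0 < d ∧
    (∀ t, (γ t).1 ∈ interior K → (γ t).2 ∈ frontier T →
      HasDerivAt γ (d • (-gradient (gaugeAt T b) (γ t).2, (0 : E n))) t) ∧
    (∀ t, (γ t).1 ∈ frontier K → (γ t).2 ∈ interior T →
      HasDerivAt γ (d • ((0 : E n), gradient (gaugeAt K a) (γ t).1)) t)
  /-- On `∂K × ∂T` the left and right derivatives lie in the cone of admissible velocities. -/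
  left_reflection : ∀ t, (γ t).1 ∈ frontier K → (γ t).2 ∈ frontier T →
    ∃ v ∈ velocityCone K T a b (γ t), HasDerivWithinAt γ v (Iic t) t
  right_reflection : ∀ t, (γ t).1 ∈ frontier K → (γ t).2 ∈ frontier T →
    ∃ v ∈ velocityCone K T a b (γ t), HasDerivWithinAt γ v (Ici t) t

/-- A closed `T`-billiard trajectory in `K`: the projection to configuration space of a closed
`(K, T)`-billiard trajectory. -/
def IsTableTrajectory {n : ℕ} (K T : Set (E n)) (a b : E n) (q : ℝ → E n) : Prop :=
  ∃ γ : ℝ → Phase n, IsBilliardTrajectory K T a b γ ∧ q = fun t => (γ t).1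

/-- The `h_T`-length of a closed `T`-billiard trajectory. In the sign convention
`J (q, p) = (-p, q)` a `(K, T)`-billiard trajectory moves in `K` in the directions `-∇g_T(p)`, so
displacements are measured against the direction of motion: a straight piece from `q₀` to `q₁`
has length `h_T(q₀ - q₁)`. The sign is immaterial if `T = -T`. -/
def tableLength {n : ℕ} (T : Set (E n)) (q : ℝ → E n) : ℝ :=
  ∫ t in (0 : ℝ)..(2 * π), supportFunction T (-(deriv q t))

end

end MinkowskiBilliard

/-! The proof is Clarke's dual variational principle in isoperimetric form. For a compact convex
neighbourhood D of the origin in a symplectic space, velocities are measured by N(v) = max of Ω(x,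
v) over x in D (`lengthNorm`), and the integral of Ω(z, z') is maximised over loops of N-length at
most P. A maximiser exists by compactness; its value is M = `isoConst`. Rescaling arc length gives
the isoperimetric inequality area · P² ≤ M · length² (`integral_bilin_mul_sq_le`).

Let S be a convex body, c an interior point and D = S - c. A closed curve in S whose velocity is
everywhere an outer normal with respect to ω has N-length equal to twice its action, so the
inequality bounds its action below by P²/(2M), which is `minimalAction` for P = 2π. Conversely, a
maximiser, translated by the Lagrange multiplier of the closing condition, has a velocity that
maximises Ω(γ, ·) on {N ≤ 1} at almost every time. Hence its gauge is constant, and after rescaling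
it is a generalised closed characteristic whose action is exactly that bound
(`IsSymplecticBody.exists_minimizer`). Smoothness of D plays no role in this, so the argument covers
smooth bodies and K × T alike.

On a smooth body the generalised characteristic solves a smooth Hamiltonian equation and is
embedded, since a shorter closed arc would violate the isoperimetric inequality. N grows with D, so
characteristics on bodies containing K × T have at least the minimal action of K × T. Smooth bodies
squeezed between K × T and its dilations by s > 1 give equality as s tends to 1
(`extendedCapacity_prod`).

Billiard velocities are outer normals of K × T with respect to ω, so trajectories obey the same
lower bound. What remains is regularity of the generalised trajectory q' = -α∇g_T(p), p' = β∇g_K(q),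
α + β = d, at points of ∂K × ∂T. Put f = g_K(q) - 1 ≤ 0, h = g_T(p) - 1 ≤ 0 and σ = ⟨∇g_K(q),
∇g_T(p)⟩; then f' = -ασ and h' = βσ. If σ ≠ 0, the opposite monotonicity of f and h leaves a single
active coefficient on each side. If σ = 0, the energy σ²/2 - κ₁f - κ₂h, with κ₁, κ₂ the Hessians of
the gauges in the direction of the other normal, vanishes nearby by Grönwall; then σ = 0 on an
interval, ακ₁ = βκ₂, and the curve solves a smooth equation. Positive Gauss curvature enters only
here, to make κ₁ and κ₂ positive. Finally, integrating d⟨q, p⟩ over a period identifies action and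
h_T-length. -/

namespace MinkowskiBilliard

open Filter Topology intervalIntegral
open scoped NNReal

/-! ### Lipschitz curves -/

section LipschitzCurves

variable {V : Type*} [NormedAddCommGroup V] [NormedSpace ℝ V] [FiniteDimensional ℝ V]

theorem ae_differentiableAt_of_lipschitzOn {f : ℝ → V} {a b : ℝ} {C : ℝ≥0}
    (hf : LipschitzOnWith C f (uIcc a b)) : ∀ᵐ x, x ∈ uIcc a b → DifferentiableAt ℝ f x :=
  hf.absolutelyContinuousOnInterval.boundedVariationOn.ae_differentiableAt_of_mem_uIcc

theorem intervalIntegrable_deriv_of_lipschitzOn {f : ℝ → V} {a b : ℝ} {C : ℝ≥0}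
    (hf : LipschitzOnWith C f (uIcc a b)) : IntervalIntegrable (deriv f) volume a b := by
  have : CompleteSpace V := FiniteDimensional.complete ℝ V
  borelize V
  have hfin : SecondCountableTopology V := by
    have := FiniteDimensional.proper ℝ V
    infer_instance
  wlog hab : a ≤ b generalizing a b
  · exact (this (by rwa [uIcc_comm]) (le_of_not_ge hab)).symm
  rw [uIcc_of_le hab] at hf
  rw [intervalIntegrable_iff_integrableOn_Ioo_of_le hab]
  refine Measure.integrableOn_of_bounded (M := C) (by simp)
    (stronglyMeasurable_deriv f).aestronglyMeasurable ?_
  refine (ae_restrict_iff' measurableSet_Ioo).2 (Eventually.of_forall fun x hx => ?_)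
  exact norm_deriv_le_of_lipschitzOn (Icc_mem_nhds hx.1 hx.2) hf

/-- Continuous functionals separate points and reduce this to real valued absolutely continuous
functions. -/
theorem integral_deriv_of_lipschitzOn {f : ℝ → V} {a b : ℝ} {C : ℝ≥0}
    (hf : LipschitzOnWith C f (uIcc a b)) : ∫ x in a..b, deriv f x = f b - f a := by
  have : CompleteSpace V := FiniteDimensional.complete ℝ V
  refine (SeparatingDual.eq_iff_forall_dual_eq (R := ℝ)).2 fun ℓ => ?_
  have hℓ : LipschitzOnWith (‖ℓ‖₊ * C) (fun x => ℓ (f x)) (uIcc a b) :=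
    ℓ.lipschitz.comp_lipschitzOnWith hf
  rw [← ℓ.intervalIntegral_comp_comm (intervalIntegrable_deriv_of_lipschitzOn hf), map_sub,
    ← hℓ.absolutelyContinuousOnInterval.integral_deriv_eq_sub]
  refine intervalIntegral.integral_congr_ae ?_
  filter_upwards [ae_differentiableAt_of_lipschitzOn hf] with x hx hxm
  exact ((ℓ.hasFDerivAt.comp_hasDerivAt x
    (hx (uIoc_subset_uIcc hxm)).hasDerivAt).deriv).symm

/-- The fundamental theorem of calculus for a Lipschitz curve with an a.e. prescribed derivative. -/
theorem integral_of_lipschitzOn_of_ae_hasDerivAt {f f' : ℝ → V} {a b : ℝ} {C : ℝ≥0}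
    (hf : LipschitzOnWith C f (uIcc a b))
    (hf' : ∀ᵐ x, x ∈ uIcc a b → HasDerivAt f (f' x) x) :
    IntervalIntegrable f' volume a b ∧ ∫ x in a..b, f' x = f b - f a := by
  have h : ∀ᵐ x, x ∈ uIoc a b → deriv f x = f' x := by
    filter_upwards [hf'] with x hx hxm
    exact (hx (uIoc_subset_uIcc hxm)).deriv
  refine ⟨(intervalIntegrable_deriv_of_lipschitzOn hf).congr_ae
    ((ae_restrict_iff' measurableSet_uIoc).2 h), ?_⟩
  rw [← intervalIntegral.integral_congr_ae h, integral_deriv_of_lipschitzOn hf]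

variable {W : Type*} [NormedAddCommGroup W] [NormedSpace ℝ W]

theorem intervalIntegrable_bilin {X : Type*} [NormedAddCommGroup X] [NormedSpace ℝ X]
    (B : W →L[ℝ] X →L[ℝ] ℝ) {f : ℝ → W} {g : ℝ → X} {a b : ℝ}
    (hf : ContinuousOn f (uIcc a b)) (hg : IntervalIntegrable g volume a b) :
    IntervalIntegrable (fun x => B (f x) (g x)) volume a b := by
  obtain ⟨K, hK⟩ := isCompact_uIcc.exists_bound_of_continuousOn hf
  rw [intervalIntegrable_iff] at hg ⊢
  refine Integrable.mono' (hg.norm.const_mul (‖B‖ * K)) ?_ ?_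
  · exact B.aestronglyMeasurable_comp₂
      ((hf.mono uIoc_subset_uIcc).aestronglyMeasurable measurableSet_uIoc)
      hg.aestronglyMeasurable
  · refine (ae_restrict_iff' measurableSet_uIoc).2 (Eventually.of_forall fun x hx => ?_)
    refine (B.le_opNorm₂ _ _).trans ?_
    gcongr
    exact hK x (uIoc_subset_uIcc hx)

/-- The error made by replacing the integral of `B(γ, γ')` by a Riemann-Stieltjes sum. -/
theorem abs_integral_bilin_sub_sum_le [CompleteSpace W] (B : W →L[ℝ] W →L[ℝ] ℝ) {γ γ' : ℝ → W}
    {t : ℕ → ℝ} (ht : Monotone t) (k : ℕ) {ρ : ℝ}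
    (hc : ContinuousOn γ (Icc (t 0) (t k)))
    (hint : IntervalIntegrable γ' volume (t 0) (t k))
    (hftc : ∀ x ∈ Icc (t 0) (t k), ∀ y ∈ Icc (t 0) (t k), x ≤ y →
      ∫ s in x..y, γ' s = γ y - γ x)
    (hosc : ∀ i < k, ∀ x ∈ Icc (t i) (t (i + 1)), ‖γ x - γ (t i)‖ ≤ ρ) :
    |(∫ s in (t 0)..(t k), B (γ s) (γ' s))
        - ∑ i ∈ Finset.range k, B (γ (t i)) (γ (t (i + 1)) - γ (t i))|
      ≤ ‖B‖ * ρ * ∫ s in (t 0)..(t k), ‖γ' s‖ := by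
  have hsub : ∀ i < k, uIcc (t i) (t (i + 1)) ⊆ uIcc (t 0) (t k) := fun i hi => by
    rw [uIcc_of_le (ht i.le_succ), uIcc_of_le (ht k.zero_le)]
    exact Icc_subset_Icc (ht i.zero_le) (ht hi)
  have hc' : ContinuousOn γ (uIcc (t 0) (t k)) := by rwa [uIcc_of_le (ht k.zero_le)]
  have hi : ∀ i < k, IntervalIntegrable γ' volume (t i) (t (i + 1)) := fun i hi =>
    hint.mono_set (hsub i hi)
  have hB : ∀ i < k, IntervalIntegrable (fun s => B (γ s) (γ' s)) volume (t i) (t (i + 1)) :=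
    fun i h => intervalIntegrable_bilin B (hc'.mono (hsub i h)) (hi i h)
  rw [← intervalIntegral.sum_integral_adjacent_intervals hB,
    ← intervalIntegral.sum_integral_adjacent_intervals (fun i h => (hi i h).norm),
    ← Finset.sum_sub_distrib, Finset.mul_sum]
  refine (Finset.abs_sum_le_sum_abs _ _).trans (Finset.sum_le_sum fun i hik => ?_)
  have hik := Finset.mem_range.1 hik
  have hle := ht i.le_succ
  -- Each summand is the integral of B(γ(tᵢ), γ'), so the error on a piece is the integral of B(γ -
  -- γ(tᵢ), γ').
  have h0 : B (γ (t i)) (γ (t (i + 1)) - γ (t i)) = ∫ s in (t i)..(t (i + 1)), B (γ (t i)) (γ' s) := by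
    rw [(B (γ (t i))).intervalIntegral_comp_comm (hi i hik), hftc]
    · exact ⟨ht i.zero_le, ht hik.le⟩
    · exact ⟨ht (i + 1).zero_le, ht hik⟩
    · exact hle
  rw [h0, ← intervalIntegral.integral_sub (hB i hik)
    (intervalIntegrable_bilin B continuousOn_const (hi i hik)), ← Real.norm_eq_abs,
    ← intervalIntegral.integral_const_mul]
  refine intervalIntegral.norm_integral_le_of_norm_le hle (Eventually.of_forall fun s hs => ?_)
    ((hi i hik).norm.const_mul _)
  rw [← _root_.sub_apply, ← map_sub]
  refine (B.le_opNorm₂ _ _).trans ?_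
  gcongr
  exact hosc i hik s (Ioc_subset_Icc_self hs)

end LipschitzCurves

/-! ### The length functional dual to a convex body -/

section LengthNorm

variable {V : Type*} [NormedAddCommGroup V] [NormedSpace ℝ V]

/-- The length of the velocity `v` measured by the body `D`: the value at `-J v` of the support
function of `D`. -/
noncomputable def lengthNorm (Ω : V →L[ℝ] V →L[ℝ] ℝ) (D : Set V) (v : V) : ℝ :=
  sSup ((fun x => Ω x v) '' D)

/-- A compact convex neighbourhood `D` of the origin in a symplectic vector space. -/
structure IsSymplecticBody (Ω : V →L[ℝ] V →L[ℝ] ℝ) (D : Set V) : Prop where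
  alt : ∀ v, Ω v v = 0
  nondeg : ∀ ℓ : V →L[ℝ] ℝ, ∃ v, ∀ x, Ω x v = ℓ x
  isCompact : IsCompact D
  convex : Convex ℝ D
  zero_mem : (0 : V) ∈ interior D

namespace IsSymplecticBody

variable {Ω : V →L[ℝ] V →L[ℝ] ℝ} {D : Set V}

theorem swap (h : IsSymplecticBody Ω D) (u v : V) : Ω u v = -Ω v u := by
  have := h.alt (u + v)
  simp only [map_add, add_apply, h.alt] at this
  linarith

theorem bddAbove (h : IsSymplecticBody Ω D) (v : V) : BddAbove ((fun x => Ω x v) '' D) :=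
  (h.isCompact.image (by fun_prop)).bddAbove

theorem le_lengthNorm (h : IsSymplecticBody Ω D) {x : V} (hx : x ∈ D) (v : V) :
    Ω x v ≤ lengthNorm Ω D v :=
  le_csSup (h.bddAbove v) (mem_image_of_mem _ hx)

theorem lengthNorm_le (h : IsSymplecticBody Ω D) {v : V} {c : ℝ} (hc : ∀ x ∈ D, Ω x v ≤ c) :
    lengthNorm Ω D v ≤ c :=
  csSup_le (Set.Nonempty.image _ ⟨0, interior_subset h.zero_mem⟩) (by rintro _ ⟨x, hx, rfl⟩; exact hc x hx)

theorem exists_eq_lengthNorm (h : IsSymplecticBody Ω D) (v : V) :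
    ∃ x ∈ D, Ω x v = lengthNorm Ω D v := by
  obtain ⟨x, hx, hmax⟩ := h.isCompact.exists_isMaxOn ⟨0, interior_subset h.zero_mem⟩
    (f := fun x => Ω x v) (by fun_prop)
  exact ⟨x, hx, le_antisymm (h.le_lengthNorm hx v) (h.lengthNorm_le fun y hy => hmax hy)⟩

theorem lengthNorm_nonneg (h : IsSymplecticBody Ω D) (v : V) : 0 ≤ lengthNorm Ω D v := by
  simpa using h.le_lengthNorm (interior_subset h.zero_mem) v

theorem lengthNorm_add_le (h : IsSymplecticBody Ω D) (v w : V) :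
    lengthNorm Ω D (v + w) ≤ lengthNorm Ω D v + lengthNorm Ω D w :=
  h.lengthNorm_le fun x hx => by
    rw [map_add]; exact add_le_add (h.le_lengthNorm hx v) (h.le_lengthNorm hx w)

theorem lengthNorm_smul (h : IsSymplecticBody Ω D) {c : ℝ} (hc : 0 ≤ c) (v : V) :
    lengthNorm Ω D (c • v) = c * lengthNorm Ω D v := by
  refine le_antisymm (h.lengthNorm_le fun x hx => ?_) ?_
  · rw [map_smul, smul_eq_mul]
    exact mul_le_mul_of_nonneg_left (h.le_lengthNorm hx v) hc
  · obtain ⟨x, hx, hxv⟩ := h.exists_eq_lengthNorm v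
    rw [← hxv, ← smul_eq_mul, ← map_smul]
    exact h.le_lengthNorm hx _

theorem lengthNorm_zero (h : IsSymplecticBody Ω D) : lengthNorm Ω D 0 = 0 := by
  simpa using h.lengthNorm_smul le_rfl 0

theorem exists_lengthNorm_le (h : IsSymplecticBody Ω D) :
    ∃ C : ℝ≥0, ∀ v, lengthNorm Ω D v ≤ C * ‖v‖ := by
  obtain ⟨R, hR⟩ := h.isCompact.isBounded.exists_norm_le
  have hR0 : 0 ≤ R := (norm_nonneg _).trans (hR 0 (interior_subset h.zero_mem))
  refine ⟨(‖Ω‖ * R).toNNReal, fun v => h.lengthNorm_le fun x hx => ?_⟩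
  rw [Real.coe_toNNReal _ (by positivity)]
  refine (le_abs_self _).trans ((Ω.le_opNorm₂ x v).trans ?_)
  gcongr
  exact hR x hx

theorem lengthNorm_continuous (h : IsSymplecticBody Ω D) : Continuous (lengthNorm Ω D) := by
  obtain ⟨C, hC⟩ := h.exists_lengthNorm_le
  refine (LipschitzWith.of_le_add_mul C fun v w => ?_).continuous
  have := h.lengthNorm_add_le w (v - w)
  rw [add_sub_cancel] at this
  rw [dist_eq_norm]
  linarith [hC (v - w)]

/-- D contains a ball, so N(v) controls the operator norm of Ω(·, v); nondegeneracy makes v ↦ Ω(·,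
v) injective, hence bounded below in finite dimension. -/
theorem exists_norm_le_lengthNorm [FiniteDimensional ℝ V] (h : IsSymplecticBody Ω D) :
    ∃ C : ℝ≥0, ∀ v, ‖v‖ ≤ C * lengthNorm Ω D v := by
  obtain ⟨r, hr, hball⟩ := Metric.mem_nhds_iff.1 (mem_interior_iff_mem_nhds.1 h.zero_mem)
  have hinj : LinearMap.ker (Ω.flip.toLinearMap) = ⊥ := by
    refine LinearMap.ker_eq_bot'.2 fun v hv => ?_
    refine (SeparatingDual.eq_zero_iff_forall_dual_eq_zero (R := ℝ) v).2 fun ℓ => ?_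
    obtain ⟨w, hw⟩ := h.nondeg ℓ
    rw [← hw, h.swap]
    have := congrArg (fun f : V →L[ℝ] ℝ => f w) hv
    simpa using this
  obtain ⟨K, -, hK⟩ := LinearMap.exists_antilipschitzWith _ hinj
  have hK' : ∀ v, ‖v‖ ≤ K * ‖Ω.flip v‖ := fun v => by
    simpa using hK.le_mul_dist v 0
  refine ⟨K * (2 / r).toNNReal, fun v => (hK' v).trans ?_⟩
  rw [NNReal.coe_mul, mul_assoc, Real.coe_toNNReal _ (by positivity)]
  refine mul_le_mul_of_nonneg_left ?_ K.2
  have hN := h.lengthNorm_nonneg v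
  have key : ∀ y : V, ‖y‖ < r → |Ω y v| ≤ lengthNorm Ω D v := fun y hy => by
    refine abs_le'.2 ⟨h.le_lengthNorm (hball (by simpa using hy)) v, ?_⟩
    have := h.le_lengthNorm (x := -y) (hball (by simpa using hy)) v
    simpa using this
  refine ContinuousLinearMap.opNorm_le_bound _ (by positivity) fun x => ?_
  rcases eq_or_ne x 0 with rfl | hx
  · simp
  have hx' : 0 < ‖x‖ := norm_pos_iff.2 hx
  -- The rescaled vector has norm r/2, inside the open ball.
  have := key ((r / (2 * ‖x‖)) • x) (by
    rw [norm_smul, Real.norm_of_nonneg (by positivity)]; field_simp; linarith)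
  rw [map_smul, smul_apply, smul_eq_mul, abs_mul, abs_of_nonneg (by positivity)] at this
  rw [ContinuousLinearMap.flip_apply, Real.norm_eq_abs]
  calc |Ω x v| = 2 * ‖x‖ / r * (r / (2 * ‖x‖) * |Ω x v|) := by field_simp
    _ ≤ 2 * ‖x‖ / r * lengthNorm Ω D v := by gcongr
    _ = _ := by ring

theorem lengthNorm_pos [FiniteDimensional ℝ V] (h : IsSymplecticBody Ω D) {v : V} (hv : v ≠ 0) :
    0 < lengthNorm Ω D v := by
  obtain ⟨C, hC⟩ := h.exists_norm_le_lengthNorm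
  by_contra! hle
  have := hC v
  have h2 : (C : ℝ) * lengthNorm Ω D v ≤ 0 := mul_nonpos_of_nonneg_of_nonpos C.2 hle
  exact hv (norm_le_zero_iff.1 (this.trans h2))

/-- The bipolar theorem. -/
theorem mem_of_forall_le (h : IsSymplecticBody Ω D) {x : V}
    (hx : ∀ v, Ω x v ≤ lengthNorm Ω D v) : x ∈ D := by
  by_contra hxD
  obtain ⟨ℓ, u, hu, hux⟩ := geometric_hahn_banach_closed_point h.convex h.isCompact.isClosed hxD
  obtain ⟨v, hv⟩ := h.nondeg ℓ
  have h1 := h.lengthNorm_le (v := v) (c := u) fun y hy => by rw [hv]; exact (hu y hy).le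
  have h2 := hx v
  rw [hv] at h2
  linarith

/-- Enlarging the body lengthens every loop; this is the source of the monotonicity of the capacity.
-/
theorem lengthNorm_mono {D' : Set V} (h : IsSymplecticBody Ω D) (h' : IsSymplecticBody Ω D')
    (hD : D ⊆ D') (v : V) : lengthNorm Ω D v ≤ lengthNorm Ω D' v :=
  h.lengthNorm_le fun _ hx => h'.le_lengthNorm (hD hx) v

end IsSymplecticBody

end LengthNorm

/-! ### The isoperimetric problem -/

section Isoperimetric

variable {V : Type*} [NormedAddCommGroup V] [NormedSpace ℝ V] [FiniteDimensional ℝ V]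
  {Ω : V →L[ℝ] V →L[ℝ] ℝ} {D : Set V}

/-- Curves starting at the origin which move with speed at most one with respect to `D`. -/
def unitSpeedCurves (Ω : V →L[ℝ] V →L[ℝ] ℝ) (D : Set V) : Set (ℝ → V) :=
  {z | z 0 = 0 ∧ ∀ s t, s ≤ t → lengthNorm Ω D (z t - z s) ≤ t - s}

/-- Loops of length at most `P`. -/
def unitSpeedLoops (Ω : V →L[ℝ] V →L[ℝ] ℝ) (D : Set V) (P : ℝ) : Set (ℝ → V) :=
  {z ∈ unitSpeedCurves Ω D | z P = 0}

/-- Twice the symplectic area of a loop. -/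
noncomputable def loopArea (Ω : V →L[ℝ] V →L[ℝ] ℝ) (P : ℝ) (z : ℝ → V) : ℝ :=
  ∫ t in (0 : ℝ)..P, Ω (z t) (deriv z t)

namespace IsSymplecticBody

theorem exists_lipschitz (h : IsSymplecticBody Ω D) :
    ∃ C : ℝ≥0, ∀ z ∈ unitSpeedCurves Ω D, LipschitzWith C z := by
  obtain ⟨C, hC⟩ := h.exists_norm_le_lengthNorm
  refine ⟨C, fun z hz => LipschitzWith.of_dist_le_mul fun s t => ?_⟩
  wlog hst : t ≤ s generalizing s t
  · rw [dist_comm, dist_comm s]; exact this t s (le_of_not_ge hst)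
  rw [dist_eq_norm, Real.dist_eq, abs_of_nonneg (by linarith)]
  exact (hC _).trans (mul_le_mul_of_nonneg_left (hz.2 t s hst) C.2)

omit [FiniteDimensional ℝ V] in
theorem unitSpeedCurves_convex (h : IsSymplecticBody Ω D) : Convex ℝ (unitSpeedCurves Ω D) := by
  intro z hz w hw a b ha hb hab
  refine ⟨by simp [hz.1, hw.1], fun s t hst => ?_⟩
  have h1 : (a • z + b • w) t - (a • z + b • w) s = a • (z t - z s) + b • (w t - w s) := by
    simp only [Pi.add_apply, Pi.smul_apply]; module
  rw [h1]
  refine (h.lengthNorm_add_le _ _).trans ?_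
  rw [h.lengthNorm_smul ha, h.lengthNorm_smul hb]
  have := mul_le_mul_of_nonneg_left (hz.2 s t hst) ha
  have := mul_le_mul_of_nonneg_left (hw.2 s t hst) hb
  have h3 : t - s = a * (t - s) + b * (t - s) := by rw [← add_mul, hab, one_mul]
  linarith

/-- Compactness refers to pointwise convergence on `ℝ → V`. The speed condition is stated for
increments, hence is closed, and z t stays in a ball of radius C|t|, so Tychonoff takes the place of
Arzelà-Ascoli. -/
theorem unitSpeedLoops_isCompact (h : IsSymplecticBody Ω D) (P : ℝ) :
    IsCompact (unitSpeedLoops Ω D P) := by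
  have := FiniteDimensional.proper ℝ V
  obtain ⟨C, hC⟩ := h.exists_lipschitz
  refine IsCompact.of_isClosed_subset
    (isCompact_univ_pi fun t : ℝ => isCompact_closedBall (0 : V) (C * |t|)) ?_ ?_
  · have hN := h.lengthNorm_continuous
    rw [show unitSpeedLoops Ω D P = ({z | z 0 = 0} ∩ (⋂ (s : ℝ) (t : ℝ) (_ : s ≤ t),
      {z | lengthNorm Ω D (z t - z s) ≤ t - s})) ∩ {z | z P = 0} by
        ext; simp [unitSpeedLoops, unitSpeedCurves]]
    refine IsClosed.inter (IsClosed.inter (isClosed_eq (by fun_prop) continuous_const) ?_)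
      (isClosed_eq (by fun_prop) continuous_const)
    refine isClosed_iInter fun s => isClosed_iInter fun t => isClosed_iInter fun _ => ?_
    exact isClosed_le (hN.comp (by fun_prop)) continuous_const
  · intro z hz t _
    have := (hC z hz.1).dist_le_mul t 0
    simpa [hz.1.1] using this

/-- The area is the uniform limit of Riemann-Stieltjes sums. -/
theorem exists_abs_loopArea_sub_sum_le (h : IsSymplecticBody Ω D) {P : ℝ} (hP : 0 < P) :
    ∃ K : ℝ, ∀ k : ℕ, ∀ z ∈ unitSpeedLoops Ω D P,
      |loopArea Ω P z - ∑ i ∈ Finset.range (k + 1), Ω (z (i * (P / (k + 1))))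
        (z ((i + 1 : ℕ) * (P / (k + 1))) - z (i * (P / (k + 1))))| ≤ K / (k + 1) := by
  obtain ⟨C, hC⟩ := h.exists_lipschitz
  have : CompleteSpace V := FiniteDimensional.complete ℝ V
  refine ⟨‖Ω‖ * C * P * (C * P), fun k z hz => ?_⟩
  have hL := hC z hz.1
  have hd : 0 ≤ P / (k + 1 : ℝ) := by positivity
  have hmono : Monotone fun i : ℕ => (i : ℝ) * (P / (k + 1)) := fun i j hij => by
    dsimp only; gcongr
  have e0 : ((0 : ℕ) : ℝ) * (P / (k + 1)) = 0 := by simp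
  have e1 : ((k + 1 : ℕ) : ℝ) * (P / (k + 1)) = P := by push_cast; field_simp
  have := abs_integral_bilin_sub_sum_le Ω (γ := z) (γ' := deriv z) hmono (k + 1)
    (ρ := C * (P / (k + 1))) hL.continuous.continuousOn
    (intervalIntegrable_deriv_of_lipschitzOn hL.lipschitzOnWith)
    (fun x _ y _ _ => integral_deriv_of_lipschitzOn hL.lipschitzOnWith)
    (fun i _ x hx => by
      have := hL.dist_le_mul x (i * (P / (k + 1)))
      rw [dist_eq_norm, Real.dist_eq, abs_of_nonneg (by linarith [hx.1])] at this
      refine this.trans (mul_le_mul_of_nonneg_left ?_ C.2)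
      have h2 := hx.2
      push_cast at h2
      linarith)
  simp only [e0, e1] at this
  refine this.trans ?_
  have hn : ∫ s in (0 : ℝ)..P, ‖deriv z s‖ ≤ C * P := by
    have := intervalIntegral.norm_integral_le_of_norm_le_const (a := 0) (b := P)
      (f := fun s => ‖deriv z s‖) (C := C) fun x _ => by
        simpa using norm_deriv_le_of_lipschitz hL
    rw [sub_zero, abs_of_pos hP] at this
    exact (le_abs_self _).trans this
  calc _ ≤ ‖Ω‖ * (C * (P / (k + 1))) * (C * P) := by gcongr
    _ = _ := by ring

/-- Derivatives do not converge under pointwise convergence of curves. The Riemann-Stieltjes sums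
involve finitely many values only and approximate the area uniformly on the compact set of loops. -/
theorem loopArea_continuousOn (h : IsSymplecticBody Ω D) {P : ℝ} (hP : 0 < P) :
    ContinuousOn (loopArea Ω P) (unitSpeedLoops Ω D P) := by
  obtain ⟨K, key⟩ := h.exists_abs_loopArea_sub_sum_le hP
  let S : ℕ → (ℝ → V) → ℝ := fun k z => ∑ i ∈ Finset.range (k + 1),
    Ω (z (i * (P / (k + 1)))) (z ((i + 1 : ℕ) * (P / (k + 1))) - z (i * (P / (k + 1))))
  have hS : ∀ k, Continuous (S k) := fun k => by fun_prop
  refine TendstoUniformlyOn.continuousOn (F := S) (p := atTop) ?_ (Eventually.of_forall fun k => (hS k).continuousOn).frequently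
  rw [Metric.tendstoUniformlyOn_iff]
  intro ε hε
  have hlim : Tendsto (fun k : ℕ => K / ((k : ℝ) + 1)) atTop (𝓝 0) :=
    (tendsto_const_div_atTop_nhds_zero_nat (K)).comp (tendsto_add_atTop_nat 1) |>.congr
      fun k => by simp
  filter_upwards [hlim.eventually_lt_const hε] with k hk z hz
  exact (key k z hz).trans_lt hk

end IsSymplecticBody

end Isoperimetric

/-! ### Smooth functions of Lipschitz curves. -/

section CompLipschitz

variable {V W : Type*} [NormedAddCommGroup V] [NormedSpace ℝ V] [FiniteDimensional ℝ V]
  [NormedAddCommGroup W] [NormedSpace ℝ W]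

theorem exists_lipschitzOn_comp {F : V → W} (hF : ContDiff ℝ 1 F) {z : ℝ → V} {C : ℝ≥0}
    (hz : LipschitzWith C z) (a b : ℝ) :
    ∃ C' : ℝ≥0, LipschitzOnWith C' (fun t => F (z t)) (uIcc a b) := by
  have := FiniteDimensional.proper ℝ V
  obtain ⟨R, hR⟩ := ((isCompact_uIcc (a := a) (b := b)).image hz.continuous).isBounded.subset_closedBall 0
  obtain ⟨K, hK⟩ := hF.contDiffOn.exists_lipschitzOnWith (by decide) (convex_closedBall (0 : V) R)
    (isCompact_closedBall _ _)
  exact ⟨K * C, hK.comp hz.lipschitzOnWith fun t ht => hR (mem_image_of_mem z ht)⟩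

end CompLipschitz

/-! ### First order conditions for loops of maximal area. -/

section EulerLagrange

variable {V : Type*} [NormedAddCommGroup V] [NormedSpace ℝ V] [FiniteDimensional ℝ V]
  {Ω : V →L[ℝ] V →L[ℝ] ℝ} {D : Set V}

/-- Integration by parts for Lipschitz curves. -/
theorem integral_bilin_deriv_add (B : V →L[ℝ] V →L[ℝ] ℝ) {z w : ℝ → V} {C : ℝ≥0}
    (hz : LipschitzWith C z) (hw : LipschitzWith C w) (a b : ℝ) :
    (∫ t in a..b, B (deriv z t) (w t)) + ∫ t in a..b, B (z t) (deriv w t)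
      = B (z b) (w b) - B (z a) (w a) := by
  have : CompleteSpace V := FiniteDimensional.complete ℝ V
  have hF : ContDiff ℝ 1 fun p : V × V => B p.1 p.2 := by fun_prop
  obtain ⟨C', hC'⟩ := exists_lipschitzOn_comp hF (hz.prodMk hw) a b
  have h1 : IntervalIntegrable (fun t => B (deriv z t) (w t)) volume a b :=
    intervalIntegrable_bilin B.flip hw.continuous.continuousOn
      (intervalIntegrable_deriv_of_lipschitzOn hz.lipschitzOnWith)
  have h2 : IntervalIntegrable (fun t => B (z t) (deriv w t)) volume a b :=
    intervalIntegrable_bilin B hz.continuous.continuousOn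
      (intervalIntegrable_deriv_of_lipschitzOn hw.lipschitzOnWith)
  rw [← intervalIntegral.integral_add h1 h2]
  refine (integral_of_lipschitzOn_of_ae_hasDerivAt hC' ?_).2
  filter_upwards [hz.ae_differentiableAt_real, hw.ae_differentiableAt_real] with t htz htw _
  have := (B.hasFDerivAt_of_bilinear htz.hasDerivAt.hasFDerivAt htw.hasDerivAt.hasFDerivAt).hasDerivAt
  simpa [add_comm] using this

namespace IsSymplecticBody

omit [FiniteDimensional ℝ V] in
-- An ellipse in a plane spanned by e, f with Ω(e, f) > 0 encloses positive area; it only has to be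
-- shrunk to admissible speed.
theorem exists_loopArea_pos [Nontrivial V] (h : IsSymplecticBody Ω D) {P : ℝ} (hP : 0 < P) :
    ∃ z ∈ unitSpeedLoops Ω D P, 0 < loopArea Ω P z := by
  obtain ⟨e, he⟩ := exists_ne (0 : V)
  obtain ⟨ℓ, hℓ⟩ := SeparatingDual.exists_ne_zero (R := ℝ) he
  obtain ⟨f, hf⟩ : ∃ f, 0 < Ω e f := by
    obtain ⟨f, hf⟩ := h.nondeg ℓ
    rcases lt_or_gt_of_ne hℓ with h1 | h1
    · exact ⟨-f, by rw [map_neg, hf]; linarith⟩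
    · exact ⟨f, by rw [hf]; exact h1⟩
  obtain ⟨C, hC⟩ := h.exists_lengthNorm_le
  -- A bound for the N-speed of the unscaled ellipse of period P; adding 1 makes it positive.
  set K : ℝ := C * (2 * π / P * (‖e‖ + ‖f‖)) + 1 with hK
  have hKpos : 0 < K := by positivity
  set k : ℝ := 2 * π / P with hk
  have hkpos : 0 < k := by positivity
  let z : ℝ → V := fun t => K⁻¹ • ((Real.cos (k * t) - 1) • e + Real.sin (k * t) • f)
  have hkt : ∀ t, HasDerivAt (fun t => k * t) k t := fun t => by
    simpa using (hasDerivAt_id t).const_mul k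
  have hderiv : ∀ t, HasDerivAt z
      (K⁻¹ • ((-(Real.sin (k * t)) * k) • e + (Real.cos (k * t) * k) • f)) t := fun t =>
    ((((hkt t).cos.sub_const 1).smul_const e).add ((hkt t).sin.smul_const f)).const_smul K⁻¹
  have hLip : ∀ s t, ‖z t - z s‖ ≤ K⁻¹ * (k * (‖e‖ + ‖f‖)) * ‖t - s‖ := fun s t => by
    refine Convex.norm_image_sub_le_of_norm_hasDerivWithin_le (s := univ)
      (fun x _ => (hderiv x).hasDerivWithinAt) (fun x _ => ?_) convex_univ trivial trivial
    rw [norm_smul, Real.norm_of_nonneg (by positivity)]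
    gcongr
    refine (norm_add_le _ _).trans ?_
    rw [norm_smul, norm_smul, mul_add, norm_mul, norm_mul, norm_neg, Real.norm_of_nonneg hkpos.le]
    have := Real.abs_sin_le_one (k * x)
    have := Real.abs_cos_le_one (k * x)
    simp only [Real.norm_eq_abs]
    gcongr <;> exact mul_le_of_le_one_left hkpos.le ‹_›
  have hkP : k * P = 2 * π := by rw [hk]; field_simp
  refine ⟨z, ⟨⟨by simp [z], fun s t hst => ?_⟩, by simp [z, hkP]⟩, ?_⟩
  · refine (hC _).trans ?_
    have h1 := mul_le_mul_of_nonneg_left (hLip s t) C.2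
    rw [Real.norm_of_nonneg (by linarith)] at h1
    refine h1.trans ?_
    have h2 : (C : ℝ) * (K⁻¹ * (k * (‖e‖ + ‖f‖))) ≤ 1 := by
      rw [mul_left_comm, inv_mul_le_iff₀ hKpos]; linarith
    change (C : ℝ) * (K⁻¹ * (k * (‖e‖ + ‖f‖)) * (t - s)) ≤ _
    rw [← mul_assoc]
    exact mul_le_of_le_one_left (by linarith) h2
  · have hval : ∀ t, Ω (z t) (deriv z t) = K⁻¹ ^ 2 * k * Ω e f * (1 - Real.cos (k * t)) := fun t => by
      rw [(hderiv t).deriv]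
      simp only [z, map_smul, map_add, smul_apply, add_apply, smul_eq_mul, h.alt, h.swap f e]
      linear_combination K⁻¹ ^ 2 * k * Ω e f * Real.sin_sq_add_cos_sq (k * t)
    have hint : ∫ t in (0 : ℝ)..P, (1 - Real.cos (k * t)) = P := by
      rw [intervalIntegral.integral_sub (by simp)
        (Continuous.intervalIntegrable (by fun_prop) _ _),
        intervalIntegral.integral_comp_mul_left _ hkpos.ne', hkP]
      simp
    rw [loopArea, intervalIntegral.integral_congr fun t _ => hval t,
      intervalIntegral.integral_const_mul, hint]
    positivity

/-- A maximiser of the area satisfies a first order condition. -/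
theorem integral_le_of_isMaxOn (h : IsSymplecticBody Ω D) {P : ℝ} {z : ℝ → V}
    (hz : z ∈ unitSpeedLoops Ω D P) (hmax : IsMaxOn (loopArea Ω P) (unitSpeedLoops Ω D P) z)
    {w : ℝ → V} (hw : w ∈ unitSpeedLoops Ω D P) :
    ∫ t in (0 : ℝ)..P, Ω (w t) (deriv z t) ≤ loopArea Ω P z := by
  obtain ⟨C, hC⟩ := h.exists_lipschitz
  have hLz := hC z hz.1
  have hLw := hC w hw.1
  have hint : ∀ {x y : ℝ → V}, LipschitzWith C x → LipschitzWith C y →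
      IntervalIntegrable (fun t => Ω (x t) (deriv y t)) volume 0 P := fun hx hy =>
    intervalIntegrable_bilin Ω hx.continuous.continuousOn
      (intervalIntegrable_deriv_of_lipschitzOn hy.lipschitzOnWith)
  -- The cross terms agree: both loops start and end at the origin, so integration by parts has no
  -- boundary term, and Ω is skew.
  have hparts : ∫ t in (0 : ℝ)..P, Ω (z t) (deriv w t) = ∫ t in (0 : ℝ)..P, Ω (w t) (deriv z t) := by
    have h1 := integral_bilin_deriv_add Ω hLz hLw 0 P
    rw [hz.1.1, hz.2, map_zero, zero_apply, zero_apply, sub_zero] at h1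
    have h2 : ∫ t in (0 : ℝ)..P, Ω (deriv z t) (w t) = -∫ t in (0 : ℝ)..P, Ω (w t) (deriv z t) := by
      rw [← intervalIntegral.integral_neg]
      exact intervalIntegral.integral_congr fun t _ => h.swap _ _
    linarith
  set a := loopArea Ω P z with ha
  set b := ∫ t in (0 : ℝ)..P, Ω (w t) (deriv z t) with hb
  -- The area is a quadratic form; this is its value on the admissible loop (1 - ε)z + εw.
  have key : ∀ ε ∈ Ioc (0 : ℝ) 1, (1 - ε) ^ 2 * a + 2 * ((1 - ε) * ε) * b + ε ^ 2 * loopArea Ω P w ≤ a := by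
    intro ε hε
    have hmem : (1 - ε) • z + ε • w ∈ unitSpeedLoops Ω D P :=
      ⟨h.unitSpeedCurves_convex hz.1 hw.1 (by linarith [hε.2]) hε.1.le (by ring), by
        simp [hz.2, hw.2]⟩
    refine le_trans (le_of_eq ?_) (hmax hmem)
    rw [loopArea, loopArea]
    have : ∀ᵐ t, t ∈ uIoc 0 P → Ω (((1 - ε) • z + ε • w) t) (deriv ((1 - ε) • z + ε • w) t) =
        (1 - ε) ^ 2 * Ω (z t) (deriv z t) + ((1 - ε) * ε) * Ω (w t) (deriv z t)
          + ((1 - ε) * ε) * Ω (z t) (deriv w t) + ε ^ 2 * Ω (w t) (deriv w t) := by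
      filter_upwards [hLz.ae_differentiableAt_real, hLw.ae_differentiableAt_real] with t h1 h2 _
      rw [((h1.hasDerivAt.const_smul (1 - ε)).add (h2.hasDerivAt.const_smul ε)).deriv]
      simp only [Pi.add_apply, Pi.smul_apply, map_add, map_smul, add_apply, smul_apply, smul_eq_mul]
      ring
    rw [intervalIntegral.integral_congr_ae this, intervalIntegral.integral_add,
      intervalIntegral.integral_add, intervalIntegral.integral_add]
    · simp only [intervalIntegral.integral_const_mul]
      rw [hparts, ha, loopArea]
      ring
    all_goals
      first
      | exact (hint hLz hLz).const_mul _
      | exact (hint hLw hLz).const_mul _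
      | exact (hint hLz hLw).const_mul _
      | exact (hint hLw hLw).const_mul _
      | exact ((hint hLz hLz).const_mul _).add ((hint hLw hLz).const_mul _)
      | exact (((hint hLz hLz).const_mul _).add ((hint hLw hLz).const_mul _)).add
          ((hint hLz hLw).const_mul _)
  -- Subtracting a and dividing by ε leaves an expression whose limit is 2(b - a).
  have key2 : ∀ ε ∈ Ioc (0 : ℝ) 1, (ε - 2) * a + 2 * (1 - ε) * b + ε * loopArea Ω P w ≤ 0 := by
    intro ε hε
    have := key ε hε
    have h3 : ε * ((ε - 2) * a + 2 * (1 - ε) * b + ε * loopArea Ω P w) ≤ 0 := by nlinarith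
    exact nonpos_of_mul_nonpos_right h3 hε.1
  have hlim : Tendsto (fun ε : ℝ => (ε - 2) * a + 2 * (1 - ε) * b + ε * loopArea Ω P w)
      (𝓝[>] 0) (𝓝 ((0 - 2) * a + 2 * (1 - 0) * b + 0 * loopArea Ω P w)) :=
    ((by fun_prop : Continuous fun ε : ℝ =>
      (ε - 2) * a + 2 * (1 - ε) * b + ε * loopArea Ω P w).tendsto 0).mono_left nhdsWithin_le_nhds
  have := le_of_tendsto hlim (by
    filter_upwards [Ioc_mem_nhdsGT (zero_lt_one (α := ℝ))] with ε hε using key2 ε hε)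
  linarith

/-- The Lagrange multiplier belonging to the closing condition. -/
theorem exists_multiplier (h : IsSymplecticBody Ω D) {P : ℝ} (hP : 0 < P) {z : ℝ → V}
    (hz : z ∈ unitSpeedLoops Ω D P) (hmax : IsMaxOn (loopArea Ω P) (unitSpeedLoops Ω D P) z) :
    ∃ c : V, ∀ w ∈ unitSpeedCurves Ω D,
      (∫ t in (0 : ℝ)..P, Ω (w t) (deriv z t)) + Ω c (w P) ≤ loopArea Ω P z := by
  obtain ⟨C, hC⟩ := h.exists_lipschitz
  have hLz := hC z hz.1
  set M := loopArea Ω P z with hM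
  let B : (ℝ → V) → ℝ := fun w => ∫ t in (0 : ℝ)..P, Ω (w t) (deriv z t)
  have hint : ∀ w : ℝ → V, Continuous w →
      IntervalIntegrable (fun t => Ω (w t) (deriv z t)) volume 0 P := fun w hw =>
    intervalIntegrable_bilin Ω hw.continuousOn
      (intervalIntegrable_deriv_of_lipschitzOn hLz.lipschitzOnWith)
  have hBadd : ∀ w w' : ℝ → V, Continuous w → Continuous w' → ∀ a b : ℝ,
      B (a • w + b • w') = a * B w + b * B w' := fun w w' hw hw' a b => by
    simp only [B, ← intervalIntegral.integral_const_mul]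
    rw [← intervalIntegral.integral_add ((hint w hw).const_mul a) ((hint w' hw').const_mul b)]
    simp
  -- The pairs of an attainable end point and a value not above the linearised area. The first order
  -- condition for loops says that (0, M) is not interior to this convex set; a supporting
  -- hyperplane there supplies the multiplier.
  let A : Set (V × ℝ) := {p | ∃ w ∈ unitSpeedCurves Ω D, w P = p.1 ∧ p.2 ≤ B w}
  have hconv : Convex ℝ A := by
    rintro ⟨x, r⟩ ⟨w, hw, rfl, hr⟩ ⟨y, r'⟩ ⟨w', hw', rfl, hr'⟩ a b ha hb hab
    refine ⟨a • w + b • w', h.unitSpeedCurves_convex hw hw' ha hb hab, by simp, ?_⟩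
    rw [hBadd w w' (hC w hw).continuous (hC w' hw').continuous]
    simp only [Prod.snd_add, Prod.smul_snd, smul_eq_mul]
    exact add_le_add (mul_le_mul_of_nonneg_left hr ha) (mul_le_mul_of_nonneg_left hr' hb)
  obtain ⟨C', hC'⟩ := h.exists_lengthNorm_le
  -- Segments to end points closer than δ are slow enough to be admissible, which gives A interior
  -- points.
  obtain ⟨δ, hδ, hδC⟩ : ∃ δ : ℝ, 0 < δ ∧ ∀ x : V, ‖x‖ < δ → lengthNorm Ω D x ≤ P := by
    refine ⟨P / (C' + 1), by positivity, fun x hx => (hC' x).trans ?_⟩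
    rw [lt_div_iff₀ (by positivity)] at hx
    nlinarith [norm_nonneg x]
  have hline : ∀ x : V, ‖x‖ < δ → (fun t : ℝ => (t / P) • x) ∈ unitSpeedCurves Ω D := by
    refine fun x hx => ⟨by simp, fun s t hst => ?_⟩
    rw [← sub_smul, ← sub_div, h.lengthNorm_smul (by have := sub_nonneg.2 hst; positivity), div_mul_eq_mul_div,
      div_le_iff₀ hP]
    exact mul_le_mul_of_nonneg_left (hδC x hx) (sub_nonneg.2 hst)
  obtain ⟨K, hK⟩ : ∃ K : ℝ, ∀ x : V, ‖x‖ < δ → -K ≤ B fun t : ℝ => (t / P) • x := by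
    have e : ∀ x : V, (B fun t : ℝ => (t / P) • x) =
        Ω x (∫ t in (0 : ℝ)..P, (t / P) • deriv z t) := fun x => by
      have : CompleteSpace V := FiniteDimensional.complete ℝ V
      rw [← (Ω x).intervalIntegral_comp_comm]
      · simp [B]
      · exact (intervalIntegrable_deriv_of_lipschitzOn hLz.lipschitzOnWith).continuousOn_smul
          (by fun_prop)
    refine ⟨‖Ω‖ * δ * ‖∫ t in (0 : ℝ)..P, (t / P) • deriv z t‖, fun x hx => ?_⟩
    rw [e]
    refine (abs_le.1 ((Ω.le_opNorm₂ x _).trans ?_)).1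
    gcongr
  have hball : Metric.ball (0 : V) δ ×ˢ Iio (-K) ⊆ A := by
    rintro ⟨x, r⟩ ⟨hx, hr⟩
    have hx' : ‖x‖ < δ := by simpa using hx
    exact ⟨_, hline x hx', by simp [hP.ne'], (mem_Iio.1 hr).le.trans (hK x hx')⟩
  have hopen : IsOpen (Metric.ball (0 : V) δ ×ˢ Iio (-K)) := Metric.isOpen_ball.prod isOpen_Iio
  have hnot : ((0 : V), M) ∉ interior A := by
    intro hmem
    have hcont : Tendsto (fun ε : ℝ => ((0 : V), M + ε)) (𝓝[>] 0) (𝓝 (0, M + 0)) :=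
      ((by fun_prop : Continuous fun ε : ℝ => ((0 : V), M + ε)).tendsto 0).mono_left
        nhdsWithin_le_nhds
    rw [add_zero] at hcont
    obtain ⟨ε, hεA, hε⟩ := ((hcont.eventually (mem_interior_iff_mem_nhds.1 hmem)).and
      self_mem_nhdsWithin).exists
    obtain ⟨w, hw, hwP, hwB⟩ := hεA
    have := h.integral_le_of_isMaxOn hz hmax ⟨hw, hwP⟩
    have hε' : 0 < ε := hε
    change M + ε ≤ B w at hwB
    linarith
  obtain ⟨f, hf0, hf⟩ := geometric_hahn_banach_of_nonempty_interior_point hconv hnot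
    ⟨(0, -K - 1), interior_maximal hball hopen ⟨by simpa using hδ, by simp⟩⟩
  set ℓ : V →L[ℝ] ℝ := f.comp (.inl ℝ V ℝ)
  set μ : ℝ := f (0, 1) with hμ
  have hfe : ∀ x r, f (x, r) = ℓ x + r * μ := fun x r => by
    have : ((x, r) : V × ℝ) = (x, 0) + r • (0, 1) := by simp
    rw [this, map_add, map_smul, smul_eq_mul]
    rfl
  have hμ0 : 0 ≤ μ := by
    by_contra! hneg
    have hN : ∀ r < -K, r * μ ≤ M * μ := fun r hr => by
      have := hf _ (hball ⟨by simpa using hδ, hr⟩ : ((0 : V), r) ∈ A)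
      simpa [hfe] using this
    have := hN (min (-K) M - 1) (by linarith [min_le_left (-K) M])
    nlinarith [min_le_right (-K) M]
  -- The hyperplane is not vertical: for μ = 0 the functional ℓ would be nonpositive on a ball,
  -- hence zero, and f would vanish.
  have hμpos : 0 < μ := by
    refine lt_of_le_of_ne hμ0 fun hμ0 => hf0 ?_
    have hℓ : ∀ x, ‖x‖ < δ → ℓ x ≤ 0 := fun x hx => by
      have := hf _ (hball ⟨by simpa using hx, by simp⟩ : (x, -K - 1) ∈ A)
      simpa [hfe, ← hμ0] using this
    have hℓ0 : ℓ = 0 := by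
      ext x
      have hs : ∃ s : ℝ, 0 < s ∧ s * ‖x‖ < δ := by
        refine ⟨δ / (‖x‖ + 1), by positivity, ?_⟩
        rw [div_mul_eq_mul_div, div_lt_iff₀ (by positivity)]
        nlinarith [norm_nonneg x]
      obtain ⟨s, hs, hsx⟩ := hs
      have h1 := hℓ (s • x) (by rwa [norm_smul, Real.norm_of_nonneg hs.le])
      have h2 := hℓ (-(s • x)) (by rwa [norm_neg, norm_smul, Real.norm_of_nonneg hs.le])
      rw [map_neg] at h2
      rw [map_smul, smul_eq_mul] at h1 h2
      have : s * ℓ x = 0 := by linarith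
      simpa [hs.ne'] using this
    refine ContinuousLinearMap.ext fun p => ?_
    rw [← Prod.mk.eta (p := p), hfe, hℓ0, ← hμ0]
    simp
  obtain ⟨c, hc⟩ := h.nondeg (μ⁻¹ • ℓ)
  refine ⟨-c, fun w hw => ?_⟩
  have h1 := hf (w P, B w) ⟨w, hw, rfl, le_rfl⟩
  rw [hfe, hfe, map_zero, zero_add] at h1
  have h2 : Ω (-c) (w P) = μ⁻¹ * ℓ (w P) := by
    rw [h.swap, map_neg, neg_neg, hc]; rfl
  rw [h2]
  change B w + _ ≤ M
  have h3 : μ⁻¹ * (ℓ (w P) + B w * μ) ≤ μ⁻¹ * (M * μ) := by gcongr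
  have h4 : μ⁻¹ * (B w * μ) = B w := by field_simp
  have h5 : μ⁻¹ * (M * μ) = M := by field_simp
  linarith

end IsSymplecticBody

end EulerLagrange

/-! ### Extremals of the isoperimetric problem. -/

section Minimizer

variable {V : Type*} [NormedAddCommGroup V] [NormedSpace ℝ V] [FiniteDimensional ℝ V]
  {Ω : V →L[ℝ] V →L[ℝ] ℝ} {D : Set V}

namespace IsSymplecticBody

omit [FiniteDimensional ℝ V] in
-- One half of the duality between the gauge of D and N: the gauge at x is the supremum of Ω x v
-- over N(v) ≤ 1. The other half, `gauge_le`, rests on the bipolar theorem.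
theorem le_gauge (h : IsSymplecticBody Ω D) {v : V} (hv : lengthNorm Ω D v ≤ 1) (x : V) :
    Ω x v ≤ gauge D x := by
  have habs : Absorbent ℝ D := absorbent_nhds_zero (mem_interior_iff_mem_nhds.1 h.zero_mem)
  refine le_of_forall_gt_imp_ge_of_dense fun r hr => ?_
  obtain ⟨b, hb0, hbr, y, hy, rfl⟩ := exists_lt_of_gauge_lt habs hr
  simp only [map_smul, smul_apply, smul_eq_mul]
  have := (h.le_lengthNorm hy v).trans hv
  nlinarith

theorem gauge_le (h : IsSymplecticBody Ω D) {x : V} {r : ℝ} (hr : 0 ≤ r)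
    (hx : ∀ v, lengthNorm Ω D v ≤ 1 → Ω x v ≤ r) : gauge D x ≤ r := by
  refine le_of_forall_pos_le_add fun ε hε => gauge_le_of_mem (by positivity) ?_
  refine ⟨(r + ε)⁻¹ • x, h.mem_of_forall_le fun v => ?_, smul_inv_smul₀ (by positivity) x⟩
  simp only [map_smul, smul_apply, smul_eq_mul]
  rw [inv_mul_le_iff₀ (by positivity)]
  rcases eq_or_ne v 0 with rfl | hv
  · simp [h.lengthNorm_zero]
  have hN := h.lengthNorm_pos hv
  have := hx ((lengthNorm Ω D v)⁻¹ • v) (by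
    rw [h.lengthNorm_smul (by positivity), inv_mul_cancel₀ hN.ne'])
  rw [map_smul, smul_eq_mul, inv_mul_le_iff₀ hN] at this
  nlinarith

/-- Comparison of a maximiser with the curve in which a short arc is replaced by a segment. -/
theorem mul_le_of_isMaxOn (h : IsSymplecticBody Ω D) {P : ℝ} {z : ℝ → V}
    (hz : z ∈ unitSpeedLoops Ω D P) {c : V} {M : ℝ}
    (hM : ∫ t in (0 : ℝ)..P, Ω (z t) (deriv z t) = M)
    (hc : ∀ w ∈ unitSpeedCurves Ω D,
      (∫ t in (0 : ℝ)..P, Ω (w t) (deriv z t)) + Ω c (w P) ≤ M) :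
    ∃ K : ℝ, ∀ s t v, 0 ≤ s → s ≤ t → t ≤ P → lengthNorm Ω D v ≤ 1 →
      (t - s) * Ω (z t + c) v ≤ Ω (z t + c) (z t - z s) + K * (t - s) ^ 2 := by
  obtain ⟨C, hC⟩ := h.exists_norm_le_lengthNorm
  have hLz : LipschitzWith C z := LipschitzWith.of_dist_le_mul fun s t => by
    wlog hst : t ≤ s generalizing s t
    · rw [dist_comm, dist_comm s]; exact this t s (le_of_not_ge hst)
    rw [dist_eq_norm, Real.dist_eq, abs_of_nonneg (by linarith)]
    exact (hC _).trans (mul_le_mul_of_nonneg_left (hz.1.2 t s hst) C.2)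
  have hint : ∀ (w : ℝ → V) (a b : ℝ), Continuous w →
      IntervalIntegrable (fun t => Ω (w t) (deriv z t)) volume a b := fun w a b hw =>
    intervalIntegrable_bilin Ω hw.continuousOn
      (intervalIntegrable_deriv_of_lipschitzOn hLz.lipschitzOnWith)
  refine ⟨‖Ω‖ * (2 * C) * C, fun s t v hs hst htP hv => ?_⟩
  -- w follows z up to time s, runs with constant velocity v until t, and then follows a translate
  -- of z.
  let w : ℝ → V := fun τ => z (min τ s) + (max s (min τ t) - s) • v + (z (max τ t) - z t)
  have hwmem : w ∈ unitSpeedCurves Ω D := by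
    refine ⟨?_, fun a b hab => ?_⟩
    · simp [w, min_eq_left hs, min_eq_left (hs.trans hst), max_eq_left hs, max_eq_right (hs.trans hst),
        hz.1.1]
    · have e : w b - w a = (z (min b s) - z (min a s))
          + ((max s (min b t) - max s (min a t)) • v + (z (max b t) - z (max a t))) := by
        simp only [w]; module
      have h1 : min a s ≤ min b s := by gcongr
      have h2 : max s (min a t) ≤ max s (min b t) := by gcongr
      have h3 : max a t ≤ max b t := by gcongr
      rw [e]
      refine (h.lengthNorm_add_le _ _).trans ((add_le_add_right (h.lengthNorm_add_le _ _) _).trans ?_)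
      rw [h.lengthNorm_smul (sub_nonneg.2 h2)]
      have := hz.1.2 _ _ h1
      have := hz.1.2 _ _ h3
      have := mul_le_mul_of_nonneg_left hv (sub_nonneg.2 h2)
      -- The clocks of the three phases add up to the original time plus a constant, so the speed
      -- bounds add up to at most one.
      have hsum : ∀ x, min x s + max s (min x t) + max x t = x + s + t := fun x => by
        rcases le_total x s with hx | hx <;> rcases le_total x t with hx' | hx' <;>
          simp [hx, hx', hst] <;> linarith
      linarith [hsum a, hsum b]
  have hcw : Continuous w := by
    have := hLz.continuous
    fun_prop
  set δ := (t - s) • v - (z t - z s) with hδ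
  have hwP : w P = δ := by
    simp [w, hδ, min_eq_right (hst.trans htP), min_eq_right htP, max_eq_right hst, max_eq_left htP, hz.2]
    module
  -- Before s the curves coincide; after t they differ by the constant δ, which pairs with z P - z t
  -- = -z t to Ω(z t, δ).
  have hdiff : (∫ τ in (0 : ℝ)..P, Ω (w τ) (deriv z τ)) - M
      = (∫ τ in s..t, Ω (w τ - z τ) (deriv z τ)) + Ω (z t) δ := by
    rw [← hM, ← intervalIntegral.integral_sub (hint w _ _ hcw) (hint z _ _ hLz.continuous)]
    have hcwz : Continuous fun τ => w τ - z τ := hcw.sub hLz.continuous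
    simp only [← sub_apply, ← map_sub]
    have i := fun a b => hint _ a b hcwz
    rw [← intervalIntegral.integral_add_adjacent_intervals (i 0 s) (i s P),
      ← intervalIntegral.integral_add_adjacent_intervals (i s t) (i t P)]
    have e1 : ∫ τ in (0 : ℝ)..s, Ω (w τ - z τ) (deriv z τ) = 0 := by
      rw [intervalIntegral.integral_congr (g := fun _ => (0 : ℝ))]
      · simp
      · intro τ hτ
        rw [uIcc_of_le hs] at hτ
        simp [w, min_eq_left hτ.2, min_eq_left (hτ.2.trans hst), max_eq_left hτ.2,
          max_eq_right (hτ.2.trans hst)]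
    have e2 : ∫ τ in t..P, Ω (w τ - z τ) (deriv z τ) = Ω (z t) δ := by
      have : CompleteSpace V := FiniteDimensional.complete ℝ V
      rw [intervalIntegral.integral_congr (g := fun τ => Ω δ (deriv z τ))]
      · rw [(Ω δ).intervalIntegral_comp_comm
          (intervalIntegrable_deriv_of_lipschitzOn hLz.lipschitzOnWith),
          integral_deriv_of_lipschitzOn hLz.lipschitzOnWith, hz.2, h.swap, zero_sub, map_neg,
          neg_apply, neg_neg]
      · intro τ hτ
        rw [uIcc_of_le htP] at hτ
        have : w τ - z τ = δ := by
          simp [w, hδ, min_eq_right (hst.trans hτ.1), min_eq_right hτ.1, max_eq_right hst,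
            max_eq_left hτ.1]
          module
        simp only [this]
    rw [e1, e2, zero_add]
  -- Between s and t the curves are O(t - s) apart, so this interval contributes only a quadratic
  -- error.
  have hsmall : |∫ τ in s..t, Ω (w τ - z τ) (deriv z τ)| ≤ ‖Ω‖ * (2 * C * (t - s)) * C * |t - s| := by
    rw [← Real.norm_eq_abs]
    refine intervalIntegral.norm_integral_le_of_norm_le_const fun τ hτ => ?_
    rw [uIoc_of_le hst] at hτ
    refine (Ω.le_opNorm₂ _ _).trans ?_
    gcongr
    · have e : w τ - z τ = (z s - z τ) + (τ - s) • v := by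
        simp [w, min_eq_right hτ.1.le, min_eq_left hτ.2, max_eq_right hτ.1.le, max_eq_right hτ.2]
        module
      rw [e]
      refine (norm_add_le _ _).trans ?_
      have h1 := hLz.dist_le_mul s τ
      rw [dist_eq_norm, Real.dist_eq, abs_sub_comm, abs_of_pos (by linarith [hτ.1])] at h1
      have h2 := (hC v).trans (mul_le_of_le_one_right C.2 hv)
      rw [norm_smul, Real.norm_of_nonneg (by linarith [hτ.1])]
      have h3 : (C : ℝ) * (τ - s) ≤ C * (t - s) := mul_le_mul_of_nonneg_left (by linarith [hτ.2]) C.2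
      have h4 : (τ - s) * ‖v‖ ≤ (t - s) * C :=
        mul_le_mul (by linarith [hτ.2]) h2 (norm_nonneg _) (by linarith)
      linarith
    · exact norm_deriv_le_of_lipschitz hLz
  rw [abs_of_nonneg (sub_nonneg.2 hst)] at hsmall
  have h1 := hc w hwmem
  rw [hwP] at h1
  have h2 : Ω (z t + c) δ ≤ ‖Ω‖ * (2 * C) * C * (t - s) ^ 2 := by
    rw [map_add, add_apply]
    have := (abs_le.1 hsmall).1
    linarith
  rw [hδ, map_sub, map_smul, smul_eq_mul] at h2
  linarith

/-- The isoperimetric constant of `D`: twice the largest area enclosed by loops of length `P`. -/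
noncomputable def _root_.MinkowskiBilliard.isoConst (Ω : V →L[ℝ] V →L[ℝ] ℝ) (D : Set V) (P : ℝ) :
    ℝ :=
  sSup (loopArea Ω P '' unitSpeedLoops Ω D P)

theorem loopArea_le_isoConst (h : IsSymplecticBody Ω D) {P : ℝ} (hP : 0 < P) {z : ℝ → V}
    (hz : z ∈ unitSpeedLoops Ω D P) : loopArea Ω P z ≤ isoConst Ω D P :=
  le_csSup ((h.unitSpeedLoops_isCompact P).image_of_continuousOn
    (h.loopArea_continuousOn hP)).bddAbove (mem_image_of_mem _ hz)

theorem isoConst_pos [Nontrivial V] (h : IsSymplecticBody Ω D) {P : ℝ} (hP : 0 < P) :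
    0 < isoConst Ω D P := by
  obtain ⟨z, hz, hz0⟩ := h.exists_loopArea_pos hP
  exact hz0.trans_le (h.loopArea_le_isoConst hP hz)

omit [FiniteDimensional ℝ V] in
-- Division by t - s and the limit t ↓ s remove the quadratic error of the comparison with a
-- segment.
theorem _root_.MinkowskiBilliard.le_bilin_deriv_of_mul_le (Ω : V →L[ℝ] V →L[ℝ] ℝ) {γ : ℝ → V}
    (hγ : Continuous γ) {s P K : ℝ} {v : V} (hs : s < P) (hsd : DifferentiableAt ℝ γ s)
    (hK : ∀ t ∈ Ioo s P, (t - s) * Ω (γ t) v ≤ Ω (γ t) (γ t - γ s) + K * (t - s) ^ 2) :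
    Ω (γ s) v ≤ Ω (γ s) (deriv γ s) := by
  have hlim := (hasDerivAt_iff_tendsto_slope.1 hsd.hasDerivAt).mono_left
    (nhdsGT_le_nhdsNE s)
  have hγs : Tendsto γ (𝓝[>] s) (𝓝 (γ s)) := (hγ.tendsto s).mono_left
    nhdsWithin_le_nhds
  have hB : Continuous fun p : V × V => Ω p.1 p.2 := by fun_prop
  have l1 : Tendsto (fun t => Ω (γ t) v) (𝓝[>] s) (𝓝 (Ω (γ s) v)) :=
    (hB.tendsto (γ s, v)).comp (hγs.prodMk_nhds tendsto_const_nhds)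
  have l2 : Tendsto (fun t => Ω (γ t) (slope γ s t) + K * (t - s)) (𝓝[>] s)
      (𝓝 (Ω (γ s) (deriv γ s) + K * (s - s))) := by
    refine ((hB.tendsto (γ s, deriv γ s)).comp (hγs.prodMk_nhds hlim)).add ?_
    exact ((by fun_prop : Continuous fun t => K * (t - s)).tendsto s).mono_left nhdsWithin_le_nhds
  rw [sub_self, mul_zero, add_zero] at l2
  refine le_of_tendsto_of_tendsto l1 l2 ?_
  filter_upwards [Ioo_mem_nhdsGT hs] with t ht
  have hts : 0 < t - s := sub_pos.2 ht.1
  have := hK t ht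
  rw [← mul_le_mul_iff_right₀ hts, slope_def_module, map_smul, smul_eq_mul, mul_add,
    mul_inv_cancel_left₀ hts.ne']
  linarith

/-- The Euler-Lagrange inclusion for a loop of maximal area. -/
theorem exists_forall_le_deriv [Nontrivial V] (h : IsSymplecticBody Ω D) {P : ℝ} (hP : 0 < P) :
    ∃ (γ : ℝ → V) (C : ℝ≥0), LipschitzWith C γ ∧ γ P = γ 0 ∧
      ∫ t in (0 : ℝ)..P, Ω (γ t) (deriv γ t) = isoConst Ω D P ∧
      (∀ t, DifferentiableAt ℝ γ t → lengthNorm Ω D (deriv γ t) ≤ 1) ∧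
      ∀ t ∈ Ico 0 P, DifferentiableAt ℝ γ t → ∀ v, lengthNorm Ω D v ≤ 1 →
        Ω (γ t) v ≤ Ω (γ t) (deriv γ t) := by
  have hMpos := h.isoConst_pos hP
  obtain ⟨z₀, hz₀, -⟩ := h.exists_loopArea_pos hP
  obtain ⟨z, hz, hzmax⟩ := (h.unitSpeedLoops_isCompact P).exists_sSup_image_eq ⟨z₀, hz₀⟩
    (h.loopArea_continuousOn hP)
  set M := isoConst Ω D P with hM
  have hzM : loopArea Ω P z = M := hzmax.symm
  have hmax : IsMaxOn (loopArea Ω P) (unitSpeedLoops Ω D P) z := fun w hw => by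
    simp only [mem_ofPred_eq]
    rw [hzM]
    exact h.loopArea_le_isoConst hP hw
  obtain ⟨c, hc⟩ := h.exists_multiplier hP hz hmax
  rw [hzM] at hc
  obtain ⟨K, hK⟩ := h.mul_le_of_isMaxOn hz hzM hc
  obtain ⟨C, hC⟩ := h.exists_lipschitz
  have hLz := hC z hz.1
  -- The multiplier is absorbed by a translation, which leaves the area of a closed curve unchanged.
  set γ : ℝ → V := fun t => z t + c with hγ
  have hLγ : LipschitzWith C γ := LipschitzWith.of_dist_le_mul fun s t => by
    simpa [hγ] using hLz.dist_le_mul s t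
  have hγd : ∀ s t, γ t - γ s = z t - z s := fun s t => by simp [hγ]
  have hN1 : ∀ t, DifferentiableAt ℝ γ t → lengthNorm Ω D (deriv γ t) ≤ 1 := fun t ht => by
    have hlim := (hasDerivAt_iff_tendsto_slope.1 ht.hasDerivAt).mono_left
      (nhdsGT_le_nhdsNE t)
    refine le_of_tendsto ((h.lengthNorm_continuous.tendsto _).comp hlim) ?_
    filter_upwards [self_mem_nhdsWithin] with s hs
    have hs' : 0 < s - t := sub_pos.2 hs
    rw [Function.comp_apply, slope_def_module, h.lengthNorm_smul (by positivity), hγd,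
      inv_mul_le_iff₀ hs', mul_one]
    exact hz.1.2 _ _ (le_of_lt hs)
  have hopt : ∀ t ∈ Ico 0 P, DifferentiableAt ℝ γ t → ∀ v, lengthNorm Ω D v ≤ 1 →
      Ω (γ t) v ≤ Ω (γ t) (deriv γ t) := fun s hs hsd v hv =>
    le_bilin_deriv_of_mul_le Ω hLγ.continuous hs.2 hsd (K := K) fun t ht => by
      have := hK s t v hs.1 ht.1.le ht.2.le hv
      rwa [← hγd] at this
  have hdz : ∀ t, deriv γ t = deriv z t := fun t => by simp [hγ]
  have : CompleteSpace V := FiniteDimensional.complete ℝ V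
  have e1 : ∫ t in (0 : ℝ)..P, Ω (γ t) (deriv γ t) = M := by
    have i := intervalIntegrable_deriv_of_lipschitzOn (hLz.lipschitzOnWith (s := uIcc 0 P))
    simp only [hdz]
    simp only [hγ, map_add, add_apply]
    rw [intervalIntegral.integral_add (intervalIntegrable_bilin Ω hLz.continuous.continuousOn i)
      (intervalIntegrable_bilin Ω continuousOn_const i), (Ω c).intervalIntegral_comp_comm i,
      integral_deriv_of_lipschitzOn hLz.lipschitzOnWith, hz.2, hz.1.1, sub_zero, map_zero,
      add_zero]
    exact hzM
  exact ⟨γ, C, hLγ, by simp [hγ, hz.2, hz.1.1], e1, hN1, hopt⟩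

/-- The isoperimetric extremals, before normalisation. -/
theorem exists_extremal [Nontrivial V] (h : IsSymplecticBody Ω D) {P : ℝ} (hP : 0 < P) :
    ∃ (γ : ℝ → V) (C : ℝ≥0), LipschitzWith C γ ∧ γ P = γ 0 ∧
      (∀ t ∈ Icc 0 P, gauge D (γ t) = isoConst Ω D P / P) ∧
      ∀ᵐ t, t ∈ Icc 0 P → DifferentiableAt ℝ γ t ∧ lengthNorm Ω D (deriv γ t) = 1 ∧
        Ω (γ t) (deriv γ t) = isoConst Ω D P / P := by
  obtain ⟨γ, C, hLγ, hloop, hM', hN1, hopt⟩ := h.exists_forall_le_deriv hP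
  have hMpos := h.isoConst_pos hP
  set M := isoConst Ω D P
  -- γ' attains the supremum in the dual description of the gauge.
  have hgauge : ∀ t ∈ Ico 0 P, DifferentiableAt ℝ γ t → gauge D (γ t) = Ω (γ t) (deriv γ t) := by
    intro t ht htd
    refine le_antisymm (h.gauge_le ?_ (hopt t ht htd)) (h.le_gauge (hN1 t htd) _)
    simpa using hopt t ht htd 0 (by simp [h.lengthNorm_zero])
  obtain ⟨Kg, hKg⟩ := h.convex.lipschitz_gauge (mem_interior_iff_mem_nhds.1 h.zero_mem)
  have hLρ : LipschitzWith (Kg * C) fun t => gauge D (γ t) := hKg.comp hLγ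
  have hρ : ∀ᵐ t, t ∈ uIcc 0 P → HasDerivAt (fun t => gauge D (γ t)) 0 t := by
    have hne : ∀ᵐ t : ℝ, t ≠ P := by simp [ae_iff, measure_singleton]
    filter_upwards [hLγ.ae_differentiableAt_real, hLρ.ae_differentiableAt_real, hne] with s hs hsρ hsP hsI
    rw [uIcc_of_le hP.le] at hsI
    have hs' : s ∈ Ico 0 P := ⟨hsI.1, lt_of_le_of_ne hsI.2 hsP⟩
    have hd : HasDerivAt (fun t => gauge D (γ t) - Ω (γ t) (deriv γ s))
        (deriv (fun t => gauge D (γ t)) s - Ω (deriv γ s) (deriv γ s)) s :=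
      hsρ.hasDerivAt.sub ((Ω.flip (deriv γ s)).hasFDerivAt.comp_hasDerivAt s hs.hasDerivAt)
    -- With the velocity frozen at time s, gauge minus pairing is nonnegative and vanishes at s.
    -- Hence the derivative of the gauge along γ equals Ω(γ', γ') = 0.
    have hmin : IsLocalMin (fun t => gauge D (γ t) - Ω (γ t) (deriv γ s)) s :=
      Eventually.of_forall fun t => by
        simp only [hgauge s hs' hs, sub_self]
        exact sub_nonneg.2 (h.le_gauge (hN1 s hs) _)
    have := hmin.hasDerivAt_eq_zero hd
    rw [h.alt, sub_zero] at this
    rw [← this]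
    exact hsρ.hasDerivAt
  obtain ⟨R, hR⟩ := hLρ.lipschitzOnWith.absolutelyContinuousOnInterval.const_of_ae_hasDerivAt_zero hρ
  rw [uIcc_of_le hP.le] at hR
  have hae : ∀ᵐ t, t ∈ Icc 0 P → DifferentiableAt ℝ γ t ∧ Ω (γ t) (deriv γ t) = R := by
    have hne : ∀ᵐ t : ℝ, t ≠ P := by simp [ae_iff, measure_singleton]
    filter_upwards [hLγ.ae_differentiableAt_real, hne] with t ht htP htI
    exact ⟨ht, by rw [← hgauge t ⟨htI.1, lt_of_le_of_ne htI.2 htP⟩ ht, hR t htI]⟩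
  have hRM : R = M / P := by
    have e2 : ∫ t in (0 : ℝ)..P, Ω (γ t) (deriv γ t) = ∫ t in (0 : ℝ)..P, R := by
      refine intervalIntegral.integral_congr_ae ?_
      filter_upwards [hae] with t ht htI
      rw [uIoc_of_le hP.le] at htI
      exact (ht (Ioc_subset_Icc_self htI)).2
    rw [hM', intervalIntegral.integral_const, sub_zero, smul_eq_mul] at e2
    field_simp
    linarith
  have hRpos : 0 < R := by rw [hRM]; positivity
  rw [← hRM]
  refine ⟨γ, C, hLγ, hloop, hR, ?_⟩
  filter_upwards [hae] with t ht htI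
  obtain ⟨hd, hΩ⟩ := ht htI
  refine ⟨hd, le_antisymm (hN1 t hd) ?_, hΩ⟩
  have hN0 : deriv γ t ≠ 0 := fun h0 => by rw [h0, map_zero] at hΩ; exact hRpos.ne hΩ
  have hN := h.lengthNorm_pos hN0
  -- Duality for the normalised velocity gives Ω(γ, γ') ≤ R · N(γ'); the left side is R > 0, so the
  -- speed is at least one.
  have := h.le_gauge (v := (lengthNorm Ω D (deriv γ t))⁻¹ • deriv γ t) (by
    rw [h.lengthNorm_smul (by positivity), inv_mul_cancel₀ hN.ne']) (γ t)
  rw [hR t htI, map_smul, smul_eq_mul, hΩ, inv_mul_le_iff₀ hN] at this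
  nlinarith

end IsSymplecticBody

end Minimizer

/-! ### The isoperimetric inequality. -/

section IsoInequality

variable {V : Type*} [NormedAddCommGroup V] [NormedSpace ℝ V] [FiniteDimensional ℝ V]
  {Ω : V →L[ℝ] V →L[ℝ] ℝ} {D : Set V}

namespace IsSymplecticBody

omit [FiniteDimensional ℝ V] in
theorem intervalIntegrable_lengthNorm (h : IsSymplecticBody Ω D) {v : ℝ → V} {a b : ℝ}
    (hv : IntervalIntegrable v volume a b) :
    IntervalIntegrable (fun t => lengthNorm Ω D (v t)) volume a b := by
  obtain ⟨C, hC⟩ := h.exists_lengthNorm_le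
  rw [intervalIntegrable_iff] at hv ⊢
  refine Integrable.mono' (hv.norm.const_mul C)
    (h.lengthNorm_continuous.comp_aestronglyMeasurable hv.aestronglyMeasurable)
    (Eventually.of_forall fun t => ?_)
  rw [Real.norm_of_nonneg (h.lengthNorm_nonneg _)]
  exact hC _

theorem lengthNorm_integral_le (h : IsSymplecticBody Ω D) {v : ℝ → V} {a b : ℝ} (hab : a ≤ b)
    (hv : IntervalIntegrable v volume a b) :
    lengthNorm Ω D (∫ t in a..b, v t) ≤ ∫ t in a..b, lengthNorm Ω D (v t) := by
  have : CompleteSpace V := FiniteDimensional.complete ℝ V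
  refine h.lengthNorm_le fun x hx => ?_
  rw [← (Ω x).intervalIntegral_comp_comm hv]
  exact intervalIntegral.integral_mono hab (intervalIntegrable_bilin Ω continuousOn_const hv)
    (h.intervalIntegrable_lengthNorm hv) fun t => h.le_lengthNorm hx _

/-- Reparametrisation of a loop by (almost) arc length. -/
theorem integral_bilin_mul_sq_le_aux (h : IsSymplecticBody Ω D) {P : ℝ} (hP : 0 < P)
    {γ γ' : ℝ → V} {a b : ℝ} (hab : a < b) (hc : ContinuousOn γ (Icc a b)) (hloop : γ a = γ b)
    (hint : IntervalIntegrable γ' volume a b)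
    (hftc : ∀ x ∈ Icc a b, ∀ y ∈ Icc a b, x ≤ y → ∫ t in x..y, γ' t = γ y - γ x)
    {ε : ℝ} (hε : 0 < ε) :
    (∫ t in a..b, Ω (γ t) (γ' t)) * P ^ 2
      ≤ isoConst Ω D P * ((∫ t in a..b, lengthNorm Ω D (γ' t)) + ε * (b - a)) ^ 2 := by
  have : CompleteSpace V := FiniteDimensional.complete ℝ V
  have hsub : ∀ {x y}, x ∈ Icc a b → y ∈ Icc a b → uIcc x y ⊆ uIcc a b := fun hx hy => by
    rw [uIcc_of_le hab.le]; exact uIcc_subset_Icc hx hy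
  -- The summand ε makes the length parameter strictly increasing even where γ' vanishes, so that it
  -- can be inverted.
  set ν : ℝ → ℝ := fun t => lengthNorm Ω D (γ' t) + ε with hν
  have hνint : ∀ {x y}, x ∈ Icc a b → y ∈ Icc a b → IntervalIntegrable ν volume x y := fun hx hy =>
    (h.intervalIntegrable_lengthNorm (hint.mono_set (hsub hx hy))).add (by simp)
  have ha : a ∈ Icc a b := left_mem_Icc.2 hab.le
  have hb : b ∈ Icc a b := right_mem_Icc.2 hab.le
  set s : ℝ → ℝ := fun x => ∫ t in a..x, ν t with hs
  have hsdiff : ∀ {x y}, x ∈ Icc a b → y ∈ Icc a b → s y - s x = ∫ t in x..y, ν t := fun hx hy =>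
    intervalIntegral.integral_interval_sub_left (hνint ha hy) (hνint ha hx)
  have hN : ∀ {x y}, x ∈ Icc a b → y ∈ Icc a b → x ≤ y → lengthNorm Ω D (γ y - γ x) ≤ s y - s x := by
    intro x y hx hy hxy
    rw [hsdiff hx hy, ← hftc x hx y hy hxy]
    have i := hint.mono_set (hsub hx hy)
    refine (h.lengthNorm_integral_le hxy i).trans ?_
    exact intervalIntegral.integral_mono hxy (h.intervalIntegrable_lengthNorm i) (hνint hx hy)
      fun t => by simp [hν, hε.le]
  have hsmono : StrictMonoOn s (Icc a b) := by
    intro x hx y hy hxy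
    rw [← sub_pos, hsdiff hx hy]
    refine intervalIntegral.intervalIntegral_pos_of_pos (hνint hx hy) (fun t => ?_) hxy
    have := h.lengthNorm_nonneg (γ' t)
    simp only [hν]; linarith
  have hscont : ContinuousOn s (Icc a b) := by
    have := intervalIntegral.continuousOn_primitive_interval' (hνint ha hb) left_mem_uIcc
    rwa [uIcc_of_le hab.le] at this
  have hsa : s a = 0 := by simp [hs]
  set L := s b with hL
  have hLval : L = (∫ t in a..b, lengthNorm Ω D (γ' t)) + ε * (b - a) := by
    rw [hL, hs]
    simp only [hν]
    rw [intervalIntegral.integral_add (h.intervalIntegrable_lengthNorm hint) (by simp)]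
    simp [mul_comm]
  have hLpos : 0 < L := by rw [← hsa]; exact hsmono ha hb hab
  rw [← hLval]
  -- The inverse is continued by constants outside [0, L], because competitors are curves on the
  -- whole line.
  have hex : ∀ u : ℝ, ∃ x ∈ Icc a b, s x = max 0 (min u L) := fun u => by
    have := intermediate_value_Icc hab.le hscont
    rw [hsa] at this
    exact this ⟨le_max_left _ _, max_le hLpos.le (min_le_right _ _)⟩
  choose τ hτ hsτ using hex
  have hτmono : Monotone τ := fun u v huv => by
    rw [← hsmono.le_iff_le (hτ u) (hτ v), hsτ, hsτ]
    gcongr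
  have hτ0 : τ 0 = a := hsmono.injOn (hτ 0) ha (by rw [hsτ, hsa]; simp [hLpos.le])
  have hτL : τ L = b := hsmono.injOn (hτ L) hb (by rw [hsτ, min_self, max_eq_right hLpos.le])
  -- Scaling by κ turns total length L into P and multiplies areas by κ².
  set κ := P / L with hκ
  have hκpos : 0 < κ := by positivity
  have hκP : P / κ = L := by rw [hκ]; field_simp
  set γ₁ : ℝ → V := fun t => γ t - γ a with hγ₁
  have hγ₁d : ∀ x y, γ₁ y - γ₁ x = γ y - γ x := fun x y => by simp [hγ₁]
  set z : ℝ → V := fun σ => κ • γ₁ (τ (σ / κ)) with hz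
  have hzmem : z ∈ unitSpeedLoops Ω D P := by
    refine ⟨⟨by simp [hz, hτ0, hγ₁], fun u v huv => ?_⟩, by simp [hz, hκP, hτL, hγ₁, hloop]⟩
    have huv' : u / κ ≤ v / κ := by gcongr
    simp only [hz]
    rw [← smul_sub, h.lengthNorm_smul hκpos.le, hγ₁d]
    have h1 := hN (hτ (u / κ)) (hτ (v / κ)) (hτmono huv')
    rw [hsτ, hsτ] at h1
    have h2 : max 0 (min (v / κ) L) - max 0 (min (u / κ) L) ≤ v / κ - u / κ := by
      rcases le_total (v / κ) L with h3 | h3 <;> rcases le_total (u / κ) L with h4 | h4 <;>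
      rcases le_total 0 (v / κ) with h5 | h5 <;> rcases le_total 0 (u / κ) with h6 | h6 <;>
        simp [h3, h4, h5, h6, hLpos.le] <;> linarith
    calc κ * lengthNorm Ω D (γ (τ (v / κ)) - γ (τ (u / κ))) ≤ κ * (v / κ - u / κ) := by
          gcongr; exact h1.trans h2
      _ = v - u := by field_simp
  obtain ⟨K, hK⟩ := h.exists_abs_loopArea_sub_sum_le hP
  obtain ⟨C, hC⟩ := h.exists_norm_le_lengthNorm
  set I := ∫ t in a..b, Ω (γ t) (γ' t) with hI
  have hI₁ : ∫ t in a..b, Ω (γ₁ t) (γ' t) = I := by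
    have hc' : ContinuousOn γ (uIcc a b) := by rwa [uIcc_of_le hab.le]
    simp only [hγ₁, map_sub, sub_apply]
    rw [intervalIntegral.integral_sub (intervalIntegrable_bilin Ω hc' hint)
      (intervalIntegrable_bilin Ω continuousOn_const hint), (Ω (γ a)).intervalIntegral_comp_comm hint,
      hftc a ha b hb hab.le, hloop, sub_self, map_zero, sub_zero]
  set G := ∫ t in a..b, ‖γ' t‖
  -- The change of parameter is never differentiated. Both areas are compared with Riemann-Stieltjes
  -- sums over corresponding nodes, which differ by the factor κ².
  have key : ∀ k : ℕ, κ ^ 2 * I ≤ isoConst Ω D P + (K + κ ^ 2 * (‖Ω‖ * (C * L) * G)) / (k + 1) := by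
    intro k
    have hk : (0 : ℝ) < k + 1 := by positivity
    have h1 := hK k z hzmem
    let t : ℕ → ℝ := fun i => τ ((i : ℝ) * (P / (k + 1)) / κ)
    have ht : Monotone t := fun i j hij => hτmono (by gcongr)
    have ht0 : t 0 = a := by simp [t, hτ0]
    have htk : t (k + 1) = b := by
      have : ((k + 1 : ℕ) : ℝ) * (P / (k + 1)) / κ = L := by
        rw [← hκP]; push_cast; field_simp
      simp only [t]
      rw [this, hτL]
    have hst : ∀ i : ℕ, i ≤ k + 1 → s (t i) = i * (L / (k + 1)) := fun i hi => by
      have e : (i : ℝ) * (P / (k + 1)) / κ = i * (L / (k + 1)) := by rw [← hκP]; field_simp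
      have hi' : (i : ℝ) ≤ k + 1 := by exact_mod_cast hi
      have h2 : (i : ℝ) * (L / (k + 1)) ≤ L := by
        rw [mul_div_assoc', div_le_iff₀ hk, mul_comm L]; gcongr
      simp only [t]
      rw [hsτ, e, min_eq_left h2, max_eq_right (by positivity)]
    have h2 := abs_integral_bilin_sub_sum_le Ω (γ := γ₁) (γ' := γ') ht (k + 1)
      (ρ := C * (L / (k + 1))) (by rw [ht0, htk]; exact hc.sub continuousOn_const)
      (by rwa [ht0, htk]) (by
        rw [ht0, htk]
        intro x hx y hy hxy
        rw [hγ₁d]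
        exact hftc x hx y hy hxy) (fun i hi x hx => by
        have hti : t i ∈ Icc a b := hτ _
        have hti' : t (i + 1) ∈ Icc a b := hτ _
        have hxI : x ∈ Icc a b := ⟨hti.1.trans hx.1, hx.2.trans hti'.2⟩
        rw [hγ₁d]
        refine (hC _).trans (mul_le_mul_of_nonneg_left ?_ C.2)
        refine (hN hti hxI hx.1).trans ?_
        have h3 : s x ≤ s (t (i + 1)) := hsmono.monotoneOn hxI hti' hx.2
        rw [hst _ hi] at h3
        rw [hst _ hi.le]
        push_cast at h3
        linarith)
    rw [ht0, htk, hI₁] at h2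
    have hsum : ∑ i ∈ Finset.range (k + 1), Ω (z (i * (P / (k + 1))))
        (z ((i + 1 : ℕ) * (P / (k + 1))) - z (i * (P / (k + 1))))
        = κ ^ 2 * ∑ i ∈ Finset.range (k + 1), Ω (γ₁ (t i)) (γ₁ (t (i + 1)) - γ₁ (t i)) := by
      rw [Finset.mul_sum]
      refine Finset.sum_congr rfl fun i _ => ?_
      simp only [hz, t]
      rw [← smul_sub]
      simp only [map_smul, smul_apply, smul_eq_mul]
      ring
    rw [hsum] at h1
    set S := ∑ i ∈ Finset.range (k + 1), Ω (γ₁ (t i)) (γ₁ (t (i + 1)) - γ₁ (t i))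
    have h3 := (abs_le.1 h1).1
    have h4 := (abs_le.1 h2).2
    have h5 := h.loopArea_le_isoConst hP hzmem
    have h6 : κ ^ 2 * (I - S) ≤ κ ^ 2 * (‖Ω‖ * (C * (L / (k + 1))) * G) := by gcongr
    have h7 : (K + κ ^ 2 * (‖Ω‖ * (C * L) * G)) / (k + 1)
        = K / (k + 1) + κ ^ 2 * (‖Ω‖ * (C * (L / (k + 1))) * G) := by field_simp
    rw [h7]
    linarith
  have hlim : Tendsto (fun k : ℕ => isoConst Ω D P + (K + κ ^ 2 * (‖Ω‖ * (C * L) * G)) / ((k : ℝ) + 1))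
      atTop (𝓝 (isoConst Ω D P + 0)) :=
    ((tendsto_const_div_atTop_nhds_zero_nat (K + κ ^ 2 * (‖Ω‖ * (C * L) * G))).comp
      (tendsto_add_atTop_nat 1) |>.congr fun k => by simp).const_add _
  have := ge_of_tendsto' hlim key
  rw [add_zero, hκ, div_pow, div_mul_eq_mul_div, div_le_iff₀ (by positivity)] at this
  linarith

/-- The isoperimetric inequality. -/
theorem integral_bilin_mul_sq_le (h : IsSymplecticBody Ω D) {P : ℝ} (hP : 0 < P)
    {γ γ' : ℝ → V} {a b : ℝ} (hab : a < b) (hc : ContinuousOn γ (Icc a b)) (hloop : γ a = γ b)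
    (hint : IntervalIntegrable γ' volume a b)
    (hftc : ∀ x ∈ Icc a b, ∀ y ∈ Icc a b, x ≤ y → ∫ t in x..y, γ' t = γ y - γ x) :
    (∫ t in a..b, Ω (γ t) (γ' t)) * P ^ 2
      ≤ isoConst Ω D P * (∫ t in a..b, lengthNorm Ω D (γ' t)) ^ 2 := by
  set L := ∫ t in a..b, lengthNorm Ω D (γ' t)
  have hlim : Tendsto (fun ε : ℝ => isoConst Ω D P * (L + ε * (b - a)) ^ 2) (𝓝[>] 0)
      (𝓝 (isoConst Ω D P * (L + 0 * (b - a)) ^ 2)) :=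
    ((by fun_prop : Continuous fun ε : ℝ => isoConst Ω D P * (L + ε * (b - a)) ^ 2).tendsto
      0).mono_left nhdsWithin_le_nhds
  rw [zero_mul, add_zero] at hlim
  refine ge_of_tendsto hlim ?_
  filter_upwards [self_mem_nhdsWithin] with ε hε
  exact h.integral_bilin_mul_sq_le_aux hP hab hc hloop hint hftc hε

end IsSymplecticBody

end IsoInequality

/-! ### Periodic continuation of loops. -/

section Periodic

variable {V : Type*} [NormedAddCommGroup V]

/-- Periodic continuation of a Lipschitz loop. -/
theorem exists_periodic_continuation {γ : ℝ → V} {C : ℝ≥0} (hγ : LipschitzWith C γ) {P : ℝ}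
    (hP : 0 < P) (hloop : γ P = γ 0) :
    ∃ γ' : ℝ → V, LipschitzWith C γ' ∧ Function.Periodic γ' P ∧
      (∀ t, ∃ s ∈ Icc 0 P, γ' t = γ s) ∧
      ∀ p : ℝ → Prop, (∀ᵐ t, t ∈ Icc 0 P → p t) →
        ∀ᵐ t, ∃ s, p s ∧ γ' =ᶠ[𝓝 t] fun u => γ (u - (t - s)) := by
  let F : ℝ → V := fun t => γ (t - ⌊t / P⌋ * P)
  have hfl : ∀ t, 0 ≤ t - ⌊t / P⌋ * P ∧ t - ⌊t / P⌋ * P < P := fun t => by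
    have h1 := Int.floor_le (t / P)
    have h2 := Int.lt_floor_add_one (t / P)
    rw [le_div_iff₀ hP] at h1
    rw [div_lt_iff₀ hP] at h2
    constructor <;> linarith
  refine ⟨F, LipschitzWith.of_dist_le_mul fun s t => ?_, fun t => ?_, fun t =>
    ⟨_, ⟨(hfl t).1, (hfl t).2.le⟩, rfl⟩, fun p hp => ?_⟩
  · wlog hst : s ≤ t generalizing s t
    · rw [dist_comm, dist_comm s]; exact this t s (le_of_not_ge hst)
    have hk : ⌊s / P⌋ ≤ ⌊t / P⌋ := Int.floor_mono (by gcongr)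
    rw [dist_comm s, Real.dist_eq t, abs_of_nonneg (sub_nonneg.2 hst)]
    -- Points in different periods are compared through the common value γ P = γ 0.
    rcases hk.eq_or_lt with hk | hk
    · refine (hγ.dist_le_mul _ _).trans (le_of_eq ?_)
      rw [dist_comm, Real.dist_eq, hk, sub_sub_sub_cancel_right, abs_of_nonneg (sub_nonneg.2 hst)]
    · have h1 := hγ.dist_le_mul (s - ⌊s / P⌋ * P) P
      have h2 := hγ.dist_le_mul 0 (t - ⌊t / P⌋ * P)
      rw [dist_comm _ P, Real.dist_eq, abs_of_pos (by linarith [(hfl s).2])] at h1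
      rw [dist_comm 0 (t - _), Real.dist_eq, sub_zero, abs_of_nonneg (hfl t).1, ← hloop] at h2
      have hk' : (⌊s / P⌋ : ℝ) + 1 ≤ ⌊t / P⌋ := by exact_mod_cast hk
      have h3 : ((⌊s / P⌋ : ℝ) + 1) * P ≤ ⌊t / P⌋ * P := by gcongr
      have h4 : (C : ℝ) * (P - (s - ⌊s / P⌋ * P)) + C * (t - ⌊t / P⌋ * P) ≤ C * (t - s) := by
        rw [← mul_add]; refine mul_le_mul_of_nonneg_left ?_ C.2; linarith
      linarith [dist_triangle (γ (s - ⌊s / P⌋ * P)) (γ P) (γ (t - ⌊t / P⌋ * P))]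
  · have : (t + P) / P = t / P + 1 := by field_simp
    simp only [F, this, Int.floor_add_one]
    congr 1; push_cast; ring
  · have h1 : ∀ᵐ t : ℝ, ∀ k : ℤ, t - k * P ∈ Icc 0 P → p (t - k * P) := by
      refine ae_all_iff.2 fun k => ?_
      exact (measurePreserving_sub_right volume ((k : ℝ) * P)).quasiMeasurePreserving.ae hp
    have h2 : ∀ᵐ t : ℝ, ∀ k : ℤ, t ≠ k * P := by
      refine ae_all_iff.2 fun k => by simp [ae_iff, measure_singleton]
    filter_upwards [h1, h2] with t ht hne
    refine ⟨t - ⌊t / P⌋ * P, ht _ ⟨(hfl t).1, (hfl t).2.le⟩, ?_⟩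
    have hpos : 0 < t - ⌊t / P⌋ * P :=
      lt_of_le_of_ne (hfl t).1 fun h0 => hne ⌊t / P⌋ (by linarith)
    have hnhd : Ioo (⌊t / P⌋ * P) ((⌊t / P⌋ + 1) * P) ∈ 𝓝 t :=
      Ioo_mem_nhds (by linarith) (by linarith [(hfl t).2])
    filter_upwards [hnhd] with u hu
    have : ⌊u / P⌋ = ⌊t / P⌋ := by
      rw [Int.floor_eq_iff, le_div_iff₀ hP, div_lt_iff₀ hP]
      exact ⟨hu.1.le, hu.2⟩
    simp only [F, this]
    congr 1; ring

end Periodic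

/-! ### Generalised closed characteristics of minimal action. -/

section Minimizer

variable {V : Type*} [NormedAddCommGroup V] [NormedSpace ℝ V] [FiniteDimensional ℝ V]
  {Ω : V →L[ℝ] V →L[ℝ] ℝ} {D : Set V}

/-- A generalised closed characteristic of minimal action on the boundary of `D`. -/
theorem IsSymplecticBody.exists_minimizer [Nontrivial V] (h : IsSymplecticBody Ω D) {P : ℝ}
    (hP : 0 < P) :
    ∃ (γ : ℝ → V) (C : ℝ≥0), LipschitzWith C γ ∧ Function.Periodic γ P ∧ (∀ t, gauge D (γ t) = 1) ∧
      ∀ᵐ t, DifferentiableAt ℝ γ t ∧ lengthNorm Ω D (deriv γ t) = P / isoConst Ω D P ∧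
        Ω (γ t) (deriv γ t) = P / isoConst Ω D P := by
  obtain ⟨γ₀, C, hL, hloop, hg, hae⟩ := h.exists_extremal hP
  obtain ⟨γ, hLγ, hper, hrange, hp⟩ := exists_periodic_continuation hL hP hloop
  have hM := h.isoConst_pos hP
  set R := isoConst Ω D P / P with hR
  have hRpos : 0 < R := by positivity
  have hRinv : P / isoConst Ω D P = R⁻¹ := by rw [hR, inv_div]
  rw [hRinv]
  -- Division by the constant gauge R puts the curve on the boundary. The speed 1 becomes R⁻¹, and
  -- the pairing R, being quadratic in the curve, becomes R⁻¹ as well.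
  refine ⟨fun t => R⁻¹ • γ t, ‖R⁻¹‖₊ * C, (lipschitzWith_smul R⁻¹).comp hLγ, fun t => by
    simp only [hper t], fun t => ?_, ?_⟩
  · obtain ⟨s, hs, hts⟩ := hrange t
    simp only [hts]
    rw [gauge_smul_of_nonneg (by positivity), hg s hs, smul_eq_mul, inv_mul_cancel₀ hRpos.ne']
  · filter_upwards [hp _ hae] with t ⟨s, ⟨hd, hN, hΩ⟩, hev⟩
    have hder : HasDerivAt γ (deriv γ₀ s) t := by
      refine HasDerivAt.congr_of_eventuallyEq ?_ hev
      have hs : HasDerivAt γ₀ (deriv γ₀ s) (t - (t - s)) := by rw [sub_sub_cancel]; exact hd.hasDerivAt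
      exact hs.comp_sub_const t (t - s)
    have hγt : γ t = γ₀ s := by simpa using hev.self_of_nhds
    have hder' : HasDerivAt (fun t => R⁻¹ • γ t) (R⁻¹ • deriv γ₀ s) t := hder.const_smul R⁻¹
    refine ⟨hder'.differentiableAt, ?_, ?_⟩
    · rw [hder'.deriv, h.lengthNorm_smul (by positivity), hN, mul_one]
    · rw [hder'.deriv, hγt]
      simp only [map_smul, smul_apply, smul_eq_mul, hΩ]
      field_simp

end Minimizer

/-! ### Regularity of solutions of autonomous equations -/

section Bootstrap

variable {V : Type*} [NormedAddCommGroup V] [NormedSpace ℝ V] [FiniteDimensional ℝ V]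

/-- A Lipschitz curve which solves a smooth autonomous equation almost everywhere is a smooth
solution. -/
theorem hasDerivAt_and_contDiffOn_of_ae {γ : ℝ → V} {C : ℝ≥0} (hγ : LipschitzWith C γ)
    {F : V → V} {U : Set V} (hF : ContDiffOn ℝ ∞ F U) {I : Set ℝ} (hI : IsOpen I)
    (hmaps : MapsTo γ I U) (hae : ∀ᵐ t, t ∈ I → HasDerivAt γ (F (γ t)) t) :
    (∀ t ∈ I, HasDerivAt γ (F (γ t)) t) ∧ ContDiffOn ℝ ∞ γ I := by
  have : CompleteSpace V := FiniteDimensional.complete ℝ V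
  have hcont : ContinuousOn (fun t => F (γ t)) I := hF.continuousOn.comp hγ.continuous.continuousOn hmaps
  have h1 : ∀ t ∈ I, HasDerivAt γ (F (γ t)) t := by
    intro t₀ ht₀
    obtain ⟨δ, hδ, hball⟩ := Metric.isOpen_iff.1 hI t₀ ht₀
    have hsub : ∀ t ∈ Metric.ball t₀ δ, uIcc t₀ t ⊆ I := fun t ht =>
      ((convex_ball t₀ δ).ordConnected.uIcc_subset (Metric.mem_ball_self hδ) ht).trans hball
    -- The integral equation has a continuous integrand, so the equation holds at every time and
    -- regularity can be bootstrapped.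
    have heq : γ =ᶠ[𝓝 t₀] fun t => γ t₀ + ∫ s in t₀..t, F (γ s) := by
      filter_upwards [Metric.ball_mem_nhds t₀ hδ] with t ht
      have := (integral_of_lipschitzOn_of_ae_hasDerivAt (f' := fun t => F (γ t))
        (hγ.lipschitzOnWith (s := uIcc t₀ t)) (by
          filter_upwards [hae] with s hs hsm using hs (hsub t ht hsm))).2
      rw [this]; abel
    refine HasDerivAt.congr_of_eventuallyEq (HasDerivAt.const_add _ ?_) heq
    have hmeas : StronglyMeasurableAtFilter (fun t => F (γ t)) (𝓝 t₀) :=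
      hcont.stronglyMeasurableAtFilter hI t₀ ht₀
    exact intervalIntegral.integral_hasDerivAt_right (by simp) hmeas
      (hcont.continuousAt (hI.mem_nhds ht₀))
  refine ⟨h1, contDiffOn_infty.2 fun n => ?_⟩
  induction n with
  | zero => exact contDiffOn_zero.2 hγ.continuous.continuousOn
  | succ n ih =>
    push_cast
    refine (contDiffOn_succ_iff_deriv_of_isOpen hI).2
      ⟨fun t ht => (h1 t ht).differentiableAt.differentiableWithinAt, by simp, ?_⟩
    refine ContDiffOn.congr ?_ fun t ht => (h1 t ht).deriv
    exact (hF.of_le (by exact_mod_cast le_top)).comp ih hmaps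

end Bootstrap

/-! ### Normal vectors of smooth convex bodies -/

section Normals

variable {V : Type*} [NormedAddCommGroup V] [NormedSpace ℝ V] {S : Set V} {H : V → ℝ}

theorem IsDefiningFunction.hasFDerivAt (h : IsDefiningFunction S H) (x : V) :
    HasFDerivAt H (fderiv ℝ H x) x :=
  (h.contDiff.differentiable (by simp) x).hasFDerivAt

theorem IsDefiningFunction.hasDerivAt_line (h : IsDefiningFunction S H) (x η : V) :
    HasDerivAt (fun s : ℝ => H (x + s • η)) (fderiv ℝ H x η) 0 := by
  have h1 : HasDerivAt (fun s : ℝ => x + s • η) η 0 := by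
    simpa using ((hasDerivAt_id (0 : ℝ)).smul_const η).const_add x
  have h2 : HasFDerivAt H (fderiv ℝ H x) (x + (0 : ℝ) • η) := by simpa using h.hasFDerivAt x
  exact h2.comp_hasDerivAt 0 h1

theorem IsDefiningFunction.exists_mem_of_fderiv_neg (h : IsDefiningFunction S H) {x η : V}
    (hx : H x = 0) (hη : fderiv ℝ H x η < 0) : ∃ s : ℝ, 0 < s ∧ x + s • η ∈ S := by
  have hslope := (h.hasDerivAt_line x η).hasDerivWithinAt (s := Ioi 0) |>.limsup_slope_le'
    (by simp) hη
  obtain ⟨s, hs, hs0⟩ := (hslope.and self_mem_nhdsWithin).exists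
  refine ⟨s, hs0, (h.mem_iff _).2 ?_⟩
  have hs0' : 0 < s := hs0
  rw [slope_def_field, zero_smul, add_zero, hx, sub_zero, sub_zero, div_lt_iff₀ hs0', zero_mul] at hs
  exact hs.le

/-- A zero of H in the interior of S would be a local maximum, hence a critical point, against
regularity. -/
theorem IsDefiningFunction.frontier_iff (h : IsDefiningFunction S H) (x : V) :
    x ∈ frontier S ↔ H x = 0 := by
  have hcont : Continuous H := h.contDiff.continuous
  have hcl : IsClosed S := by
    have : S = {x | H x ≤ 0} := by ext; simp [h.mem_iff]
    rw [this]; exact isClosed_le hcont continuous_const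
  rw [hcl.frontier_eq, Set.mem_sdiff, h.mem_iff]
  constructor
  · rintro ⟨h1, h2⟩
    by_contra h3
    refine h2 (mem_interior_iff_mem_nhds.2 ?_)
    filter_upwards [hcont.continuousAt.eventually_lt_const (lt_of_le_of_ne h1 h3)] with y hy
    exact (h.mem_iff y).2 hy.le
  · intro h0
    refine ⟨h0.le, fun hint => h.regular x h0 ?_⟩
    refine IsLocalMax.fderiv_eq_zero (f := H) ?_
    filter_upwards [mem_interior_iff_mem_nhds.1 hint] with y hy
    rw [h0]; exact (h.mem_iff y).1 hy

theorem IsDefiningFunction.fderiv_sub_nonpos (h : IsDefiningFunction S H) (hS : Convex ℝ S)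
    {x y : V} (hx : H x = 0) (hy : y ∈ S) : fderiv ℝ H x (y - x) ≤ 0 := by
  have hmax : IsLocalMaxOn H S x := by
    filter_upwards [self_mem_nhdsWithin] with z hz
    rw [hx]; exact (h.mem_iff z).1 hz
  exact hmax.hasFDerivWithinAt_nonpos (h.hasFDerivAt x).hasFDerivWithinAt
    (sub_mem_posTangentConeAt_of_segment_subset (hS.segment_subset ((h.mem_iff x).2 hx.le) hy))

/-- An interior point can be pushed within S in a direction in which dH is positive; this makes the
supporting inequality strict. -/
theorem IsDefiningFunction.fderiv_sub_neg (h : IsDefiningFunction S H) (hS : Convex ℝ S)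
    {x y : V} (hx : H x = 0) (hy : y ∈ interior S) : fderiv ℝ H x (y - x) < 0 := by
  obtain ⟨η, hη⟩ : ∃ η, 0 < fderiv ℝ H x η := by
    by_contra! hle
    refine h.regular x hx (ContinuousLinearMap.ext fun η => le_antisymm (hle η) ?_)
    have := hle (-η)
    rw [map_neg] at this
    simpa using this
  have hc : Tendsto (fun s : ℝ => y + s • η) (𝓝[>] 0) (𝓝 (y + (0 : ℝ) • η)) :=
    ((by fun_prop : Continuous fun s : ℝ => y + s • η).tendsto 0).mono_left nhdsWithin_le_nhds
  rw [zero_smul, add_zero] at hc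
  obtain ⟨s, hs, hs0⟩ := ((hc.eventually (mem_interior_iff_mem_nhds.1 hy)).and
    self_mem_nhdsWithin).exists
  have h1 := h.fderiv_sub_nonpos hS hx hs
  rw [add_sub_right_comm, map_add, map_smul, smul_eq_mul] at h1
  have : 0 < s * fderiv ℝ H x η := mul_pos hs0 hη
  linarith

/-- A functional which vanishes on the tangent space is a multiple of the differential. -/
theorem IsDefiningFunction.exists_eq_mul (h : IsDefiningFunction S H) {x : V} (hx : H x = 0)
    (ℓ : V →L[ℝ] ℝ) (hℓ : ∀ η, fderiv ℝ H x η = 0 → ℓ η = 0) :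
    ∃ c : ℝ, ∀ η, ℓ η = c * fderiv ℝ H x η := by
  obtain ⟨η₀, hη₀⟩ : ∃ η, fderiv ℝ H x η ≠ 0 := by
    by_contra! h0
    exact h.regular x hx (ContinuousLinearMap.ext h0)
  refine ⟨ℓ η₀ / fderiv ℝ H x η₀, fun η => ?_⟩
  have := hℓ (η - (fderiv ℝ H x η / fderiv ℝ H x η₀) • η₀) (by
    rw [map_sub, map_smul, smul_eq_mul]; field_simp; ring)
  rw [map_sub, map_smul, smul_eq_mul] at this
  field_simp at this ⊢
  linarith

/-- Every outer normal at a boundary point is a multiple of the differential. -/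
theorem IsDefiningFunction.exists_eq_mul_of_isMaxOn (h : IsDefiningFunction S H) {x : V}
    (hx : H x = 0) (ℓ : V →L[ℝ] ℝ) (hℓ : ∀ y ∈ S, ℓ y ≤ ℓ x) :
    ∃ c : ℝ, ∀ η, ℓ η = c * fderiv ℝ H x η := by
  have hneg : ∀ η, fderiv ℝ H x η < 0 → ℓ η ≤ 0 := fun η hη => by
    obtain ⟨s, hs, hsS⟩ := h.exists_mem_of_fderiv_neg hx hη
    have := hℓ _ hsS
    rw [map_add, map_smul, smul_eq_mul] at this
    exact nonpos_of_mul_nonpos_right (by linarith) hs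
  obtain ⟨η₀, hη₀⟩ : ∃ η, fderiv ℝ H x η < 0 := by
    by_contra! hle
    refine h.regular x hx (ContinuousLinearMap.ext fun η => le_antisymm ?_ (hle η))
    have := hle (-η)
    rw [map_neg] at this
    simpa using this
  -- Tangent vectors are limits of the inward vectors η + εη₀.
  have hker : ∀ η, fderiv ℝ H x η = 0 → ℓ η ≤ 0 := fun η hη => by
    have hc : Tendsto (fun ε : ℝ => ℓ η + ε * ℓ η₀) (𝓝[>] 0) (𝓝 (ℓ η + 0 * ℓ η₀)) :=
      ((by fun_prop : Continuous fun ε : ℝ => ℓ η + ε * ℓ η₀).tendsto 0).mono_left nhdsWithin_le_nhds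
    rw [zero_mul, add_zero] at hc
    refine le_of_tendsto hc ?_
    filter_upwards [self_mem_nhdsWithin] with ε hε
    have := hneg (η + ε • η₀) (by
      rw [map_add, map_smul, hη, zero_add, smul_eq_mul]; exact mul_neg_of_pos_of_neg hε hη₀)
    simpa using this
  refine h.exists_eq_mul hx ℓ fun η hη => le_antisymm (hker η hη) ?_
  have := hker (-η) (by rw [map_neg, hη, neg_zero])
  rw [map_neg] at this
  linarith

end Normals

/-! ### The symplectic form of phase space -/

section Phase

/-- The symplectic form of phase space as a continuous bilinear map. -/
noncomputable def sympForm (n : ℕ) : Phase n →L[ℝ] Phase n →L[ℝ] ℝ :=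
  (innerSL ℝ).bilinearComp (.fst ℝ (E n) (E n)) (.snd ℝ (E n) (E n))
    - (innerSL ℝ).bilinearComp (.snd ℝ (E n) (E n)) (.fst ℝ (E n) (E n))

theorem sympForm_apply {n : ℕ} (u v : Phase n) : sympForm n u v = omega u v := by
  simp [sympForm, omega]

theorem omega_self {n : ℕ} (u : Phase n) : omega u u = 0 := by
  rw [omega, real_inner_comm, sub_self]

/-- The Hamiltonian vector dual to a functional. -/
noncomputable def hamiltonianVector (n : ℕ) : (Phase n →L[ℝ] ℝ) →L[ℝ] Phase n :=
  ((-(InnerProductSpace.toDual ℝ (E n)).symm.toContinuousLinearEquiv.toContinuousLinearMap).comp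
    ((ContinuousLinearMap.compL ℝ (E n) (Phase n) ℝ).flip (.inr ℝ (E n) (E n)))).prod
  ((InnerProductSpace.toDual ℝ (E n)).symm.toContinuousLinearEquiv.toContinuousLinearMap.comp
    ((ContinuousLinearMap.compL ℝ (E n) (Phase n) ℝ).flip (.inl ℝ (E n) (E n))))

theorem omega_hamiltonianVector {n : ℕ} (ℓ : Phase n →L[ℝ] ℝ) (x : Phase n) :
    omega x (hamiltonianVector n ℓ) = ℓ x := by
  change inner ℝ x.1 ((InnerProductSpace.toDual ℝ (E n)).symm (ℓ.comp (.inl ℝ (E n) (E n))))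
    - inner ℝ x.2 (-(InnerProductSpace.toDual ℝ (E n)).symm (ℓ.comp (.inr ℝ (E n) (E n)))) = ℓ x
  rw [real_inner_comm, InnerProductSpace.toDual_symm_apply, inner_neg_right, real_inner_comm,
    InnerProductSpace.toDual_symm_apply, sub_neg_eq_add]
  have : x = (x.1, 0) + (0, x.2) := by simp
  conv_rhs => rw [this, map_add]
  rfl

/-- The body `S` translated by `-c`. -/
def centred {V : Type*} [AddGroup V] (S : Set V) (c : V) : Set V := (fun y => y - c) '' S

theorem isSymplecticBody_centred {n : ℕ} {S : Set (Phase n)} (hS : IsConvexBody S) {c : Phase n}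
    (hc : c ∈ interior S) : IsSymplecticBody (sympForm n) (centred S c) where
  alt v := by rw [sympForm_apply, omega_self]
  nondeg ℓ := ⟨hamiltonianVector n ℓ, fun x => by rw [sympForm_apply, omega_hamiltonianVector]⟩
  isCompact := hS.isCompact.image (by fun_prop)
  convex := by
    have := hS.convex.translate (-c)
    simpa [centred, sub_eq_neg_add] using this
  zero_mem := by
    have := (Homeomorph.subRight c).image_interior S
    rw [centred]
    change (0 : Phase n) ∈ interior ((Homeomorph.subRight c) '' S)
    rw [← this]
    exact ⟨c, hc, by simp⟩

end Phase

/-! ### Translated bodies and their gauge functions. -/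

section Centred

variable {V : Type*} [NormedAddCommGroup V] [NormedSpace ℝ V] {S : Set V} {c : V}

theorem mem_centred_iff {V : Type*} [AddGroup V] {S : Set V} {c x : V} :
    x ∈ centred S c ↔ x + c ∈ S := by
  constructor
  · rintro ⟨y, hy, rfl⟩; simpa using hy
  · exact fun h => ⟨x + c, h, by simp⟩

theorem convex_centred (hS : Convex ℝ S) (c : V) : Convex ℝ (centred S c) := by
  have := hS.translate (-c)
  simpa [centred, sub_eq_neg_add] using this

omit [NormedSpace ℝ V] in
theorem centred_mem_nhds (hc : c ∈ interior S) : centred S c ∈ 𝓝 (0 : V) := by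
  have := (Homeomorph.subRight c).image_interior S
  refine mem_interior_iff_mem_nhds.1 (?_ : (0 : V) ∈ interior ((Homeomorph.subRight c) '' S))
  rw [← this]
  exact ⟨c, hc, by simp⟩

omit [NormedSpace ℝ V] in
theorem mem_frontier_centred_iff {x : V} : x ∈ frontier (centred S c) ↔ x + c ∈ frontier S := by
  change x ∈ frontier ((Homeomorph.subRight c) '' S) ↔ _
  rw [← (Homeomorph.subRight c).image_frontier]
  exact mem_centred_iff

theorem gauge_centred_eq_one_iff (hS : Convex ℝ S) (hc : c ∈ interior S) (x : V) :
    gauge (centred S c) x = 1 ↔ x + c ∈ frontier S := by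
  rw [gauge_eq_one_iff_mem_frontier (convex_centred hS c) (centred_mem_nhds hc),
    mem_frontier_centred_iff]

end Centred

/-! ### Closed characteristics and the minimal action. -/

section Characteristics

variable {n : ℕ}

/-- The minimal action of generalised closed characteristics on the boundary of `S`. -/
noncomputable def minimalAction (S : Set (Phase n)) (c : Phase n) : ℝ :=
  (2 * π) ^ 2 / (2 * isoConst (sympForm n) (centred S c) (2 * π))

/-- Curves on the boundary which run in the direction of outer normals. -/
theorem lengthNorm_eq_of_normal {S : Set (Phase n)} (hS : IsConvexBody S) {c : Phase n}
    (hc : c ∈ interior S) {x v : Phase n} (hx : x ∈ S)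
    (hv : ∀ y ∈ S, omega y v ≤ omega x v) :
    lengthNorm (sympForm n) (centred S c) v = sympForm n (x - c) v := by
  have h := isSymplecticBody_centred hS hc
  refine le_antisymm (h.lengthNorm_le fun y hy => ?_) (h.le_lengthNorm (mem_image_of_mem _ hx) v)
  have := hv _ (mem_centred_iff.1 hy)
  rw [← sympForm_apply, ← sympForm_apply] at this
  simp only [map_add, map_sub, add_apply, sub_apply] at this ⊢
  linarith

/-- A loop along which length equals twice the action has at least the minimal action. -/
theorem minimalAction_le (hn : 1 ≤ n) {S : Set (Phase n)} (hS : IsConvexBody S) {c : Phase n}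
    (hc : c ∈ interior S) {γ γ' : ℝ → Phase n} (hγ : Continuous γ)
    (hloop : γ 0 = γ (2 * π)) (hint : IntervalIntegrable γ' volume 0 (2 * π))
    (hftc : ∀ x ∈ Icc 0 (2 * π), ∀ y ∈ Icc 0 (2 * π), x ≤ y → ∫ t in x..y, γ' t = γ y - γ x)
    (hpos : ∀ t, γ' t ≠ 0)
    (hle : ∀ t, lengthNorm (sympForm n) (centred S c) (γ' t) ≤ sympForm n (γ t - c) (γ' t)) :
    minimalAction S c ≤ (1 / 2) * ∫ t in (0 : ℝ)..(2 * π), omega (γ t) (γ' t) := by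
  have h := isSymplecticBody_centred hS hc
  have : Nontrivial (Phase n) := by
    have : Nonempty (Fin n) := ⟨⟨0, hn⟩⟩
    infer_instance
  have hP : 0 < 2 * π := by positivity
  have hM := h.isoConst_pos hP
  have hiso := h.integral_bilin_mul_sq_le hP hP hγ.continuousOn hloop hint hftc
  set L := ∫ t in (0 : ℝ)..(2 * π), lengthNorm (sympForm n) (centred S c) (γ' t)
  set A := ∫ t in (0 : ℝ)..(2 * π), sympForm n (γ t) (γ' t) with hA
  have hAeq : ∫ t in (0 : ℝ)..(2 * π), omega (γ t) (γ' t) = A := by simp only [hA, sympForm_apply]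
  have hIγ : IntervalIntegrable (fun t => sympForm n (γ t) (γ' t)) volume 0 (2 * π) :=
    intervalIntegrable_bilin _ hγ.continuousOn hint
  have hIc : IntervalIntegrable (fun t => sympForm n c (γ' t)) volume 0 (2 * π) :=
    intervalIntegrable_bilin _ continuousOn_const hint
  -- The centre c contributes nothing to the pairing because the loop closes up.
  have hLA : L ≤ A := by
    have h1 : ∫ t in (0 : ℝ)..(2 * π), sympForm n (γ t - c) (γ' t) = A := by
      simp only [map_sub, sub_apply]
      rw [intervalIntegral.integral_sub hIγ hIc, (sympForm n c).intervalIntegral_comp_comm hint,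
        hftc 0 (left_mem_Icc.2 hP.le) _ (right_mem_Icc.2 hP.le) hP.le, hloop, sub_self, map_zero,
        sub_zero]
    rw [← h1]
    refine intervalIntegral.integral_mono hP.le (h.intervalIntegrable_lengthNorm hint) ?_ hle
    simp only [map_sub, sub_apply]
    exact hIγ.sub hIc
  have hLpos : 0 < L := intervalIntegral.intervalIntegral_pos_of_pos
    (h.intervalIntegrable_lengthNorm hint) (fun t => h.lengthNorm_pos (hpos t)) hP
  rw [hAeq, minimalAction]
  set M := isoConst (sympForm n) (centred S c) (2 * π)
  rw [div_le_iff₀ (by positivity)]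
  have h1 : M * L ^ 2 ≤ M * (A * A) := by
    gcongr; nlinarith
  have h2 : A * (2 * π) ^ 2 ≤ A * (M * A) := by linarith
  have h3 := le_of_mul_le_mul_left h2 (hLpos.trans_le hLA)
  linarith

/-- The velocity of a characteristic is plus or minus an outer normal, with constant sign, so after
a possible reversal its length with respect to S' equals its area integral. Its length with respect
to the smaller body S is no larger, so the isoperimetric inequality of S applies. -/
theorem minimalAction_le_abs_action (hn : 1 ≤ n) {S S' : Set (Phase n)} (hS : IsConvexBody S)
    (hS' : IsConvexBody S') (hsub : S ⊆ S') {c : Phase n} (hc : c ∈ interior S)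
    {γ : ℝ → Phase n} (hγ : IsClosedCharacteristic S' γ) : minimalAction S c ≤ |action γ| := by
  have h := isSymplecticBody_centred hS hc
  have hc' := interior_mono hsub hc
  have h' := isSymplecticBody_centred hS' hc'
  have hmono : centred S c ⊆ centred S' c := image_mono hsub
  have hd : ∀ t, HasDerivAt γ (deriv γ t) t := fun t =>
    (hγ.contDiff.differentiable (by simp) t).hasDerivAt
  have hdc : Continuous (deriv γ) := hγ.contDiff.continuous_deriv (by simp)
  have hγc : Continuous γ := hγ.contDiff.continuous
  have hline : ∀ t, ∃ μ : ℝ, ∃ H, IsDefiningFunction S' H ∧ H (γ t) = 0 ∧ μ ≠ 0 ∧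
      ∀ η, omega η (deriv γ t) = μ * fderiv ℝ H (γ t) η := by
    intro t
    obtain ⟨⟨H, hH, -⟩, hort⟩ := hγ.tangent t
    have hx := (hH.frontier_iff _).1 (hγ.mem_frontier t)
    obtain ⟨μ, hμ⟩ := hH.exists_eq_mul hx ((sympForm n).flip (deriv γ t)) fun η hη => by
      have := hort η ⟨H, hH, hη⟩
      rw [ContinuousLinearMap.flip_apply, h.swap, sympForm_apply, this, neg_zero]
    simp only [ContinuousLinearMap.flip_apply, sympForm_apply] at hμ
    refine ⟨μ, H, hH, hx, ?_, hμ⟩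
    rintro rfl
    refine hγ.deriv_ne_zero t ?_
    by_contra hne
    have := h.lengthNorm_pos hne
    have h2 : lengthNorm (sympForm n) (centred S c) (deriv γ t) ≤ 0 :=
      h.lengthNorm_le fun x _ => by rw [sympForm_apply, hμ, zero_mul]
    linarith
  let φ : ℝ → ℝ := fun t => sympForm n (γ t - c) (deriv γ t)
  have hφc : Continuous φ := by fun_prop
  -- The direction from c, interior to S', to a boundary point is transversal to the boundary; by
  -- continuity φ then has one sign.
  have hφ0 : ∀ t, φ t ≠ 0 := fun t => by
    obtain ⟨μ, H, hH, hx, hμ, hη⟩ := hline t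
    have := hH.fderiv_sub_neg hS'.convex hx hc'
    simp only [φ, sympForm_apply, hη]
    rw [← neg_sub, map_neg]
    exact mul_ne_zero hμ (by linarith)
  have hnormal : ∀ t, (0 < φ t → lengthNorm (sympForm n) (centred S' c) (deriv γ t) = φ t) ∧
      (φ t < 0 → lengthNorm (sympForm n) (centred S' c) (-deriv γ t) = -φ t) := by
    intro t
    obtain ⟨μ, H, hH, hx, hμ, hη⟩ := hline t
    have hneg := hH.fderiv_sub_neg hS'.convex hx hc'
    have hxS : γ t ∈ S' := (hH.mem_iff _).2 hx.le
    have hφt : φ t = -(μ * fderiv ℝ H (γ t) (c - γ t)) := by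
      simp only [φ, sympForm_apply, hη]
      rw [← neg_sub, map_neg]; ring
    have hle : ∀ y ∈ S', fderiv ℝ H (γ t) y ≤ fderiv ℝ H (γ t) (γ t) := fun y hy => by
      have := hH.fderiv_sub_nonpos hS'.convex hx hy
      rw [map_sub] at this; linarith
    constructor
    · intro hpos
      refine lengthNorm_eq_of_normal hS' hc' hxS fun y hy => ?_
      rw [hη, hη]
      refine mul_le_mul_of_nonneg_left (hle y hy) ?_
      by_contra! hμ
      nlinarith
    · intro hn
      rw [lengthNorm_eq_of_normal hS' hc' hxS, map_neg]
      intro y hy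
      rw [← sympForm_apply, ← sympForm_apply, map_neg, map_neg, sympForm_apply, sympForm_apply, hη, hη]
      have hμ : μ ≤ 0 := by
        by_contra! hμ
        nlinarith
      have := hle y hy
      nlinarith
  have hsign : (∀ t, 0 < φ t) ∨ ∀ t, φ t < 0 := by
    by_contra! hcon
    obtain ⟨⟨s, hs⟩, ⟨t, ht⟩⟩ := hcon
    obtain ⟨u, hu⟩ := mem_range_of_exists_le_of_exists_ge hφc ⟨s, hs⟩ ⟨t, ht⟩
    exact hφ0 u hu
  have hγper : γ 0 = γ (2 * π) := by simpa using (hγ.periodic 0).symm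
  rcases hsign with hpos | hneg
  · refine (minimalAction_le hn hS hc hγc hγper (hdc.intervalIntegrable _ _)
      (fun x _ y _ _ => intervalIntegral.integral_eq_sub_of_hasDerivAt (fun t _ => hd t)
        (hdc.intervalIntegrable _ _)) hγ.deriv_ne_zero fun t => ?_).trans (le_abs_self _)
    rw [show sympForm n (γ t - c) (deriv γ t) = φ t from rfl, ← (hnormal t).1 (hpos t)]
    exact h.lengthNorm_mono h' hmono _
  -- For the wrong orientation the curve is run backwards, which changes the sign of the action.
  · have hd' : ∀ t, HasDerivAt (fun t => γ (2 * π - t)) (-deriv γ (2 * π - t)) t := fun t =>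
      (hd (2 * π - t)).comp_const_sub (2 * π) t
    have hdc' : Continuous fun t => -deriv γ (2 * π - t) := by fun_prop
    have hmin := minimalAction_le hn hS hc (γ := fun t => γ (2 * π - t))
      (γ' := fun t => -deriv γ (2 * π - t)) (by fun_prop) (by simpa using hγper.symm)
      (hdc'.intervalIntegrable _ _)
      (fun x _ y _ _ => intervalIntegral.integral_eq_sub_of_hasDerivAt (fun t _ => hd' t)
        (hdc'.intervalIntegrable _ _)) (fun t => neg_ne_zero.2 (hγ.deriv_ne_zero _)) fun t => by
        rw [map_neg, show sympForm n (γ (2 * π - t) - c) (deriv γ (2 * π - t)) = φ (2 * π - t) from rfl,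
          ← (hnormal _).2 (hneg _)]
        exact h.lengthNorm_mono h' hmono _
    refine hmin.trans (le_trans (le_of_eq ?_) (neg_le_abs _))
    rw [action, ← mul_neg, ← intervalIntegral.integral_neg]
    congr 1
    have := intervalIntegral.integral_comp_sub_left (a := 0) (b := 2 * π)
      (fun t => -omega (γ t) (deriv γ t)) (2 * π)
    rw [sub_self, sub_zero] at this
    rw [← this]
    refine intervalIntegral.integral_congr fun t _ => ?_
    simp only [← sympForm_apply, map_neg]

/-- A smooth convex body carries a closed characteristic of minimal action. -/
theorem exists_isClosedCharacteristic (hn : 1 ≤ n) {S : Set (Phase n)} (hS : IsSmoothConvexBody S)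
    {c : Phase n} (hc : c ∈ interior S) :
    ∃ γ, IsClosedCharacteristic S γ ∧ action γ = minimalAction S c := by
  obtain ⟨hSb, H, hH⟩ := hS
  have h := isSymplecticBody_centred hSb hc
  have : Nontrivial (Phase n) := by
    have : Nonempty (Fin n) := ⟨⟨0, hn⟩⟩
    infer_instance
  have hP : 0 < 2 * π := by positivity
  have hM := h.isoConst_pos hP
  obtain ⟨γ₀, C, hLip, hper, hg, hae⟩ := h.exists_minimizer hP
  set M := isoConst (sympForm n) (centred S c) (2 * π) with hMdef
  set r := 2 * π / M with hr
  have hrpos : 0 < r := by positivity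
  set γ : ℝ → Phase n := fun t => γ₀ t + c with hγ
  have hγLip : LipschitzWith C γ := LipschitzWith.of_dist_le_mul fun s t => by
    simpa [hγ] using hLip.dist_le_mul s t
  have hγfr : ∀ t, γ t ∈ frontier S := fun t => (gauge_centred_eq_one_iff hSb.convex hc _).1 (hg t)
  have hγ0 : ∀ t, H (γ t) = 0 := fun t => (hH.frontier_iff _).1 (hγfr t)
  have hγS : ∀ t, γ t ∈ S := fun t => (hH.mem_iff _).2 (hγ0 t).le
  have hrad : ∀ t, 0 < fderiv ℝ H (γ t) (γ t - c) := fun t => by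
    have := hH.fderiv_sub_neg hSb.convex (hγ0 t) hc
    rw [← neg_sub, map_neg] at this
    linarith
  have hae' : ∀ᵐ t, HasDerivAt γ (deriv γ t) t ∧
      lengthNorm (sympForm n) (centred S c) (deriv γ t) = r ∧
        sympForm n (γ t - c) (deriv γ t) = r := by
    filter_upwards [hae] with t ⟨hd, hN, hΩ⟩
    have hd' : HasDerivAt γ (deriv γ₀ t) t := hd.hasDerivAt.add_const c
    rw [hd'.deriv]
    refine ⟨hd', hN, ?_⟩
    simpa [hγ] using hΩ
  -- the Hamiltonian vector field
  let U : Set (Phase n) := {x | fderiv ℝ H x (x - c) ≠ 0}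
  -- The Hamiltonian field of H, normalised by ω(x - c, F x) = r to match the constant speed of the
  -- minimiser.
  let F : Phase n → Phase n := fun x =>
    (r / fderiv ℝ H x (x - c)) • hamiltonianVector n (fderiv ℝ H x)
  have hdH : ContDiff ℝ ∞ (fderiv ℝ H) := hH.contDiff.fderiv_right (by simp)
  have hF : ContDiffOn ℝ ∞ F U := by
    have h1 : ContDiff ℝ ∞ fun x => fderiv ℝ H x (x - c) := hdH.clm_apply (by fun_prop)
    have h2 : ContDiff ℝ ∞ fun x => hamiltonianVector n (fderiv ℝ H x) :=
      (hamiltonianVector n).contDiff.comp hdH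
    exact (contDiffOn_const.div h1.contDiffOn fun x hx => hx).smul h2.contDiffOn
  have hode : ∀ᵐ t, t ∈ univ → HasDerivAt γ (F (γ t)) t := by
    filter_upwards [hae'] with t ⟨hd, hN, hΩ⟩ _
    have hmax : ∀ y ∈ S, (sympForm n).flip (deriv γ t) y ≤ (sympForm n).flip (deriv γ t) (γ t) := by
      intro y hy
      have := h.le_lengthNorm (mem_image_of_mem _ hy) (deriv γ t)
      rw [hN, ← hΩ] at this
      simp only [map_sub, sub_apply] at this
      simp only [ContinuousLinearMap.flip_apply]
      linarith
    obtain ⟨μ, hμ⟩ := hH.exists_eq_mul_of_isMaxOn (hγ0 t) _ hmax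
    simp only [ContinuousLinearMap.flip_apply] at hμ
    have hμval : μ = r / fderiv ℝ H (γ t) (γ t - c) := by
      rw [eq_div_iff (hrad t).ne', ← hμ, hΩ]
    have heq : deriv γ t = F (γ t) := by
      by_contra hne
      have hpos := h.lengthNorm_pos (sub_ne_zero.2 hne)
      have : lengthNorm (sympForm n) (centred S c) (deriv γ t - F (γ t)) ≤ 0 :=
        h.lengthNorm_le fun x _ => by
          rw [map_sub, hμ, map_smul, sympForm_apply, omega_hamiltonianVector, smul_eq_mul, hμval,
            sub_self]
      linarith
    rwa [heq] at hd
  obtain ⟨hsol, hsmooth⟩ := hasDerivAt_and_contDiffOn_of_ae hγLip hF isOpen_univ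
    (fun t _ => (hrad t).ne') hode
  have hderiv : ∀ t, HasDerivAt γ (F (γ t)) t := fun t => hsol t trivial
  have hdc : Continuous fun t => F (γ t) :=
    hF.continuousOn.comp_continuous hγLip.continuous fun t => (hrad t).ne'
  have hΩF : ∀ t y, omega y (F (γ t)) = r / fderiv ℝ H (γ t) (γ t - c) * fderiv ℝ H (γ t) y := by
    intro t y
    rw [← sympForm_apply, map_smul, sympForm_apply, omega_hamiltonianVector, smul_eq_mul]
  have hΩr : ∀ t, sympForm n (γ t - c) (F (γ t)) = r := fun t => by
    rw [sympForm_apply, hΩF, div_mul_cancel₀ _ (hrad t).ne']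
  have hNr : ∀ t, lengthNorm (sympForm n) (centred S c) (F (γ t)) = r := fun t => by
    rw [lengthNorm_eq_of_normal hSb hc (hγS t), hΩr]
    intro y hy
    rw [hΩF, hΩF]
    have := hH.fderiv_sub_nonpos hSb.convex (hγ0 t) hy
    rw [map_sub] at this
    have h2 := (div_pos hrpos (hrad t)).le
    exact mul_le_mul_of_nonneg_left (by linarith) h2
  have hperγ : Function.Periodic γ (2 * π) := fun t => by simp only [hγ, hper t]
  have hint : ∀ a b : ℝ, IntervalIntegrable (fun t => F (γ t)) volume a b := fun a b =>
    hdc.intervalIntegrable _ _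
  have hftc : ∀ a b : ℝ, ∫ t in a..b, F (γ t) = γ b - γ a := fun a b =>
    intervalIntegral.integral_eq_sub_of_hasDerivAt (fun t _ => hderiv t) (hint a b)
  have hloopint : ∀ a b : ℝ, γ a = γ b →
      ∫ t in a..b, sympForm n (γ t) (F (γ t)) = r * (b - a) := by
    intro a b hab
    have h1 : ∫ t in a..b, sympForm n (γ t - c) (F (γ t)) = r * (b - a) := by
      simp only [hΩr]
      rw [intervalIntegral.integral_const, smul_eq_mul, mul_comm]
    rw [← h1]
    simp only [map_sub, sub_apply]
    rw [intervalIntegral.integral_sub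
      (intervalIntegrable_bilin _ hγLip.continuous.continuousOn (hint a b))
      (intervalIntegrable_bilin _ continuousOn_const (hint a b)),
      (sympForm n c).intervalIntegral_comp_comm (hint a b), hftc, hab, sub_self, map_zero, sub_zero]
  -- A closed subarc has length and area integral r(t - s). As Mr = 2π, the isoperimetric inequality
  -- forces t - s ≥ 2π.
  have hinj : ∀ s ∈ Ico 0 (2 * π), ∀ t ∈ Ico 0 (2 * π), s < t → γ s ≠ γ t := by
    intro s hs t ht hst heq
    have hiso := h.integral_bilin_mul_sq_le hP hst hγLip.continuous.continuousOn heq (hint s t)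
      fun x _ y _ _ => hftc x y
    rw [hloopint s t heq] at hiso
    simp only [hNr] at hiso
    rw [intervalIntegral.integral_const, smul_eq_mul, ← hMdef] at hiso
    have hrM : M * r = 2 * π := by rw [hr]; field_simp
    have h1 : M * ((t - s) * r) ^ 2 = (r * (t - s)) * ((2 * π) * (t - s)) := by rw [← hrM]; ring
    rw [h1] at hiso
    have h2 := le_of_mul_le_mul_left hiso (mul_pos hrpos (sub_pos.2 hst))
    rw [sq] at h2
    have h3 := le_of_mul_le_mul_left h2 hP
    linarith [hs.1, ht.2]
  refine ⟨γ, ⟨contDiffOn_univ.1 hsmooth, hperγ, ?_, fun t => ?_, hγfr, fun t => ?_⟩, ?_⟩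
  · intro s hs t ht heq
    rcases lt_trichotomy s t with hst | hst | hst
    · exact absurd heq (hinj s hs t ht hst)
    · exact hst
    · exact absurd heq.symm (hinj t ht s hs hst)
  · rw [(hderiv t).deriv]
    intro h0
    have := hΩr t
    rw [h0, map_zero] at this
    exact hrpos.ne this
  · rw [(hderiv t).deriv]
    -- `boundaryTangentSpace` allows every defining function, so the velocity must be dual to a
    -- multiple of each of their differentials.
    have htan : ∀ H', IsDefiningFunction S H' → ∃ μ : ℝ, μ ≠ 0 ∧
        ∀ η, omega η (F (γ t)) = μ * fderiv ℝ H' (γ t) η := by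
      intro H' hH'
      have hx := (hH'.frontier_iff _).1 (hγfr t)
      obtain ⟨μ, hμ⟩ := hH'.exists_eq_mul_of_isMaxOn hx ((sympForm n).flip (F (γ t))) fun y hy => by
        simp only [ContinuousLinearMap.flip_apply, sympForm_apply]
        rw [hΩF, hΩF]
        have := hH.fderiv_sub_nonpos hSb.convex (hγ0 t) hy
        rw [map_sub] at this
        exact mul_le_mul_of_nonneg_left (by linarith) (div_pos hrpos (hrad t)).le
      simp only [ContinuousLinearMap.flip_apply, sympForm_apply] at hμ
      refine ⟨μ, ?_, hμ⟩
      rintro rfl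
      have := hΩr t
      rw [sympForm_apply, hμ, zero_mul] at this
      exact hrpos.ne this
    refine ⟨⟨H, hH, ?_⟩, ?_⟩
    · obtain ⟨μ, hμ0, hμ⟩ := htan H hH
      have := hμ (F (γ t))
      rw [omega_self] at this
      exact (mul_eq_zero.1 this.symm).resolve_left hμ0
    · rintro η ⟨H', hH', hη⟩
      obtain ⟨μ, -, hμ⟩ := htan H' hH'
      rw [← sympForm_apply, h.swap, sympForm_apply, hμ, hη, mul_zero, neg_zero]
  · have hval : ∫ t in (0 : ℝ)..(2 * π), omega (γ t) (deriv γ t) = r * (2 * π - 0) := by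
      rw [← hloopint 0 (2 * π) (by simpa using (hperγ 0).symm)]
      refine intervalIntegral.integral_congr fun t _ => ?_
      simp only [(hderiv t).deriv, sympForm_apply]
    rw [action, hval, minimalAction, ← hMdef, hr]
    field_simp
    ring

theorem smoothCapacity_le (hn : 1 ≤ n) {S : Set (Phase n)} (hS : IsSmoothConvexBody S)
    {c : Phase n} (hc : c ∈ interior S) :
    smoothCapacity S ≤ ENNReal.ofReal (minimalAction S c) := by
  obtain ⟨γ, hγ, hA⟩ := exists_isClosedCharacteristic hn hS hc
  have hnn : 0 ≤ minimalAction S c := by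
    have := (isSymplecticBody_centred hS.1 hc)
    have : Nontrivial (Phase n) := by
      have : Nonempty (Fin n) := ⟨⟨0, hn⟩⟩
      infer_instance
    have := (isSymplecticBody_centred hS.1 hc).isoConst_pos (P := 2 * π) (by positivity)
    rw [minimalAction]; positivity
  exact sInf_le ⟨_, ⟨γ, hγ, rfl⟩, by rw [hA, abs_of_nonneg hnn]⟩

end Characteristics

/-! ### The gauge function of a smooth convex body -/

section Centred

variable {V : Type*} [NormedAddCommGroup V] [NormedSpace ℝ V] {S : Set V} {c : V}

theorem IsConvexBody.isCompact_centred (hS : IsConvexBody S) (c : V) : IsCompact (centred S c) :=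
  hS.isCompact.image (by fun_prop)

end Centred

section Gauge

variable {n : ℕ} {C : Set (E n)} {a : E n}

theorem gaugeAt_eq (C : Set (E n)) (a x : E n) : gaugeAt C a x = gauge (centred C a) (x - a) := rfl

theorem gaugeAt_self (C : Set (E n)) (a : E n) : gaugeAt C a a = 0 := by
  rw [gaugeAt_eq, sub_self, gauge_zero]

theorem gaugeAt_add_smul (C : Set (E n)) (a w : E n) {s : ℝ} (hs : 0 ≤ s) :
    gaugeAt C a (a + s • w) = s * gaugeAt C a (a + w) := by
  rw [gaugeAt_eq, gaugeAt_eq, add_sub_cancel_left, add_sub_cancel_left, gauge_smul_of_nonneg hs,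
    smul_eq_mul]

theorem gaugeAt_pos (hC : IsConvexBody C) (ha : a ∈ interior C) {x : E n} (hx : x ≠ a) :
    0 < gaugeAt C a x :=
  (gauge_pos (absorbent_nhds_zero (centred_mem_nhds ha))
    (NormedSpace.isVonNBounded_of_isBounded _ (hC.isCompact_centred a).isBounded)).2 (sub_ne_zero.2 hx)

theorem continuous_gaugeAt (hC : IsConvexBody C) (ha : a ∈ interior C) :
    Continuous (gaugeAt C a) :=
  (continuous_gauge (convex_centred hC.convex a) (centred_mem_nhds ha)).comp
    (continuous_sub_right a)

theorem gaugeAt_eq_one_iff (hC : IsConvexBody C) (ha : a ∈ interior C) {x : E n} :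
    gaugeAt C a x = 1 ↔ x ∈ frontier C := by
  rw [gaugeAt_eq, gauge_centred_eq_one_iff hC.convex ha, sub_add_cancel]

theorem gaugeAt_le_one_iff (hC : IsConvexBody C) (ha : a ∈ interior C) {x : E n} :
    gaugeAt C a x ≤ 1 ↔ x ∈ C := by
  rw [gaugeAt_eq, gauge_le_one_iff_mem_closure (convex_centred hC.convex a) (centred_mem_nhds ha),
    (hC.isCompact_centred a).isClosed.closure_eq, mem_centred_iff, sub_add_cancel]

theorem ne_of_mem_frontier (ha : a ∈ interior C) {x : E n} (hx : x ∈ frontier C) : x ≠ a := by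
  rintro rfl
  exact (disjoint_interior_frontier).le_bot ⟨ha, hx⟩

theorem convexOn_gaugeAt (hC : IsConvexBody C) (ha : a ∈ interior C) :
    ConvexOn ℝ univ (gaugeAt C a) := by
  refine ⟨convex_univ, fun x _ y _ s t hs ht hst => ?_⟩
  have h : s • x + t • y - a = s • (x - a) + t • (y - a) := by
    rw [smul_sub, smul_sub, sub_add_sub_comm, ← add_smul, hst, one_smul]
  rw [gaugeAt_eq, h, gaugeAt_eq, gaugeAt_eq, ← gauge_smul_of_nonneg hs, ← gauge_smul_of_nonneg ht]
  exact gauge_add_le (convex_centred hC.convex a) (absorbent_nhds_zero (centred_mem_nhds ha)) _ _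

variable {H : E n → ℝ}

theorem defining_ray_eq_zero_iff (hC : IsConvexBody C) (hH : IsDefiningFunction C H)
    (ha : a ∈ interior C) (x : E n) {r : ℝ} (hr : 0 < r) :
    H (a + r • (x - a)) = 0 ↔ r * gaugeAt C a x = 1 := by
  rw [← hH.frontier_iff, ← gaugeAt_eq_one_iff hC ha, gaugeAt_add_smul _ _ _ hr.le,
    add_sub_cancel]

theorem radial_deriv_pos (hC : IsConvexBody C) (hH : IsDefiningFunction C H)
    (ha : a ∈ interior C) {y : E n} (hy : y ∈ frontier C) : 0 < fderiv ℝ H y (y - a) := by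
  have := hH.fderiv_sub_neg hC.convex ((hH.frontier_iff y).1 hy) ha
  rw [← neg_sub, map_neg]; linarith

/-- The reciprocal of the gauge is the root r of H(a + r(x - a)) = 0. H has positive radial
derivative on the boundary, so the implicit function theorem applies. -/
theorem contDiffAt_gaugeAt (hC : IsConvexBody C) (hH : IsDefiningFunction C H)
    (ha : a ∈ interior C) {x : E n} (hx : x ≠ a) : ContDiffAt ℝ ∞ (gaugeAt C a) x := by
  have hg := gaugeAt_pos hC ha hx
  set r := (gaugeAt C a x)⁻¹ with hr
  have hr0 : 0 < r := inv_pos.2 hg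
  set y := a + r • (x - a) with hy
  have hHy : H y = 0 := (defining_ray_eq_zero_iff hC hH ha x hr0).2 (inv_mul_cancel₀ hg.ne')
  let f : E n × ℝ → ℝ := fun z => H (a + z.2 • (z.1 - a))
  have hf : ContDiff ℝ ∞ f := hH.contDiff.comp (by fun_prop)
  have hpart : (fderiv ℝ f (x, r) ∘L .inr ℝ (E n) ℝ) 1 = fderiv ℝ H y (x - a) := by
    have h1 : HasDerivAt (fun s : ℝ => f (x, r + s • 1)) (fderiv ℝ f (x, r) (0, 1)) 0 := by
      have h2 : HasDerivAt (fun s : ℝ => ((x, r) : E n × ℝ) + s • ((0, 1) : E n × ℝ)) (0, 1) 0 := by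
        simpa using ((hasDerivAt_id (0 : ℝ)).smul_const ((0, 1) : E n × ℝ)).const_add (x, r)
      have h3 : HasFDerivAt f (fderiv ℝ f (x, r)) ((x, r) + (0 : ℝ) • ((0, 1) : E n × ℝ)) := by
        simpa using (hf.differentiable (by simp) (x, r)).hasFDerivAt
      simpa [Function.comp_def] using h3.comp_hasDerivAt 0 h2
    have h4 : HasDerivAt (fun s : ℝ => f (x, r + s • 1)) (fderiv ℝ H y (x - a)) 0 := by
      refine (hH.hasDerivAt_line y (x - a)).congr_of_eventuallyEq (.of_forall fun s => ?_)
      simp [f, y, add_smul, add_assoc]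
    exact h1.unique h4
  have hne : fderiv ℝ H y (x - a) ≠ 0 := by
    have h1 := radial_deriv_pos hC hH ha ((hH.frontier_iff y).2 hHy)
    rw [hy, add_sub_cancel_left, map_smul, ← hy, smul_eq_mul] at h1
    exact (pos_of_mul_pos_right h1 hr0.le).ne'
  have hinv : (fderiv ℝ f (x, r) ∘L .inr ℝ (E n) ℝ).IsInvertible := by
    have hL : fderiv ℝ f (x, r) ∘L .inr ℝ (E n) ℝ
        = (fderiv ℝ H y (x - a)) • ContinuousLinearMap.id ℝ ℝ := by
      ext; rw [hpart]; simp
    rw [hL]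
    refine ContinuousLinearMap.IsInvertible.of_inverse
      (g := (fderiv ℝ H y (x - a))⁻¹ • ContinuousLinearMap.id ℝ ℝ) ?_ ?_ <;>
    · ext; simp [hne, -map_sub]
  have hfa : ContDiffAt ℝ ∞ f (x, r) := hf.contDiffAt
  have hψ := hfa.contDiffAt_implicitFunction (by simp) hinv
  have hψx := hfa.implicitFunction_apply_self (by simp) hinv
  have hiff := hfa.eventually_apply_eq_iff_implicitFunction (by simp) hinv
  set ψ := hfa.implicitFunction (by simp) hinv
  -- Continuity of the gauge keeps its reciprocal on the branch singled out by the implicit function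
  -- theorem.
  have hcont : ContinuousAt (fun z => (z, (gaugeAt C a z)⁻¹)) x :=
    continuousAt_id.prodMk ((continuous_gaugeAt hC ha).continuousAt.inv₀ hg.ne')
  refine (hψ.inv (by rw [hψx]; exact hr0.ne')).congr_of_eventuallyEq ?_
  filter_upwards [hcont.eventually hiff, isOpen_ne.mem_nhds hx] with z hz hza
  have hgz := gaugeAt_pos hC ha hza
  have h0 : f (x, r) = 0 := hHy
  have h1 : f (z, (gaugeAt C a z)⁻¹) = 0 :=
    (defining_ray_eq_zero_iff hC hH ha z (inv_pos.2 hgz)).2 (inv_mul_cancel₀ hgz.ne')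
  have h2 := hz.1 (by rw [h0, h1])
  rw [Pi.inv_apply, h2, inv_inv]

theorem hasFDerivAt_gaugeAt (hC : IsConvexBody C) (hH : IsDefiningFunction C H)
    (ha : a ∈ interior C) {x : E n} (hx : x ≠ a) :
    HasFDerivAt (gaugeAt C a) (fderiv ℝ (gaugeAt C a) x) x :=
  ((contDiffAt_gaugeAt hC hH ha hx).differentiableAt (by simp)).hasFDerivAt

theorem hasDerivAt_line_of_hasFDerivAt {V : Type*} [NormedAddCommGroup V] [NormedSpace ℝ V]
    {W : Type*} [NormedAddCommGroup W] [NormedSpace ℝ W]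
    {f : V → W} {f' : V →L[ℝ] W} {x : V} (h : HasFDerivAt f f' x) (η : V) :
    HasDerivAt (fun s : ℝ => f (x + s • η)) (f' η) 0 := by
  have h1 : HasDerivAt (fun s : ℝ => x + s • η) η 0 := by
    simpa using ((hasDerivAt_id (0 : ℝ)).smul_const η).const_add x
  have h2 : HasFDerivAt f f' (x + (0 : ℝ) • η) := by simpa using h
  exact h2.comp_hasDerivAt 0 h1

/-- The radial derivative of the gauge function. -/
theorem fderiv_gaugeAt_radial (hC : IsConvexBody C) (hH : IsDefiningFunction C H)
    (ha : a ∈ interior C) {x : E n} (hx : x ≠ a) :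
    fderiv ℝ (gaugeAt C a) x (x - a) = gaugeAt C a x := by
  have h1 := hasDerivAt_line_of_hasFDerivAt (hasFDerivAt_gaugeAt hC hH ha hx) (x - a)
  have h2 : HasDerivAt (fun s : ℝ => (1 + s) * gaugeAt C a x) (gaugeAt C a x) 0 := by
    simpa using ((hasDerivAt_id (0 : ℝ)).const_add 1).mul_const (gaugeAt C a x)
  refine h1.unique (h2.congr_of_eventuallyEq ?_)
  filter_upwards [lt_mem_nhds (by norm_num : (-1 : ℝ) < 0)] with s hs
  have := gaugeAt_add_smul C a (x - a) (s := 1 + s) (by linarith)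
  rw [add_sub_cancel] at this
  rw [← this]
  congr 1
  rw [add_smul, one_smul]; abel

/-- A convex function lies above its tangent hyperplanes. -/
theorem _root_.ConvexOn.fderiv_sub_le {V : Type*} [NormedAddCommGroup V] [NormedSpace ℝ V]
    {f : V → ℝ} (hf : ConvexOn ℝ univ f) {f' : V →L[ℝ] ℝ} {x : V} (hx : HasFDerivAt f f' x) (y : V) :
    f' (y - x) ≤ f y - f x := by
  have h1 := hasDerivAt_line_of_hasFDerivAt hx (y - x)
  refine le_of_tendsto h1.tendsto_slope_zero_right ?_
  filter_upwards [Ioc_mem_nhdsGT (zero_lt_one' ℝ)] with s hs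
  have h2 := hf.2 (mem_univ x) (mem_univ y) (sub_nonneg.2 hs.2) hs.1.le (by ring)
  have h3 : (1 - s) • x + s • y = x + s • (y - x) := by module
  rw [h3] at h2
  simp only [zero_add, zero_smul, add_zero, smul_eq_mul] at h2 ⊢
  rw [inv_mul_le_iff₀ hs.1]
  linarith

theorem fderiv_gaugeAt_sub_le (hC : IsConvexBody C) (hH : IsDefiningFunction C H)
    (ha : a ∈ interior C) {x : E n} (hx : x ≠ a) (y : E n) :
    fderiv ℝ (gaugeAt C a) x (y - x) ≤ gaugeAt C a y - gaugeAt C a x :=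
  (convexOn_gaugeAt hC ha).fderiv_sub_le (hasFDerivAt_gaugeAt hC hH ha hx) y

theorem fderiv_gaugeAt_sub_nonpos (hC : IsConvexBody C) (hH : IsDefiningFunction C H)
    (ha : a ∈ interior C) {x y : E n} (hx : x ∈ frontier C) (hy : y ∈ C) :
    fderiv ℝ (gaugeAt C a) x (y - x) ≤ 0 := by
  have h1 := fderiv_gaugeAt_sub_le hC hH ha (ne_of_mem_frontier ha hx) y
  rw [(gaugeAt_eq_one_iff hC ha).2 hx] at h1
  linarith [(gaugeAt_le_one_iff hC ha).2 hy]

/-- The differential of the gauge function in terms of a defining function. -/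
theorem fderiv_gaugeAt_mul (hC : IsConvexBody C) (hH : IsDefiningFunction C H)
    (ha : a ∈ interior C) {x : E n} (hx : x ≠ a) (w : E n) :
    let y := a + (gaugeAt C a x)⁻¹ • (x - a)
    fderiv ℝ (gaugeAt C a) x w * fderiv ℝ H y (y - a) = fderiv ℝ H y w := by
  intro y
  have hg := gaugeAt_pos hC ha hx
  have hr0 := inv_pos.2 hg
  have hHy : H y = 0 := (defining_ray_eq_zero_iff hC hH ha x hr0).2 (inv_mul_cancel₀ hg.ne')
  have hyf := (hH.frontier_iff y).2 hHy
  have hmul : ∀ η, fderiv ℝ (gaugeAt C a) x η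
      = (gaugeAt C a x / fderiv ℝ H y (x - a)) * fderiv ℝ H y η := by
    -- By homogeneity and convexity the differential of the gauge at x is an outer normal of C at
    -- the radial projection y.
    obtain ⟨c, hc⟩ := hH.exists_eq_mul_of_isMaxOn hHy (fderiv ℝ (gaugeAt C a) x) fun z hz => by
      have h1 := fderiv_gaugeAt_sub_le hC hH ha hx (a + gaugeAt C a x • (z - a))
      rw [gaugeAt_add_smul _ _ _ hg.le, add_sub_cancel] at h1
      have h2 : gaugeAt C a x * gaugeAt C a z - gaugeAt C a x ≤ 0 := by
        nlinarith [(gaugeAt_le_one_iff hC ha).2 hz]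
      have h3 : a + gaugeAt C a x • (z - a) - x = gaugeAt C a x • (z - y) := by
        have : gaugeAt C a x • y = gaugeAt C a x • a + (x - a) := by
          simp only [y]; rw [smul_add, smul_smul, mul_inv_cancel₀ hg.ne', one_smul]
        rw [smul_sub, smul_sub, this]; abel
      rw [h3, map_smul, smul_eq_mul, map_sub] at h1
      nlinarith
    intro η
    have h1 := hc (x - a)
    rw [fderiv_gaugeAt_radial hC hH ha hx] at h1
    have h4 : fderiv ℝ H y (x - a) ≠ 0 := fun h0 => by rw [h0, mul_zero] at h1; exact hg.ne' h1
    rw [hc, h1, mul_div_cancel_right₀ _ h4]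
  have h4 : fderiv ℝ H y (x - a) ≠ 0 := fun h0 => by
    have := hmul (x - a)
    rw [fderiv_gaugeAt_radial hC hH ha hx, h0, mul_zero] at this
    exact hg.ne' this
  rw [hmul w]
  have h5 : y - a = (gaugeAt C a x)⁻¹ • (x - a) := add_sub_cancel_left _ _
  rw [h5, map_smul, smul_eq_mul]
  clear_value y
  field_simp

/-- Outer normals are multiples of the differential of the gauge function. -/
theorem eq_mul_fderiv_gaugeAt_of_isMaxOn (hC : IsConvexBody C) (hH : IsDefiningFunction C H)
    (ha : a ∈ interior C) {x : E n} (hx : x ∈ frontier C) (ℓ : E n →L[ℝ] ℝ)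
    (hℓ : ∀ y ∈ C, ℓ y ≤ ℓ x) (η : E n) : ℓ η = ℓ (x - a) * fderiv ℝ (gaugeAt C a) x η := by
  obtain ⟨c, hc⟩ := hH.exists_eq_mul_of_isMaxOn ((hH.frontier_iff x).1 hx) ℓ hℓ
  have h1 := fderiv_gaugeAt_mul hC hH ha (ne_of_mem_frontier ha hx) η
  rw [(gaugeAt_eq_one_iff hC ha).2 hx, inv_one, one_smul, add_sub_cancel] at h1
  simp only at h1
  rw [hc, hc, ← h1]; ring

end Gauge

/-! ### The Hessian of the gauge function -/

section Hessian

variable {n : ℕ} {C : Set (E n)} {a : E n} {H : E n → ℝ}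

theorem contDiffAt_fderiv_gaugeAt (hC : IsConvexBody C) (hH : IsDefiningFunction C H)
    (ha : a ∈ interior C) {x : E n} (hx : x ≠ a) :
    ContDiffAt ℝ ∞ (fderiv ℝ (gaugeAt C a)) x :=
  (contDiffAt_gaugeAt hC hH ha hx).fderiv_right (by simp)

/-- The second derivative of the gauge function along a line. -/
theorem hasDerivAt_fderiv_gaugeAt_line (hC : IsConvexBody C) (hH : IsDefiningFunction C H)
    (ha : a ∈ interior C) {x : E n} (hx : x ≠ a) (v w : E n) :
    HasDerivAt (fun s : ℝ => fderiv ℝ (gaugeAt C a) (x + s • v) w)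
      (fderiv ℝ (fderiv ℝ (gaugeAt C a)) x v w) 0 := by
  have h1 := hasDerivAt_line_of_hasFDerivAt
    (((contDiffAt_fderiv_gaugeAt hC hH ha hx).differentiableAt (by simp)).hasFDerivAt) v
  simpa using h1.clm_apply (hasDerivAt_const 0 w)

/-- The derivative of a convex function is monotone along lines: the tangent inequalities at x and
at x + sv add up to this. -/
theorem fderiv_fderiv_gaugeAt_nonneg (hC : IsConvexBody C) (hH : IsDefiningFunction C H)
    (ha : a ∈ interior C) {x : E n} (hx : x ≠ a) (v : E n) :
    0 ≤ fderiv ℝ (fderiv ℝ (gaugeAt C a)) x v v := by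
  have h1 := hasDerivAt_fderiv_gaugeAt_line hC hH ha hx v v
  refine ge_of_tendsto h1.tendsto_slope_zero_right ?_
  have hc : ContinuousAt (fun s : ℝ => x + s • v) 0 := by fun_prop
  have hne : ∀ᶠ s : ℝ in 𝓝[>] 0, x + s • v ≠ a :=
    nhdsWithin_le_nhds (hc.eventually_ne (by simpa using hx))
  filter_upwards [hne, self_mem_nhdsWithin] with s hs hs0
  have h2 := fderiv_gaugeAt_sub_le hC hH ha hx (x + s • v)
  have h3 := fderiv_gaugeAt_sub_le hC hH ha hs x
  rw [add_sub_cancel_left, map_smul, smul_eq_mul] at h2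
  rw [sub_add_cancel_left, map_neg, map_smul, smul_eq_mul] at h3
  have hs0' : (0 : ℝ) < s := hs0
  simp only [zero_add, zero_smul, add_zero, smul_eq_mul]
  refine mul_nonneg (inv_nonneg.2 hs0'.le) ?_
  by_contra! hlt
  nlinarith

/-- On tangent vectors the second derivatives of the gauge function and of a defining function are
proportional. -/
theorem fderiv_fderiv_gaugeAt_mul (hC : IsConvexBody C) (hH : IsDefiningFunction C H)
    (ha : a ∈ interior C) {x : E n} (hx : x ∈ frontier C) {v : E n} (hv : fderiv ℝ H x v = 0) :
    fderiv ℝ (fderiv ℝ (gaugeAt C a)) x v v * fderiv ℝ H x (x - a)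
      = fderiv ℝ (fderiv ℝ H) x v v := by
  have hxa := ne_of_mem_frontier ha hx
  have hgx := (gaugeAt_eq_one_iff hC ha).2 hx
  have hgv : fderiv ℝ (gaugeAt C a) x v = 0 := by
    have h1 := fderiv_gaugeAt_mul hC hH ha hxa v
    rw [hgx, inv_one, one_smul, add_sub_cancel] at h1
    simp only [hv] at h1
    exact (mul_eq_zero.1 h1).resolve_right (radial_deriv_pos hC hH ha hx).ne'
  have hcx : HasDerivAt (fun s : ℝ => x + s • v) v 0 := by
    simpa using ((hasDerivAt_id (0 : ℝ)).smul_const v).const_add x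
  have hcg := hasDerivAt_line_of_hasFDerivAt (hasFDerivAt_gaugeAt hC hH ha hxa) v
  rw [hgv] at hcg
  -- The radial projection of the line to the boundary still has velocity v, since v is tangent.
  have hπ : HasDerivAt (fun s : ℝ => a + (gaugeAt C a (x + s • v))⁻¹ • (x + s • v - a)) v 0 := by
    have := ((hcg.fun_inv (by simp [hgx])).smul (hcx.sub_const a)).const_add a
    simpa [hgx] using this
  have hHf : HasFDerivAt (fderiv ℝ H) (fderiv ℝ (fderiv ℝ H) x)
      (a + (gaugeAt C a (x + (0 : ℝ) • v))⁻¹ • (x + (0 : ℝ) • v - a)) := by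
    have h := ((hH.contDiff.fderiv_right (m := ∞) (by simp)).differentiable (by simp) x).hasFDerivAt
    simpa [hgx] using h
  have hN := hHf.comp_hasDerivAt 0 hπ
  have hL := hasDerivAt_fderiv_gaugeAt_line hC hH ha hxa v v
  have h1 := hL.mul (hN.clm_apply (hπ.sub_const a))
  have h2 := hN.clm_apply (hasDerivAt_const 0 v)
  have hne : ∀ᶠ s : ℝ in 𝓝 0, x + s • v ≠ a :=
    hcx.continuousAt.eventually_ne (by simpa using hxa)
  -- The identity `fderiv_gaugeAt_mul` is differentiated along the line; the term with the
  -- derivative of the radial factor drops out because the gauge has derivative zero in the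
  -- direction v.
  have h3 := h1.unique (h2.congr_of_eventuallyEq (by
    filter_upwards [hne] with s hs using fderiv_gaugeAt_mul hC hH ha hs v))
  simpa [hgx, hgv] using h3

/-- Positive Gauss curvature makes the Hessian of the gauge function positive on the tangent
space. -/
theorem fderiv_fderiv_gaugeAt_pos (hC : IsConvexBody C) (hH : IsDefiningFunction C H)
    (ha : a ∈ interior C) {x : E n} (hx : x ∈ frontier C) (hcurv : 0 < gaussCurvature H x)
    {v : E n} (hv : fderiv ℝ (gaugeAt C a) x v = 0) (hv0 : v ≠ 0) :
    0 < fderiv ℝ (fderiv ℝ (gaugeAt C a)) x v v := by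
  have hxa := ne_of_mem_frontier ha hx
  have hrad := radial_deriv_pos hC hH ha hx
  have hvH : fderiv ℝ H x v = 0 := by
    have h1 := fderiv_gaugeAt_mul hC hH ha hxa v
    rw [(gaugeAt_eq_one_iff hC ha).2 hx, inv_one, one_smul, add_sub_cancel] at h1
    simp only [hv, zero_mul] at h1
    exact h1.symm
  have hnorm : 0 < ‖fderiv ℝ H x‖ := norm_pos_iff.2 (hH.regular x ((hH.frontier_iff x).1 hx))
  set L := LinearMap.ker (fderiv ℝ H x).toLinearMap with hL
  set b := stdOrthonormalBasis ℝ L with hb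
  set M : Matrix (Fin (Module.finrank ℝ L)) (Fin (Module.finrank ℝ L)) ℝ := Matrix.of fun i j =>
    fderiv ℝ (fderiv ℝ H) x (b i : E n) (b j : E n) / ‖fderiv ℝ H x‖ with hM
  have hdet : 0 < M.det := hcurv
  have hsymm : ∀ u w : E n, fderiv ℝ (fderiv ℝ H) x u w = fderiv ℝ (fderiv ℝ H) x w u :=
    (hH.contDiff.contDiffAt (x := x)).isSymmSndFDerivAt (by
      rw [minSmoothness_of_isRCLikeNormedField]; exact WithTop.coe_le_coe.2 le_top)
  have hquad : ∀ y : Fin (Module.finrank ℝ L) → ℝ, star y ⬝ᵥ (M.mulVec y)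
      = fderiv ℝ (fderiv ℝ H) x ((∑ i, y i • b i : L) : E n) ((∑ i, y i • b i : L) : E n)
        / ‖fderiv ℝ H x‖ := by
    intro y
    simp only [dotProduct, Matrix.mulVec, hM, Matrix.of_apply, Submodule.coe_sum, Submodule.coe_smul,
      map_sum, map_smul, sum_apply, smul_apply, smul_eq_mul, Pi.star_apply,
      star_trivial, Finset.mul_sum, Finset.sum_div]
    rw [Finset.sum_comm]
    refine Finset.sum_congr rfl fun i _ => Finset.sum_congr rfl fun j _ => by ring
  have htan : ∀ w : L, 0 ≤ fderiv ℝ (fderiv ℝ H) x (w : E n) (w : E n) := fun w => by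
    rw [← fderiv_fderiv_gaugeAt_mul hC hH ha hx (v := (w : E n)) w.2]
    exact mul_nonneg (fderiv_fderiv_gaugeAt_nonneg hC hH ha hxa _) hrad.le
  -- Convexity gives semidefiniteness of the second fundamental form; the nonzero determinant
  -- upgrades it to definiteness.
  have hpsd : M.PosSemidef := by
    refine Matrix.PosSemidef.of_dotProduct_mulVec_nonneg ?_ fun y => ?_
    · ext i j
      simp [hM, Matrix.conjTranspose_apply, hsymm (b j : E n)]
    · rw [hquad]; exact div_nonneg (htan _) hnorm.le
  have hpd : M.PosDef := hpsd.posDef_iff_det_ne_zero.2 hdet.ne'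
  have hvL : ∑ i, b.repr ⟨v, hvH⟩ i • b i = (⟨v, hvH⟩ : L) := b.sum_repr _
  have hne : (fun i => b.repr ⟨v, hvH⟩ i) ≠ 0 := fun h0 => by
    have : (⟨v, hvH⟩ : L) = 0 := by
      rw [← hvL]
      exact Finset.sum_eq_zero fun i _ => by rw [show b.repr ⟨v, hvH⟩ i = 0 from congrFun h0 i, zero_smul]
    exact hv0 (congrArg Subtype.val this)
  have hpos := hpd.dotProduct_mulVec_pos hne
  rw [hquad, hvL] at hpos
  have h5 : 0 < fderiv ℝ (fderiv ℝ H) x v v := (div_pos_iff_of_pos_right hnorm).1 hpos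
  rw [← fderiv_fderiv_gaugeAt_mul hC hH ha hx hvH] at h5
  exact pos_of_mul_pos_left h5 hrad.le

end Hessian

/-! ### Smooth approximation of products -/

section Approximation

/-- D' ⊆ sD makes lengths for D' at most s times those for D, so shrinking an admissible loop of D
by s gives one of D', at the cost of a factor s² in area. -/
theorem isoConst_le_of_subset_smul {V : Type*} [NormedAddCommGroup V] [NormedSpace ℝ V]
    [FiniteDimensional ℝ V] {Ω : V →L[ℝ] V →L[ℝ] ℝ} {D D' : Set V} (h : IsSymplecticBody Ω D)
    (h' : IsSymplecticBody Ω D') {P s : ℝ} (hP : 0 < P) (hs : 0 < s)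
    (hsub : ∀ x ∈ D', s⁻¹ • x ∈ D) : isoConst Ω D P ≤ s ^ 2 * isoConst Ω D' P := by
  have hN : ∀ v, lengthNorm Ω D' v ≤ s * lengthNorm Ω D v := fun v => h'.lengthNorm_le fun x hx => by
    have := h.le_lengthNorm (hsub x hx) v
    rw [map_smul, smul_apply, smul_eq_mul, inv_mul_le_iff₀ hs] at this
    exact this
  have h0 : (fun _ => 0) ∈ unitSpeedLoops Ω D P :=
    ⟨⟨rfl, fun a b hab => by simpa [h.lengthNorm_zero] using hab⟩, rfl⟩
  refine csSup_le ⟨_, mem_image_of_mem _ h0⟩ ?_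
  rintro _ ⟨z, ⟨⟨hz0, hz⟩, hzP⟩, rfl⟩
  have hmem : (fun t => s⁻¹ • z t) ∈ unitSpeedLoops Ω D' P := by
    refine ⟨⟨by simp [hz0], fun a b hab => ?_⟩, by simp [hzP]⟩
    rw [← smul_sub, h'.lengthNorm_smul (inv_nonneg.2 hs.le), inv_mul_le_iff₀ hs]
    exact (hN _).trans (mul_le_mul_of_nonneg_left (hz a b hab) hs.le)
  have := h'.loopArea_le_isoConst hP hmem
  have hA : loopArea Ω P (fun t => s⁻¹ • z t) = s⁻¹ ^ 2 * loopArea Ω P z := by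
    rw [loopArea, loopArea, ← intervalIntegral.integral_const_mul]
    refine intervalIntegral.integral_congr fun t _ => ?_
    simp only [deriv_fun_const_smul_field, map_smul, smul_apply, smul_eq_mul]
    ring
  rw [hA, inv_pow, inv_mul_le_iff₀ (by positivity)] at this
  exact this

/-- A smooth convex function which vanishes exactly on the negative half line. -/
noncomputable def convexGlue (x : ℝ) : ℝ := ∫ t in (0 : ℝ)..x, expNegInvGlue t

theorem continuous_expNegInvGlue : Continuous expNegInvGlue :=
  (expNegInvGlue.contDiff (n := 0)).continuous

theorem hasDerivAt_convexGlue (x : ℝ) : HasDerivAt convexGlue (expNegInvGlue x) x :=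
  intervalIntegral.integral_hasDerivAt_right (continuous_expNegInvGlue.intervalIntegrable _ _)
    (continuous_expNegInvGlue.stronglyMeasurableAtFilter _ _) continuous_expNegInvGlue.continuousAt

theorem deriv_convexGlue : deriv convexGlue = expNegInvGlue :=
  funext fun x => (hasDerivAt_convexGlue x).deriv

theorem contDiff_convexGlue : ContDiff ℝ ∞ convexGlue := by
  refine contDiff_infty_iff_deriv.2 ⟨fun x => (hasDerivAt_convexGlue x).differentiableAt, ?_⟩
  rw [deriv_convexGlue]
  exact expNegInvGlue.contDiff (n := ⊤)

theorem monotone_convexGlue : Monotone convexGlue :=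
  monotone_of_deriv_nonneg (fun x => (hasDerivAt_convexGlue x).differentiableAt) fun x => by
    rw [deriv_convexGlue]; exact expNegInvGlue.nonneg x

theorem convexOn_convexGlue : ConvexOn ℝ univ convexGlue :=
  Monotone.convexOn_univ_of_deriv (fun x => (hasDerivAt_convexGlue x).differentiableAt) (by
    rw [deriv_convexGlue]; exact expNegInvGlue.monotone)

theorem convexGlue_eq_zero {x : ℝ} (hx : x ≤ 0) : convexGlue x = 0 := by
  rw [convexGlue, intervalIntegral.integral_congr (g := fun _ => 0)]
  · simp
  · intro t ht
    rw [uIcc_of_ge hx] at ht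
    exact expNegInvGlue.zero_of_nonpos ht.2

theorem convexGlue_nonneg (x : ℝ) : 0 ≤ convexGlue x := by
  rcases le_total x 0 with hx | hx
  · exact (convexGlue_eq_zero hx).ge
  · rw [← convexGlue_eq_zero le_rfl]; exact monotone_convexGlue hx

theorem convexGlue_pos {x : ℝ} (hx : 0 < x) : 0 < convexGlue x :=
  intervalIntegral.intervalIntegral_pos_of_pos_on (continuous_expNegInvGlue.intervalIntegrable _ _)
    (fun _ ht => expNegInvGlue.pos_of_pos ht.1) hx

variable {n : ℕ} {C : Set (E n)} {a : E n} {H : E n → ℝ}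

/-- The gauge may fail to be smooth at its centre, but the composition vanishes identically near
that point. -/
theorem contDiff_convexGlue_gaugeAt (hC : IsConvexBody C) (hH : IsDefiningFunction C H)
    (ha : a ∈ interior C) : ContDiff ℝ ∞ fun x => convexGlue (gaugeAt C a x - 1) := by
  refine contDiff_iff_contDiffAt.2 fun x => ?_
  by_cases hx : x = a
  · refine (contDiffAt_const (c := (0 : ℝ))).congr_of_eventuallyEq ?_
    have : gaugeAt C a x < 1 := by rw [hx, gaugeAt_self]; exact one_pos
    filter_upwards [(continuous_gaugeAt hC ha).continuousAt.eventually_lt_const this] with y hy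
    exact convexGlue_eq_zero (by linarith)
  · exact contDiff_convexGlue.contDiffAt.comp x
      ((contDiffAt_gaugeAt hC hH ha hx).sub contDiffAt_const)

theorem convexOn_convexGlue_gaugeAt (hC : IsConvexBody C) (ha : a ∈ interior C) :
    ConvexOn ℝ univ fun x => convexGlue (gaugeAt C a x - 1) := by
  have h1 : ConvexOn ℝ univ fun x => gaugeAt C a x - 1 := (convexOn_gaugeAt hC ha).sub (concaveOn_const 1 convex_univ)
  refine ⟨convex_univ, fun x _ y _ s t hs ht hst => ?_⟩
  exact (monotone_convexGlue (h1.2 (mem_univ x) (mem_univ y) hs ht hst)).trans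
    (convexOn_convexGlue.2 (mem_univ _) (mem_univ _) hs ht hst)

variable {K T : Set (E n)} {b : E n}

theorem IsConvexBody.prod (hK : IsConvexBody K) (hT : IsConvexBody T) : IsConvexBody (K ×ˢ T) where
  isCompact := hK.isCompact.prod hT.isCompact
  convex := hK.convex.prod hT.convex
  interior_nonempty := by
    rw [interior_prod_eq]; exact hK.interior_nonempty.prod hT.interior_nonempty

theorem mem_interior_prod (ha : a ∈ interior K) (hb : b ∈ interior T) :
    (a, b) ∈ interior (K ×ˢ T) := by
  rw [interior_prod_eq]; exact ⟨ha, hb⟩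

/-- Products of smooth convex bodies are approximated from outside by smooth convex bodies. -/
theorem exists_smooth_body (hK : IsSmoothConvexBody K) (hT : IsSmoothConvexBody T)
    (ha : a ∈ interior K) (hb : b ∈ interior T) {s : ℝ} (hs : 1 < s) :
    ∃ S : Set (Phase n), IsSmoothConvexBody S ∧ K ×ˢ T ⊆ S ∧
      ∀ x ∈ centred S (a, b), s⁻¹ • x ∈ centred (K ×ˢ T) (a, b) := by
  obtain ⟨hK, HK, hHK⟩ := hK
  obtain ⟨hT, HT, hHT⟩ := hT
  have hs0 : 0 < s := by linarith
  have hΦ := convexGlue_pos (sub_pos.2 hs)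
  -- With this k one glued term alone has value 2 at gauge s, so G ≤ 0 forces both gauges below s.
  set k := 2 / convexGlue (s - 1) with hk
  have hk0 : 0 < k := by positivity
  let G : Phase n → ℝ := fun x =>
    k * convexGlue (gaugeAt K a x.1 - 1) + k * convexGlue (gaugeAt T b x.2 - 1) - 1
  have hGs : ContDiff ℝ ∞ G :=
    ((contDiff_const.mul ((contDiff_convexGlue_gaugeAt hK hHK ha).comp contDiff_fst)).add
      (contDiff_const.mul ((contDiff_convexGlue_gaugeAt hT hHT hb).comp contDiff_snd))).sub
      contDiff_const
  have hGc : ConvexOn ℝ univ G := by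
    have h1 := ((convexOn_convexGlue_gaugeAt hK ha).comp_linearMap
      (LinearMap.fst ℝ (E n) (E n))).smul hk0.le
    have h2 := ((convexOn_convexGlue_gaugeAt hT hb).comp_linearMap
      (LinearMap.snd ℝ (E n) (E n))).smul hk0.le
    exact (h1.add h2).sub (concaveOn_const 1 convex_univ)
  have hsub : K ×ˢ T ⊆ {x | G x ≤ 0} := by
    rintro ⟨q, p⟩ ⟨hq, hp⟩
    change k * convexGlue (gaugeAt K a q - 1) + k * convexGlue (gaugeAt T b p - 1) - 1 ≤ 0
    rw [convexGlue_eq_zero (sub_nonpos.2 ((gaugeAt_le_one_iff hK ha).2 hq)),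
      convexGlue_eq_zero (sub_nonpos.2 ((gaugeAt_le_one_iff hT hb).2 hp))]
    norm_num
  have hlt : ∀ x : ℝ, k * convexGlue (x - 1) ≤ 1 → x ≤ s := by
    intro x hx
    by_contra! hlt
    have h1 := monotone_convexGlue (sub_le_sub_right hlt.le 1)
    have h2 := mul_le_mul_of_nonneg_left h1 hk0.le
    rw [hk, div_mul_cancel₀ _ hΦ.ne', ← hk] at h2
    linarith
  have hscale : ∀ {C : Set (E n)} {c y : E n}, IsConvexBody C → c ∈ interior C →
      gaugeAt C c y ≤ s → s⁻¹ • (y - c) + c ∈ C := by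
    intro C c y hC hc hy
    rw [← gaugeAt_le_one_iff hC hc, add_comm, gaugeAt_add_smul _ _ _ (inv_nonneg.2 hs0.le),
      add_sub_cancel, inv_mul_le_iff₀ hs0, mul_one]
    exact hy
  have hback : ∀ x ∈ centred {x | G x ≤ 0} (a, b), s⁻¹ • x ∈ centred (K ×ˢ T) (a, b) := by
    rintro _ ⟨⟨q, p⟩, hx, rfl⟩
    have hx' : k * convexGlue (gaugeAt K a q - 1) + k * convexGlue (gaugeAt T b p - 1) - 1 ≤ 0 := hx
    have h1 := mul_nonneg hk0.le (convexGlue_nonneg (gaugeAt K a q - 1))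
    have h2 := mul_nonneg hk0.le (convexGlue_nonneg (gaugeAt T b p - 1))
    exact mem_centred_iff.2 ⟨hscale hK ha (hlt _ (by linarith)), hscale hT hb (hlt _ (by linarith))⟩
  have hclosed : IsClosed {x | G x ≤ 0} := isClosed_le hGs.continuous continuous_const
  have hcomp : IsCompact {x | G x ≤ 0} := by
    have hcpt := (((hK.prod hT).isCompact_centred (a, b)).image
      (f := fun x : Phase n => s • x + (a, b)) (by fun_prop))
    refine hcpt.of_isClosed_subset hclosed fun x hx => ?_
    refine ⟨s⁻¹ • (x - (a, b)), hback _ (mem_image_of_mem _ hx), ?_⟩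
    simp only
    rw [smul_smul, mul_inv_cancel₀ hs0.ne', one_smul, sub_add_cancel]
  have hab := mem_interior_prod ha hb
  refine ⟨{x | G x ≤ 0}, ⟨⟨hcomp, ?_, (a, b), interior_mono hsub hab⟩, G, hGs, fun x => Iff.rfl, ?_⟩,
    hsub, hback⟩
  · have := hGc.convex_le 0
    simpa using this
  -- A critical zero of the convex function G would be a global minimum, but G(a, b) = -1.
  · intro x hx h0
    have h1 := hGc.fderiv_sub_le (hGs.differentiable (by simp) x).hasFDerivAt (a, b)
    have h2 : G (a, b) = -1 := by
      simp only [G, gaugeAt_self]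
      rw [convexGlue_eq_zero (by norm_num)]; ring
    rw [h0, hx, h2] at h1
    norm_num at h1

theorem minimalAction_pos (hn : 1 ≤ n) {S : Set (Phase n)} (hS : IsConvexBody S) {c : Phase n}
    (hc : c ∈ interior S) : 0 < minimalAction S c := by
  have : Nontrivial (Phase n) := by
    have : Nonempty (Fin n) := ⟨⟨0, hn⟩⟩
    infer_instance
  have := (isSymplecticBody_centred hS hc).isoConst_pos (P := 2 * π) (by positivity)
  rw [minimalAction]; positivity

/-- The extended capacity of a product of smooth convex bodies. -/
theorem extendedCapacity_prod (hn : 1 ≤ n) (hK : IsSmoothConvexBody K) (hT : IsSmoothConvexBody T)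
    (ha : a ∈ interior K) (hb : b ∈ interior T) :
    extendedCapacity (K ×ˢ T) = ENNReal.ofReal (minimalAction (K ×ˢ T) (a, b)) := by
  have hKT := hK.1.prod hT.1
  have hab := mem_interior_prod ha hb
  have hA := minimalAction_pos hn hKT hab
  refine le_antisymm ?_ ?_
  · have hbound : ∀ s : ℝ, 1 < s →
        extendedCapacity (K ×ˢ T) ≤ ENNReal.ofReal (s ^ 2 * minimalAction (K ×ˢ T) (a, b)) := by
      intro s hs
      obtain ⟨S, hS, hsub, hsc⟩ := exists_smooth_body hK hT ha hb hs
      have hab' := interior_mono hsub hab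
      refine (iInf₂_le_of_le S hS (iInf_le_of_le hsub le_rfl)).trans
        ((smoothCapacity_le hn hS hab').trans (ENNReal.ofReal_le_ofReal ?_))
      have h1 := isSymplecticBody_centred hKT hab
      have h2 := isSymplecticBody_centred hS.1 hab'
      have : Nontrivial (Phase n) := by
        have : Nonempty (Fin n) := ⟨⟨0, hn⟩⟩
        infer_instance
      have hP : 0 < 2 * π := by positivity
      have hi := isoConst_le_of_subset_smul h1 h2 hP (by linarith : 0 < s) hsc
      have p1 := h1.isoConst_pos hP
      have p2 := h2.isoConst_pos hP
      -- The comparison of isoperimetric constants says that the minimal action of S is at most s²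
      -- times that of K × T.
      rw [minimalAction, minimalAction, mul_div_assoc', div_le_div_iff₀ (by positivity) (by positivity)]
      have : (0 : ℝ) ≤ (2 * π) ^ 2 * 2 := by positivity
      nlinarith [mul_le_mul_of_nonneg_left hi this]
    have hlim : Tendsto (fun s : ℝ => ENNReal.ofReal (s ^ 2 * minimalAction (K ×ˢ T) (a, b)))
        (𝓝[>] 1) (𝓝 (ENNReal.ofReal ((1 : ℝ) ^ 2 * minimalAction (K ×ˢ T) (a, b)))) :=
      ((ENNReal.continuous_ofReal.comp (by fun_prop)).tendsto 1).mono_left nhdsWithin_le_nhds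
    rw [one_pow, one_mul] at hlim
    refine ge_of_tendsto hlim ?_
    filter_upwards [self_mem_nhdsWithin] with s hs using hbound s hs
  · refine le_iInf₂ fun S hS => le_iInf fun hsub => le_sInf ?_
    rintro _ ⟨_, ⟨γ, hγ, rfl⟩, rfl⟩
    exact ENNReal.ofReal_le_ofReal (minimalAction_le_abs_action hn hKT hS.1 hsub hab hγ)

end Approximation

/-! ### Billiard trajectories have at least the minimal action -/

/-- The right derivative of a curve which turns around the origin is locally integrable. -/
theorem IsSymplecticBody.locallyIntegrable_right_deriv {V : Type*} [NormedAddCommGroup V]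
    [NormedSpace ℝ V] [FiniteDimensional ℝ V] {Ω : V →L[ℝ] V →L[ℝ] ℝ} {D : Set V}
    (h : IsSymplecticBody Ω D) {c : V} {γ v : ℝ → V} (hγ : Continuous γ)
    (hd : ∀ t, HasDerivWithinAt γ (v t) (Ici t) t)
    (hle : ∀ t, lengthNorm Ω D (v t) ≤ Ω (γ t - c) (v t)) : LocallyIntegrable v := by
  have : CompleteSpace V := FiniteDimensional.complete ℝ V
  obtain ⟨C, hC⟩ := h.exists_norm_le_lengthNorm
  have hv : v = fun t => derivWithin γ (Ici t) t :=
    funext fun t => ((hd t).derivWithin (uniqueDiffWithinAt_Ici t)).symm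
  have hmeas : AEStronglyMeasurable v volume := by
    rw [hv]; exact aestronglyMeasurable_derivWithin_Ici γ volume
  intro t₀
  -- No bound on the velocity at corners is assumed. Near t₀, replacing γ t by γ t₀ costs at most
  -- half of N(v), so N(v) ≤ 2Ω(γ t₀ - c, v). The right side is a nonnegative right derivative of a
  -- scalar function, hence integrable.
  have hsmall : ∀ᶠ t in 𝓝 t₀, ‖Ω‖ * ‖γ t - γ t₀‖ * C < 1 / 2 := by
    have hc : ContinuousAt (fun t => ‖Ω‖ * ‖γ t - γ t₀‖ * C) t₀ := by fun_prop
    exact hc.eventually_lt_const (by simp)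
  obtain ⟨δ, hδ, hball⟩ := Metric.eventually_nhds_iff.1 hsmall
  have hIcc : ∀ t ∈ Icc (t₀ - δ / 2) (t₀ + δ / 2), ‖Ω‖ * ‖γ t - γ t₀‖ * C < 1 / 2 := fun t ht =>
    hball (by rw [Real.dist_eq, abs_lt]; constructor <;> linarith [ht.1, ht.2])
  have hlow : ∀ t ∈ Icc (t₀ - δ / 2) (t₀ + δ / 2),
      lengthNorm Ω D (v t) ≤ 2 * Ω (γ t₀ - c) (v t) := by
    intro t ht
    have h1 : Ω (γ t - γ t₀) (v t) ≤ 1 / 2 * lengthNorm Ω D (v t) := by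
      refine (le_abs_self _).trans (((Ω.le_opNorm₂ _ _)).trans ?_)
      have h2 := mul_le_mul_of_nonneg_left (hC (v t))
        (mul_nonneg (norm_nonneg Ω) (norm_nonneg (γ t - γ t₀)))
      have h3 := mul_le_mul_of_nonneg_right (hIcc t ht).le (h.lengthNorm_nonneg (v t))
      linarith
    have h4 : Ω (γ t - c) (v t) = Ω (γ t - γ t₀) (v t) + Ω (γ t₀ - c) (v t) := by
      rw [← add_apply, ← map_add, sub_add_sub_cancel]
    linarith [hle t]
  have hint : IntegrableOn (fun t => Ω (γ t₀ - c) (v t)) (Ioc (t₀ - δ / 2) (t₀ + δ / 2)) := by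
    refine integrableOn_deriv_right_of_nonneg (g := fun t => Ω (γ t₀ - c) (γ t))
      (by fun_prop) (fun t _ => ?_) fun t ht => ?_
    · exact ((Ω (γ t₀ - c)).hasFDerivAt.comp_hasDerivWithinAt t (hd t)).mono Ioi_subset_Ici_self
    · linarith [hlow t (Ioo_subset_Icc_self ht), h.lengthNorm_nonneg (v t)]
  refine ⟨Ioc (t₀ - δ / 2) (t₀ + δ / 2), Ioc_mem_nhds (by linarith) (by linarith), ?_⟩
  refine Integrable.mono' (hint.const_mul (C * 2)) hmeas.restrict ?_
  refine (ae_restrict_mem measurableSet_Ioc).mono fun t ht => ?_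
  have := mul_le_mul_of_nonneg_left (hlow t (Ioc_subset_Icc_self ht)) C.2
  have := hC (v t)
  simp only [NNReal.val_eq_coe] at *
  linarith

section Trajectories

variable {n : ℕ} {K T : Set (E n)} {a b : E n} {HK HT : E n → ℝ}

/-- The velocities of billiard trajectories at the boundary point `x`. -/
def admissibleVelocities (K T : Set (E n)) (a b : E n) (x : Phase n) : Set (Phase n) :=
  {v | ∃ α β : ℝ, 0 ≤ α ∧ 0 ≤ β ∧ 0 < α + β ∧ (α = 0 ∨ x.2 ∈ frontier T) ∧
    (β = 0 ∨ x.1 ∈ frontier K) ∧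
    v = (-(α • gradient (gaugeAt T b) x.2), β • gradient (gaugeAt K a) x.1)}

theorem mem_frontier_prod_iff (hK : IsConvexBody K) (hT : IsConvexBody T) {x : Phase n} :
    x ∈ frontier (K ×ˢ T) ↔ (x.1 ∈ interior K ∧ x.2 ∈ frontier T) ∨
      (x.1 ∈ frontier K ∧ x.2 ∈ interior T) ∨ (x.1 ∈ frontier K ∧ x.2 ∈ frontier T) := by
  have hfK := hK.isCompact.isClosed.frontier_eq
  have hfT := hT.isCompact.isClosed.frontier_eq
  have h1 := @interior_subset _ _ K x.1
  have h2 := @interior_subset _ _ T x.2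
  rw [frontier_prod_eq, hK.isCompact.isClosed.closure_eq, hT.isCompact.isClosed.closure_eq,
    mem_union, mem_prod, mem_prod, hfK, hfT, Set.mem_sdiff, Set.mem_sdiff]
  tauto

/-- The velocity is the ω-dual of β dg_K + α dg_T, a combination of outer normals. -/
theorem omega_velocity (x : Phase n) (α β : ℝ) (y : Phase n) :
    omega y (-(α • gradient (gaugeAt T b) x.2), β • gradient (gaugeAt K a) x.1)
      = β * fderiv ℝ (gaugeAt K a) x.1 y.1 + α * fderiv ℝ (gaugeAt T b) x.2 y.2 := by
  rw [omega, inner_neg_right, inner_smul_right, inner_smul_right, real_inner_comm,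
    real_inner_comm _ y.2, inner_gradient_left, inner_gradient_left]
  ring

theorem omega_le_of_mem_admissibleVelocities (hK : IsConvexBody K) (hT : IsConvexBody T)
    (hHK : IsDefiningFunction K HK) (hHT : IsDefiningFunction T HT)
    (ha : a ∈ interior K) (hb : b ∈ interior T) {x v : Phase n}
    (hv : v ∈ admissibleVelocities K T a b x) {y : Phase n} (hy : y ∈ K ×ˢ T) :
    omega y v ≤ omega x v := by
  obtain ⟨α, β, hα, hβ, -, h1, h2, rfl⟩ := hv
  rw [omega_velocity, omega_velocity]
  have e1 : β * fderiv ℝ (gaugeAt K a) x.1 (y.1 - x.1) ≤ 0 := by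
    rcases h2 with rfl | h2
    · simp
    · exact mul_nonpos_of_nonneg_of_nonpos hβ (fderiv_gaugeAt_sub_nonpos hK hHK ha h2 hy.1)
  have e2 : α * fderiv ℝ (gaugeAt T b) x.2 (y.2 - x.2) ≤ 0 := by
    rcases h1 with rfl | h1
    · simp
    · exact mul_nonpos_of_nonneg_of_nonpos hα (fderiv_gaugeAt_sub_nonpos hT hHT hb h1 hy.2)
  rw [map_sub] at e1 e2
  linarith

/-- By homogeneity of the gauges the value is α + β. -/
theorem omega_pos_of_mem_admissibleVelocities (hK : IsConvexBody K) (hT : IsConvexBody T)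
    (hHK : IsDefiningFunction K HK) (hHT : IsDefiningFunction T HT)
    (ha : a ∈ interior K) (hb : b ∈ interior T) {x v : Phase n}
    (hv : v ∈ admissibleVelocities K T a b x) : 0 < omega (x - (a, b)) v := by
  obtain ⟨α, β, hα, hβ, hαβ, h1, h2, rfl⟩ := hv
  have e1 : β * fderiv ℝ (gaugeAt K a) x.1 (x.1 - a) = β := by
    rcases h2 with rfl | h2
    · simp
    · rw [fderiv_gaugeAt_radial hK hHK ha (ne_of_mem_frontier ha h2),
        (gaugeAt_eq_one_iff hK ha).2 h2, mul_one]
  have e2 : α * fderiv ℝ (gaugeAt T b) x.2 (x.2 - b) = α := by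
    rcases h1 with rfl | h1
    · simp
    · rw [fderiv_gaugeAt_radial hT hHT hb (ne_of_mem_frontier hb h1),
        (gaugeAt_eq_one_iff hT hb).2 h1, mul_one]
  rw [omega_velocity]
  simp only [Prod.fst_sub, Prod.snd_sub]
  linarith

theorem IsBilliardTrajectory.exists_right_deriv (hK : IsConvexBody K) (hT : IsConvexBody T)
    {γ : ℝ → Phase n} (hγ : IsBilliardTrajectory K T a b γ) (t : ℝ) :
    ∃ v ∈ admissibleVelocities K T a b (γ t), HasDerivWithinAt γ v (Ici t) t := by
  obtain ⟨d, hd, hq, hp⟩ := hγ.flow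
  rcases (mem_frontier_prod_iff hK hT).1 (hγ.mem_frontier t) with ⟨h1, h2⟩ | ⟨h1, h2⟩ | ⟨h1, h2⟩
  · refine ⟨_, ⟨d, 0, hd.le, le_rfl, by simpa, .inr h2, .inl rfl, rfl⟩, ?_⟩
    simpa using (hq t h1 h2).hasDerivWithinAt (s := Ici t)
  · refine ⟨_, ⟨0, d, le_rfl, hd.le, by simpa, .inl rfl, .inr h1, rfl⟩, ?_⟩
    simpa using (hp t h1 h2).hasDerivWithinAt (s := Ici t)
  · obtain ⟨v, ⟨α, β, hα, hβ, hne, rfl⟩, hv⟩ := hγ.right_reflection t h1 h2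
    refine ⟨_, ⟨α, β, hα, hβ, ?_, .inr h2, .inr h1, rfl⟩, ?_⟩
    · by_contra! hle
      exact hne (by rw [Prod.mk.injEq]; constructor <;> linarith)
    · simpa using hv

/-- The velocity of a billiard trajectory. -/
theorem IsBilliardTrajectory.exists_velocity (hK : IsConvexBody K) (hT : IsConvexBody T)
    (hHK : IsDefiningFunction K HK) (hHT : IsDefiningFunction T HT)
    (ha : a ∈ interior K) (hb : b ∈ interior T) {γ : ℝ → Phase n}
    (hγ : IsBilliardTrajectory K T a b γ) :
    ∃ v : ℝ → Phase n, (∀ t, v t ∈ admissibleVelocities K T a b (γ t)) ∧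
      (∀ t, HasDerivWithinAt γ (v t) (Ici t) t) ∧ (∀ᵐ t, HasDerivAt γ (v t) t) ∧
      (∀ t, lengthNorm (sympForm n) (centred (K ×ˢ T) (a, b)) (v t)
        = sympForm n (γ t - (a, b)) (v t)) ∧ IntervalIntegrable v volume 0 (2 * π) := by
  choose v hv hd using hγ.exists_right_deriv hK hT
  have hKT := hK.prod hT
  have hab := mem_interior_prod ha hb
  have hmem : ∀ t, γ t ∈ K ×ˢ T := fun t =>
    hKT.isCompact.isClosed.frontier_subset (hγ.mem_frontier t)
  have hN : ∀ t, lengthNorm (sympForm n) (centred (K ×ˢ T) (a, b)) (v t)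
      = sympForm n (γ t - (a, b)) (v t) := fun t =>
    lengthNorm_eq_of_normal hKT hab (hmem t) fun y hy =>
      omega_le_of_mem_admissibleVelocities hK hT hHK hHT ha hb (hv t) hy
  have hcont := hγ.piecewiseSmooth.continuous
  obtain ⟨F, hF0, hF⟩ := hγ.piecewiseSmooth.smooth_off_null
  refine ⟨v, hv, hd, ?_, hN, ?_⟩
  · filter_upwards [measure_eq_zero_iff_ae_notMem.1 hF0] with t ht
    have hdt : HasDerivAt γ (deriv γ t) t := ((hF t ht).differentiableAt (by simp)).hasDerivAt
    rwa [(uniqueDiffWithinAt_Ici t).eq_deriv _ (hd t) hdt.hasDerivWithinAt]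
  · have hloc := (isSymplecticBody_centred hKT hab).locallyIntegrable_right_deriv hcont hd
      fun t => (hN t).le
    rw [intervalIntegrable_iff_integrableOn_Icc_of_le (by positivity)]
    exact hloc.integrableOn_isCompact isCompact_Icc

theorem IsBilliardTrajectory.action_eq {γ v : ℝ → Phase n} (hv : ∀ᵐ t, HasDerivAt γ (v t) t) :
    action γ = (1 / 2) * ∫ t in (0 : ℝ)..(2 * π), omega (γ t) (v t) := by
  rw [action]
  congr 1
  refine intervalIntegral.integral_congr_ae ?_
  filter_upwards [hv] with t ht _
  rw [ht.deriv]

theorem IsBilliardTrajectory.minimalAction_le_action (hn : 1 ≤ n)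
    (hK : IsConvexBody K) (hT : IsConvexBody T)
    (hHK : IsDefiningFunction K HK) (hHT : IsDefiningFunction T HT)
    (ha : a ∈ interior K) (hb : b ∈ interior T) {γ : ℝ → Phase n}
    (hγ : IsBilliardTrajectory K T a b γ) : minimalAction (K ×ˢ T) (a, b) ≤ action γ := by
  obtain ⟨v, hv, hd, hae, hN, hint⟩ := hγ.exists_velocity hK hT hHK hHT ha hb
  have hcont := hγ.piecewiseSmooth.continuous
  rw [IsBilliardTrajectory.action_eq hae]
  refine minimalAction_le hn (hK.prod hT) (mem_interior_prod ha hb) hcont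
    (by simpa using (hγ.periodic 0).symm) hint (fun x hx y hy hxy => ?_) (fun t h0 => ?_)
    fun t => (hN t).le
  · refine intervalIntegral.integral_eq_sub_of_hasDeriv_right hcont.continuousOn
      (fun t _ => (hd t).mono Ioi_subset_Ici_self) (hint.mono_set ?_)
    rw [uIcc_of_le hxy, uIcc_of_le (by positivity)]
    exact Icc_subset_Icc hx.1 hy.2
  · have := omega_pos_of_mem_admissibleVelocities hK hT hHK hHT ha hb (hv t)
    rw [h0, ← sympForm_apply, map_zero] at this
    exact this.false

theorem supportFunction_eq_of_forall_le {C : Set (E n)} {x u : E n} (hx : x ∈ C)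
    (hu : ∀ y ∈ C, inner ℝ y u ≤ inner ℝ x u) : supportFunction C u = inner ℝ x u :=
  IsGreatest.csSup_eq ⟨mem_image_of_mem _ hx, by rintro _ ⟨y, hy, rfl⟩; exact hu y hy⟩

/-- The length of the projection of a billiard trajectory is its action. -/
theorem IsBilliardTrajectory.tableLength_eq (hK : IsConvexBody K) (hT : IsConvexBody T)
    (hHK : IsDefiningFunction K HK) (hHT : IsDefiningFunction T HT)
    (ha : a ∈ interior K) (hb : b ∈ interior T) {γ : ℝ → Phase n}
    (hγ : IsBilliardTrajectory K T a b γ) :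
    tableLength T (fun t => (γ t).1) = action γ := by
  obtain ⟨v, hv, hd, hae, hN, hint⟩ := hγ.exists_velocity hK hT hHK hHT ha hb
  have hcont := hγ.piecewiseSmooth.continuous
  have hKT := hK.prod hT
  have hmem : ∀ t, γ t ∈ K ×ˢ T := fun t =>
    hKT.isCompact.isClosed.frontier_subset (hγ.mem_frontier t)
  -- Varying only the p-component shows that -q' is an outer normal of T at p.
  have hsupp : ∀ t, supportFunction T (-(v t).1) = -inner ℝ (γ t).2 (v t).1 := fun t => by
    rw [← inner_neg_right]
    refine supportFunction_eq_of_forall_le (hmem t).2 fun y hy => ?_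
    have := omega_le_of_mem_admissibleVelocities hK hT hHK hHT ha hb (hv t)
      (y := ((γ t).1, y)) ⟨(hmem t).1, hy⟩
    rw [omega, omega] at this
    rw [inner_neg_right, inner_neg_right]
    linarith
  have hd1 : ∀ t, HasDerivWithinAt (fun t => (γ t).1) (v t).1 (Ici t) t := fun t =>
    (ContinuousLinearMap.fst ℝ (E n) (E n)).hasFDerivAt.comp_hasDerivWithinAt t (hd t)
  have hd2 : ∀ t, HasDerivWithinAt (fun t => (γ t).2) (v t).2 (Ici t) t := fun t =>
    (ContinuousLinearMap.snd ℝ (E n) (E n)).hasFDerivAt.comp_hasDerivWithinAt t (hd t)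
  have hi1 : IntervalIntegrable (fun t => inner ℝ (γ t).1 (v t).2) volume 0 (2 * π) :=
    intervalIntegrable_bilin ((innerSL ℝ).bilinearComp (.fst ℝ (E n) (E n)) (.snd ℝ (E n) (E n)))
      hcont.continuousOn hint
  have hi2 : IntervalIntegrable (fun t => inner ℝ (γ t).2 (v t).1) volume 0 (2 * π) :=
    intervalIntegrable_bilin ((innerSL ℝ).bilinearComp (.snd ℝ (E n) (E n)) (.fst ℝ (E n) (E n)))
      hcont.continuousOn hint
  -- The integrand is the right derivative of ⟨q, p⟩, so both halves of the action integral
  -- contribute equally.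
  have hzero : ∫ t in (0 : ℝ)..(2 * π), (inner ℝ (γ t).1 (v t).2 + inner ℝ (γ t).2 (v t).1) = 0 := by
    rw [intervalIntegral.integral_eq_sub_of_hasDeriv_right
      (f := fun t => inner ℝ (γ t).1 (γ t).2) (by fun_prop) (fun t _ => ?_) (hi1.add hi2)]
    · have := hγ.periodic 0
      rw [zero_add] at this
      rw [this, sub_self]
    · have := ((hd1 t).inner ℝ (hd2 t)).mono Ioi_subset_Ici_self
      rwa [real_inner_comm (γ t).2 (v t).1] at this
  rw [intervalIntegral.integral_add hi1 hi2] at hzero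
  have hlen : tableLength T (fun t => (γ t).1)
      = ∫ t in (0 : ℝ)..(2 * π), -inner ℝ (γ t).2 (v t).1 := by
    refine intervalIntegral.integral_congr_ae ?_
    filter_upwards [hae] with t ht _
    have h1 : HasDerivAt (fun t => (γ t).1) (v t).1 t :=
      (ContinuousLinearMap.fst ℝ (E n) (E n)).hasFDerivAt.comp_hasDerivAt t ht
    rw [h1.deriv, hsupp]
  rw [hlen, IsBilliardTrajectory.action_eq hae, intervalIntegral.integral_neg]
  simp only [omega]
  rw [intervalIntegral.integral_sub hi1 hi2]
  linarith

end Trajectories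

/-! ### Differential inequalities for Lipschitz functions -/

section RealLemmas

/-- On S near t₀ the curve is the primitive of the continuous function G; half lines S give
one-sided derivatives. -/
theorem hasDerivWithinAt_of_ae {V : Type*} [NormedAddCommGroup V] [NormedSpace ℝ V]
    [FiniteDimensional ℝ V] {γ G : ℝ → V} {C : ℝ≥0} (hγ : LipschitzWith C γ) {t₀ δ : ℝ} (hδ : 0 < δ)
    {S : Set ℝ} (hS : S.OrdConnected) (ht₀ : t₀ ∈ S) (hG : ContinuousOn G (Metric.ball t₀ δ))
    (hae : ∀ᵐ t, t ∈ Metric.ball t₀ δ → t ∈ S → HasDerivAt γ (G t) t) :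
    HasDerivWithinAt γ (G t₀) S t₀ := by
  have : CompleteSpace V := FiniteDimensional.complete ℝ V
  have hmeas : StronglyMeasurableAtFilter G (𝓝 t₀) :=
    hG.stronglyMeasurableAtFilter Metric.isOpen_ball t₀ (Metric.mem_ball_self hδ)
  have hint : HasDerivAt (fun t => γ t₀ + ∫ s in t₀..t, G s) (G t₀) t₀ :=
    (intervalIntegral.integral_hasDerivAt_right (by simp) hmeas
      (hG.continuousAt (Metric.ball_mem_nhds t₀ hδ))).const_add _
  refine hint.hasDerivWithinAt.congr_of_eventuallyEq ?_ (by simp)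
  filter_upwards [self_mem_nhdsWithin, nhdsWithin_le_nhds (Metric.ball_mem_nhds t₀ hδ)] with t ht htb
  have hsub := (convex_ball t₀ δ).ordConnected.uIcc_subset (Metric.mem_ball_self hδ) htb
  rw [(integral_of_lipschitzOn_of_ae_hasDerivAt (f' := G) (hγ.lipschitzOnWith (s := uIcc t₀ t)) (by
    filter_upwards [hae] with s hs hsm using hs (hsub hsm) (hS.uIcc_subset ht₀ ht hsm))).2]
  abel

theorem le_of_ae_deriv_nonneg {φ φ' : ℝ → ℝ} {C : ℝ≥0} {s t : ℝ} (hst : s ≤ t)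
    (hφ : LipschitzOnWith C φ (Icc s t))
    (hae : ∀ᵐ u, u ∈ Icc s t → HasDerivAt φ (φ' u) u ∧ 0 ≤ φ' u) : φ s ≤ φ t := by
  rw [← uIcc_of_le hst] at hφ hae
  obtain ⟨-, h2⟩ := integral_of_lipschitzOn_of_ae_hasDerivAt hφ (f' := φ')
    (by filter_upwards [hae] with u hu hm using (hu hm).1)
  have : 0 ≤ ∫ u in s..t, φ' u := by
    refine intervalIntegral.integral_nonneg_of_ae_restrict hst ?_
    rw [EventuallyLE, ae_restrict_iff' measurableSet_Icc]
    rw [uIcc_of_le hst] at hae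
    filter_upwards [hae] with u hu hm using (hu hm).2
  linarith

/-- Two nonpositive functions which vanish at `t₀` and move in opposite directions. -/
theorem eq_zero_of_opposite_monotone {f h α β σ : ℝ → ℝ} {C C' : ℝ≥0} {t₀ δ : ℝ}
    (hf : LipschitzOnWith C f (Metric.ball t₀ δ)) (hh : LipschitzOnWith C' h (Metric.ball t₀ δ))
    (hf0 : ∀ t, f t ≤ 0) (hh0 : ∀ t, h t ≤ 0) (hft : f t₀ = 0) (hht : h t₀ = 0)
    (hσ : ∀ t ∈ Metric.ball t₀ δ, 0 < σ t)
    (hae : ∀ᵐ t, t ∈ Metric.ball t₀ δ → 0 ≤ α t ∧ 0 ≤ β t ∧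
      HasDerivAt f (-(α t * σ t)) t ∧ HasDerivAt h (β t * σ t) t) :
    ∀ᵐ t, t ∈ Metric.ball t₀ δ → (t₀ < t → β t = 0) ∧ (t < t₀ → α t = 0) := by
  rcases le_or_gt δ 0 with hδ | hδ
  · exact .of_forall fun t ht => by rw [Metric.ball_eq_empty.2 hδ] at ht; exact ht.elim
  have hsub : ∀ s ∈ Metric.ball t₀ δ, ∀ t ∈ Metric.ball t₀ δ, Icc s t ⊆ Metric.ball t₀ δ :=
    fun s hs t ht => (convex_ball t₀ δ).ordConnected.out hs ht
  have ht₀ : t₀ ∈ Metric.ball t₀ δ := Metric.mem_ball_self hδ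
  -- h increases from its maximal value 0, so it stays zero to the right of t₀; likewise f, which
  -- decreases to 0, is zero to the left. A constant function leaves no room for its coefficient, as
  -- σ > 0.
  have hh1 : ∀ t ∈ Metric.ball t₀ δ, t₀ < t → h t = 0 := fun t ht htt => by
    refine le_antisymm (hh0 t) ?_
    rw [← hht]
    refine le_of_ae_deriv_nonneg (φ' := fun u => β u * σ u) htt.le (hh.mono (hsub _ ht₀ _ ht)) ?_
    filter_upwards [hae] with u hu hm
    obtain ⟨-, h2, -, h4⟩ := hu (hsub _ ht₀ _ ht hm)
    exact ⟨h4, mul_nonneg h2 (hσ u (hsub _ ht₀ _ ht hm)).le⟩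
  have hf1 : ∀ t ∈ Metric.ball t₀ δ, t < t₀ → f t = 0 := fun t ht htt => by
    refine le_antisymm (hf0 t) ?_
    have := le_of_ae_deriv_nonneg (φ := fun t => -f t) htt.le
      (hf.neg.mono (hsub _ ht _ ht₀)) (φ' := fun u => α u * σ u) (by
      filter_upwards [hae] with u hu hm
      obtain ⟨h1, -, h3, -⟩ := hu (hsub _ ht _ ht₀ hm)
      exact ⟨by simpa using h3.fun_neg, mul_nonneg h1 (hσ u (hsub _ ht _ ht₀ hm)).le⟩)
    linarith
  filter_upwards [hae] with t ht htb
  obtain ⟨-, -, h3, h4⟩ := ht htb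
  have hσt := (hσ t htb).ne'
  constructor
  · intro htt
    have h5 : h =ᶠ[𝓝 t] fun _ => 0 := by
      filter_upwards [Metric.isOpen_ball.mem_nhds htb, lt_mem_nhds htt] with u hu htu
        using hh1 u hu htu
    have := (h4.congr_of_eventuallyEq h5.symm).unique (hasDerivAt_const t 0)
    exact (mul_eq_zero.1 this).resolve_right hσt
  · intro htt
    have h5 : f =ᶠ[𝓝 t] fun _ => 0 := by
      filter_upwards [Metric.isOpen_ball.mem_nhds htb, gt_mem_nhds htt] with u hu htu
        using hf1 u hu htu
    have := (h3.congr_of_eventuallyEq h5.symm).unique (hasDerivAt_const t 0)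
    exact (mul_eq_zero.1 (neg_eq_zero.1 this)).resolve_right hσt

/-- A Grönwall inequality for Lipschitz functions. -/
theorem exists_eq_zero_of_abs_deriv_le {e : ℝ → ℝ} {C : ℝ≥0} {t₀ δ L : ℝ} (hδ : 0 < δ) (hL : 0 ≤ L)
    (he : LipschitzOnWith C e (Metric.ball t₀ δ)) (he0 : ∀ t ∈ Metric.ball t₀ δ, 0 ≤ e t)
    (het : e t₀ = 0)
    (hae : ∀ᵐ t, t ∈ Metric.ball t₀ δ → ∃ e', HasDerivAt e e' t ∧ |e'| ≤ L * e t) :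
    ∃ δ' > 0, δ' ≤ δ ∧ ∀ t ∈ Metric.ball t₀ δ', e t = 0 := by
  -- The radius makes Lr ≤ 1/2; at a maximum point s of e on the ball, e s ≤ L · e s · r then forces
  -- e s ≤ 0.
  set r := min (δ / 2) (1 / (2 * (L + 1))) with hr
  have hr0 : 0 < r := by positivity
  have hrδ : r < δ := (min_le_left _ _).trans_lt (by linarith)
  have hrL : L * r ≤ 1 / 2 := by
    have h1 : r ≤ 1 / (2 * (L + 1)) := min_le_right _ _
    calc L * r ≤ L * (1 / (2 * (L + 1))) := mul_le_mul_of_nonneg_left h1 hL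
      _ ≤ 1 / 2 := by
        rw [mul_one_div, div_le_div_iff₀ (by positivity) (by positivity)]; linarith
  have hsub : Metric.closedBall t₀ r ⊆ Metric.ball t₀ δ := Metric.closedBall_subset_ball hrδ
  obtain ⟨s, hs, hmax⟩ := (isCompact_closedBall t₀ r).exists_isMaxOn
    ⟨t₀, Metric.mem_closedBall_self hr0.le⟩ (he.continuousOn.mono hsub)
  have hle : e s ≤ L * e s * r := by
    have hsub' : uIcc t₀ s ⊆ Metric.closedBall t₀ r :=
      (convex_closedBall t₀ r).ordConnected.uIcc_subset (Metric.mem_closedBall_self hr0.le) hs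
    have hder : ∀ᵐ t, t ∈ uIcc t₀ s → HasDerivAt e (deriv e t) t := by
      filter_upwards [hae] with t ht hm
      obtain ⟨e', h1, -⟩ := ht (hsub (hsub' hm))
      rwa [h1.deriv]
    have h2 := (integral_of_lipschitzOn_of_ae_hasDerivAt (he.mono (hsub'.trans hsub)) hder).2
    have h3 : ‖∫ t in t₀..s, deriv e t‖ ≤ L * e s * |s - t₀| := by
      refine intervalIntegral.norm_integral_le_of_norm_le_const_ae ?_
      filter_upwards [hae] with t ht hm
      have hm' := hsub' (uIoc_subset_uIcc hm)
      obtain ⟨e', h1, h4⟩ := ht (hsub hm')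
      rw [h1.deriv, Real.norm_eq_abs]
      exact h4.trans (mul_le_mul_of_nonneg_left (hmax hm') hL)
    rw [h2, het, sub_zero, Real.norm_eq_abs] at h3
    rw [Metric.mem_closedBall, Real.dist_eq] at hs
    exact (le_abs_self _).trans (h3.trans (mul_le_mul_of_nonneg_left hs
      (mul_nonneg hL (he0 s (hsub hs)))))
  have hes : e s ≤ 0 := by
    have := he0 s (hsub hs)
    nlinarith
  refine ⟨r, hr0, hrδ.le, fun t ht => le_antisymm ?_ (he0 t (hsub (Metric.ball_subset_closedBall ht)))⟩
  exact (hmax (Metric.ball_subset_closedBall ht)).trans hes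

/-- Smooth functions of Lipschitz curves are locally Lipschitz. -/
theorem exists_lipschitzOn_ball {V : Type*} [NormedAddCommGroup V] [NormedSpace ℝ V]
    {F : V → ℝ} {γ : ℝ → V} {C : ℝ≥0} (hγ : LipschitzWith C γ) {t₀ : ℝ}
    (hF : ContDiffAt ℝ 1 F (γ t₀)) :
    ∃ C' : ℝ≥0, ∀ᶠ δ in 𝓝[>] (0 : ℝ), LipschitzOnWith C' (fun t => F (γ t)) (Metric.ball t₀ δ) := by
  obtain ⟨L, s, hs, hL⟩ := hF.exists_lipschitzOnWith
  obtain ⟨δ₀, hδ₀, hball⟩ := Metric.mem_nhds_iff.1 (hγ.continuous.continuousAt.preimage_mem_nhds hs)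
  refine ⟨L * C, ?_⟩
  filter_upwards [Ioo_mem_nhdsGT hδ₀] with δ hδ
  exact hL.comp hγ.lipschitzOnWith fun t ht => hball (Metric.ball_subset_ball hδ.2.le ht)

/-- Conditions which hold near a point hold on small balls. -/
theorem eventually_forall_ball {p : ℝ → Prop} {t₀ : ℝ} (hp : ∀ᶠ t in 𝓝 t₀, p t) :
    ∀ᶠ δ in 𝓝[>] (0 : ℝ), ∀ t ∈ Metric.ball t₀ δ, p t := by
  obtain ⟨δ₀, hδ₀, hball⟩ := Metric.eventually_nhds_iff_ball.1 hp
  filter_upwards [Ioo_mem_nhdsGT hδ₀] with δ hδ t ht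
  exact hball t (Metric.ball_subset_ball hδ.2.le ht)

end RealLemmas

/-! ### Generalised trajectories -/

section Generalised

variable {n : ℕ} {K T : Set (E n)} {a b : E n} {HK HT : E n → ℝ}

/-- Lipschitz curves on the boundary of `K × T` which satisfy the billiard equations almost
everywhere. -/
structure IsGeneralisedTrajectory (K T : Set (E n)) (a b : E n) (d : ℝ) (α β : ℝ → ℝ)
    (γ : ℝ → Phase n) : Prop where
  lipschitz : ∃ C, LipschitzWith C γ
  pos : 0 < d
  mem_frontier : ∀ t, γ t ∈ frontier (K ×ˢ T)
  ae : ∀ᵐ t, 0 ≤ α t ∧ 0 ≤ β t ∧ α t + β t = d ∧ (α t = 0 ∨ (γ t).2 ∈ frontier T) ∧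
    (β t = 0 ∨ (γ t).1 ∈ frontier K) ∧
    HasDerivAt γ (-(α t • gradient (gaugeAt T b) (γ t).2), β t • gradient (gaugeAt K a) (γ t).1) t

/-- At a boundary point the normal is a multiple of the gradient, with factor read off on the radial
vector; at an interior point a linear functional with a maximum is zero. -/
theorem eq_smul_gradient_of_isMaxOn {C : Set (E n)} {H : E n → ℝ} {c : E n} (hC : IsConvexBody C)
    (hH : IsDefiningFunction C H) (hc : c ∈ interior C) {x w : E n} (hx : x ∈ C)
    (hw : ∀ y ∈ C, inner ℝ y w ≤ inner ℝ x w) :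
    0 ≤ inner ℝ (x - c) w ∧ (inner ℝ (x - c) w = 0 ∨ x ∈ frontier C) ∧
      w = (inner ℝ (x - c) w) • gradient (gaugeAt C c) x := by
  refine ⟨by rw [inner_sub_left]; linarith [hw c (interior_subset hc)], ?_⟩
  by_cases hfr : x ∈ frontier C
  · refine ⟨.inr hfr, ext_inner_left ℝ fun η => ?_⟩
    have := eq_mul_fderiv_gaugeAt_of_isMaxOn hC hH hc hfr ((innerSL ℝ) w) (fun y hy => by
      simp only [innerSL_apply_apply]
      rw [real_inner_comm, real_inner_comm x]
      exact hw y hy) η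
    simp only [innerSL_apply_apply] at this
    rw [real_inner_comm, this, inner_smul_right, real_inner_comm _ η, inner_gradient_left,
      real_inner_comm w]
  · have hint : x ∈ interior C := by
      rw [hC.isCompact.isClosed.frontier_eq, Set.mem_sdiff, not_and, not_not] at hfr
      exact hfr hx
    have hmax : IsLocalMax (fun y => (innerSL ℝ) w y) x := by
      filter_upwards [mem_interior_iff_mem_nhds.1 hint] with y hy
      simp only [innerSL_apply_apply]
      rw [real_inner_comm, real_inner_comm x]
      exact hw y hy
    have h0 := hmax.hasFDerivAt_eq_zero ((innerSL ℝ) w).hasFDerivAt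
    have hw0 : w = 0 := by
      have := congrArg (fun ℓ : E n →L[ℝ] ℝ => ℓ w) h0
      simpa using this
    simp [hw0]

/-- This is the isoperimetric minimiser for K × T. The normal cone of a product splits, as seen by
varying q and p separately, and the constant pairing with the velocity becomes α + β = d. -/
theorem exists_isGeneralisedTrajectory (hn : 1 ≤ n) (hK : IsConvexBody K) (hT : IsConvexBody T)
    (hHK : IsDefiningFunction K HK) (hHT : IsDefiningFunction T HT)
    (ha : a ∈ interior K) (hb : b ∈ interior T) :
    ∃ (d : ℝ) (α β : ℝ → ℝ) (γ : ℝ → Phase n), IsGeneralisedTrajectory K T a b d α β γ ∧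
      Function.Periodic γ (2 * π) ∧ action γ = minimalAction (K ×ˢ T) (a, b) := by
  have hKT := hK.prod hT
  have hab := mem_interior_prod ha hb
  have h := isSymplecticBody_centred hKT hab
  have : Nontrivial (Phase n) := by
    have : Nonempty (Fin n) := ⟨⟨0, hn⟩⟩
    infer_instance
  have hP : 0 < 2 * π := by positivity
  have hM := h.isoConst_pos hP
  obtain ⟨γ₀, C, hLip, hper, hg, hae⟩ := h.exists_minimizer hP
  set M := isoConst (sympForm n) (centred (K ×ˢ T) (a, b)) (2 * π) with hMdef
  set d := 2 * π / M with hd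
  have hdpos : 0 < d := by positivity
  set γ : ℝ → Phase n := fun t => γ₀ t + (a, b) with hγ
  have hγLip : LipschitzWith C γ := LipschitzWith.of_dist_le_mul fun s t => by
    simpa [hγ] using hLip.dist_le_mul s t
  have hfr : ∀ t, γ t ∈ frontier (K ×ˢ T) := fun t =>
    (gauge_centred_eq_one_iff hKT.convex hab _).1 (hg t)
  have hmem : ∀ t, γ t ∈ K ×ˢ T := fun t => hKT.isCompact.isClosed.frontier_subset (hfr t)
  have hae' : ∀ᵐ t, HasDerivAt γ (deriv γ t) t ∧
      lengthNorm (sympForm n) (centred (K ×ˢ T) (a, b)) (deriv γ t) = d ∧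
        sympForm n (γ t - (a, b)) (deriv γ t) = d := by
    filter_upwards [hae] with t ⟨hd, hN, hΩ⟩
    have hd' : HasDerivAt γ (deriv γ₀ t) t := hd.hasDerivAt.add_const (a, b)
    rw [hd'.deriv]
    refine ⟨hd', hN, ?_⟩
    simpa only [hγ, add_sub_cancel_right] using hΩ
  have hperγ : Function.Periodic γ (2 * π) := fun t => by simp only [hγ, hper t]
  refine ⟨d, fun t => inner ℝ ((γ t).2 - b) (-(deriv γ t).1),
    fun t => inner ℝ ((γ t).1 - a) (deriv γ t).2, γ, ⟨⟨C, hγLip⟩, hdpos, hfr, ?_⟩, hperγ, ?_⟩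
  · filter_upwards [hae'] with t ⟨hdt, hN, hΩ⟩
    set v := deriv γ t
    have hmax : ∀ y ∈ K ×ˢ T, omega y v ≤ omega (γ t) v := fun y hy => by
      have h1 := h.le_lengthNorm (mem_image_of_mem _ hy) v
      rw [hN, ← hΩ] at h1
      simp only [map_sub, sub_apply] at h1
      rw [← sympForm_apply, ← sympForm_apply]
      linarith
    obtain ⟨e1, e2, e3⟩ := eq_smul_gradient_of_isMaxOn hK hHK ha (hmem t).1 (w := v.2) fun y hy => by
      have := hmax (y, (γ t).2) ⟨hy, (hmem t).2⟩
      rw [omega, omega] at this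
      linarith
    obtain ⟨e4, e5, e6⟩ := eq_smul_gradient_of_isMaxOn hT hHT hb (hmem t).2 (w := -v.1) fun y hy => by
      have := hmax ((γ t).1, y) ⟨(hmem t).1, hy⟩
      rw [omega, omega] at this
      rw [inner_neg_right, inner_neg_right]
      linarith
    refine ⟨e4, e1, ?_, e5, e2, ?_⟩
    · rw [sympForm_apply, omega] at hΩ
      simp only [Prod.fst_sub, Prod.snd_sub] at hΩ
      rw [inner_neg_right]
      linarith
    · rw [← e6, ← e3, neg_neg]
      exact hdt
  · have hLd : ∀ s t : ℝ, IntervalIntegrable (deriv γ) volume s t := fun s t =>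
      intervalIntegrable_deriv_of_lipschitzOn hγLip.lipschitzOnWith
    have h1 : ∫ t in (0 : ℝ)..(2 * π), sympForm n (γ t - (a, b)) (deriv γ t) = d * (2 * π) := by
      rw [intervalIntegral.integral_congr_ae (g := fun _ => d)
        (by filter_upwards [hae'] with t ht _ using ht.2.2), intervalIntegral.integral_const,
        sub_zero, smul_eq_mul, mul_comm]
    have h2 : ∫ t in (0 : ℝ)..(2 * π), omega (γ t) (deriv γ t) = d * (2 * π) := by
      rw [← h1]
      simp only [map_sub, sub_apply]
      rw [intervalIntegral.integral_sub
        (intervalIntegrable_bilin _ hγLip.continuous.continuousOn (hLd _ _))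
        (intervalIntegrable_bilin _ continuousOn_const (hLd _ _)),
        (sympForm n (a, b)).intervalIntegral_comp_comm (hLd _ _),
        integral_deriv_of_lipschitzOn hγLip.lipschitzOnWith]
      have := hperγ 0
      rw [zero_add] at this
      rw [this, sub_self, map_zero, sub_zero]
      simp only [sympForm_apply]
    rw [action, h2, minimalAction, ← hMdef, hd]
    field_simp

end Generalised

/-! ### Regularity of generalised trajectories -/

section Regularity

variable {n : ℕ} {K T C : Set (E n)} {a b c : E n} {HK HT H : E n → ℝ}

/-- The Riesz isomorphism. -/
noncomputable def rieszVector (n : ℕ) : (E n →L[ℝ] ℝ) →L[ℝ] E n :=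
  (InnerProductSpace.toDual ℝ (E n)).symm.toContinuousLinearEquiv.toContinuousLinearMap

theorem inner_rieszVector (ℓ : E n →L[ℝ] ℝ) (w : E n) : inner ℝ (rieszVector n ℓ) w = ℓ w :=
  InnerProductSpace.toDual_symm_apply

theorem gradient_eq_rieszVector (f : E n → ℝ) (x : E n) :
    gradient f x = rieszVector n (fderiv ℝ f x) := rfl

theorem contDiffAt_gradient_gaugeAt (hC : IsConvexBody C) (hH : IsDefiningFunction C H)
    (hc : c ∈ interior C) {x : E n} (hx : x ≠ c) : ContDiffAt ℝ ∞ (gradient (gaugeAt C c)) x :=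
  (rieszVector n).contDiff.contDiffAt.comp x (contDiffAt_fderiv_gaugeAt hC hH hc hx)

theorem gradient_gaugeAt_ne_zero (hC : IsConvexBody C) (hH : IsDefiningFunction C H)
    (hc : c ∈ interior C) {x : E n} (hx : x ≠ c) : gradient (gaugeAt C c) x ≠ 0 := fun h0 => by
  have h1 := fderiv_gaugeAt_radial hC hH hc hx
  rw [← inner_gradient_left, h0, inner_zero_left] at h1
  exact (gaugeAt_pos hC hc hx).ne h1

/-- The inner product of the two normals at a point of `∂K × ∂T`. -/
noncomputable def normalProduct (K T : Set (E n)) (a b : E n) (x : Phase n) : ℝ :=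
  fderiv ℝ (gaugeAt K a) x.1 (gradient (gaugeAt T b) x.2)

theorem normalProduct_eq (x : Phase n) : normalProduct K T a b x
    = fderiv ℝ (gaugeAt T b) x.2 (gradient (gaugeAt K a) x.1) := by
  rw [normalProduct, ← inner_gradient_left, ← inner_gradient_left, real_inner_comm]

/-- The Hessian of the gauge function of `K` in the direction of the normal of `T`. -/
noncomputable def normalHessian (K T : Set (E n)) (a b : E n) (q p : E n) : ℝ :=
  fderiv ℝ (fderiv ℝ (gaugeAt K a)) q (gradient (gaugeAt T b) p) (gradient (gaugeAt T b) p)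

theorem contDiffAt_normalProduct (hK : IsConvexBody K) (hT : IsConvexBody T)
    (hHK : IsDefiningFunction K HK) (hHT : IsDefiningFunction T HT)
    (ha : a ∈ interior K) (hb : b ∈ interior T) {x : Phase n} (h1 : x.1 ≠ a) (h2 : x.2 ≠ b) :
    ContDiffAt ℝ ∞ (normalProduct K T a b) x :=
  ((contDiffAt_fderiv_gaugeAt hK hHK ha h1).comp x contDiffAt_fst).clm_apply
    ((contDiffAt_gradient_gaugeAt hT hHT hb h2).comp x contDiffAt_snd)

theorem contDiffAt_normalHessian (hK : IsConvexBody K) (hT : IsConvexBody T)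
    (hHK : IsDefiningFunction K HK) (hHT : IsDefiningFunction T HT)
    (ha : a ∈ interior K) (hb : b ∈ interior T) {z : Phase n} (h1 : z.1 ≠ a) (h2 : z.2 ≠ b) :
    ContDiffAt ℝ ∞ (fun z : Phase n => normalHessian K T a b z.1 z.2) z := by
  have h3 : ContDiffAt ℝ ∞ (fun z : Phase n => fderiv ℝ (fderiv ℝ (gaugeAt K a)) z.1) z :=
    ContDiffAt.comp (g := fderiv ℝ (fderiv ℝ (gaugeAt K a))) z
      ((contDiffAt_fderiv_gaugeAt hK hHK ha h1).fderiv_right (by simp)) contDiffAt_fst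
  have h4 : ContDiffAt ℝ ∞ (fun z : Phase n => gradient (gaugeAt T b) z.2) z :=
    (contDiffAt_gradient_gaugeAt hT hHT hb h2).comp z contDiffAt_snd
  exact (h3.clm_apply h4).clm_apply h4

section Derivatives

variable {γ : ℝ → Phase n} {t α β : ℝ}

theorem hasDerivAt_gauge_fst (hK : IsConvexBody K) (hHK : IsDefiningFunction K HK)
    (ha : a ∈ interior K) (h1 : (γ t).1 ≠ a)
    (hd : HasDerivAt γ (-(α • gradient (gaugeAt T b) (γ t).2),
      β • gradient (gaugeAt K a) (γ t).1) t) :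
    HasDerivAt (fun t => gaugeAt K a (γ t).1) (-(α * normalProduct K T a b (γ t))) t := by
  have hq : HasDerivAt (fun t => (γ t).1) (-(α • gradient (gaugeAt T b) (γ t).2)) t :=
    (ContinuousLinearMap.fst ℝ (E n) (E n)).hasFDerivAt.comp_hasDerivAt t hd
  have := (hasFDerivAt_gaugeAt hK hHK ha h1).comp_hasDerivAt t hq
  rwa [map_neg, map_smul, smul_eq_mul] at this

theorem hasDerivAt_gauge_snd (hT : IsConvexBody T) (hHT : IsDefiningFunction T HT)
    (hb : b ∈ interior T) (h2 : (γ t).2 ≠ b)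
    (hd : HasDerivAt γ (-(α • gradient (gaugeAt T b) (γ t).2),
      β • gradient (gaugeAt K a) (γ t).1) t) :
    HasDerivAt (fun t => gaugeAt T b (γ t).2) (β * normalProduct K T a b (γ t)) t := by
  have hp : HasDerivAt (fun t => (γ t).2) (β • gradient (gaugeAt K a) (γ t).1) t :=
    (ContinuousLinearMap.snd ℝ (E n) (E n)).hasFDerivAt.comp_hasDerivAt t hd
  have := (hasFDerivAt_gaugeAt hT hHT hb h2).comp_hasDerivAt t hp
  rwa [map_smul, smul_eq_mul, ← normalProduct_eq] at this

/-- Since q moves along the normal of T and p along the normal of K, the product rule produces only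
pure second derivatives, each in the direction of the other normal. -/
theorem hasDerivAt_normalProduct (hK : IsConvexBody K) (hT : IsConvexBody T)
    (hHK : IsDefiningFunction K HK) (hHT : IsDefiningFunction T HT)
    (ha : a ∈ interior K) (hb : b ∈ interior T) (h1 : (γ t).1 ≠ a) (h2 : (γ t).2 ≠ b)
    (hd : HasDerivAt γ (-(α • gradient (gaugeAt T b) (γ t).2),
      β • gradient (gaugeAt K a) (γ t).1) t) :
    HasDerivAt (fun t => normalProduct K T a b (γ t))
      (-(α * normalHessian K T a b (γ t).1 (γ t).2) + β * normalHessian T K b a (γ t).2 (γ t).1)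
      t := by
  have hq : HasDerivAt (fun t => (γ t).1) (-(α • gradient (gaugeAt T b) (γ t).2)) t :=
    (ContinuousLinearMap.fst ℝ (E n) (E n)).hasFDerivAt.comp_hasDerivAt t hd
  have hp : HasDerivAt (fun t => (γ t).2) (β • gradient (gaugeAt K a) (γ t).1) t :=
    (ContinuousLinearMap.snd ℝ (E n) (E n)).hasFDerivAt.comp_hasDerivAt t hd
  have hq2 := ((contDiffAt_fderiv_gaugeAt hK hHK ha h1).differentiableAt
    (by simp)).hasFDerivAt.comp_hasDerivAt t hq
  have hp2 := ((contDiffAt_fderiv_gaugeAt hT hHT hb h2).differentiableAt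
    (by simp)).hasFDerivAt.comp_hasDerivAt t hp
  have hp3 := (rieszVector n).hasFDerivAt.comp_hasDerivAt t hp2
  have := hq2.clm_apply hp3
  refine this.congr_deriv ?_
  have e1 : ∀ w : E n →L[ℝ] ℝ, fderiv ℝ (gaugeAt K a) (γ t).1 (rieszVector n w)
      = w (gradient (gaugeAt K a) (γ t).1) := fun w => by
    rw [← inner_gradient_left, real_inner_comm, inner_rieszVector]
  simp only [Function.comp_apply]
  rw [e1, map_neg, map_smul, map_smul, neg_apply, smul_apply, smul_apply, smul_eq_mul, smul_eq_mul,
    ← gradient_eq_rieszVector]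
  rfl

end Derivatives

namespace IsGeneralisedTrajectory

variable {d : ℝ} {α β : ℝ → ℝ} {γ : ℝ → Phase n}

theorem continuous (h : IsGeneralisedTrajectory K T a b d α β γ) : Continuous γ := by
  obtain ⟨C, hC⟩ := h.lipschitz
  exact hC.continuous

theorem mem (h : IsGeneralisedTrajectory K T a b d α β γ) (hK : IsConvexBody K)
    (hT : IsConvexBody T) (t : ℝ) : γ t ∈ K ×ˢ T :=
  (hK.prod hT).isCompact.isClosed.frontier_subset (h.mem_frontier t)

/-- While q is interior, β vanishes and α = d almost everywhere, so the curve solves a smooth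
autonomous equation on an open set of times. -/
theorem regular_of_fst_mem_interior (h : IsGeneralisedTrajectory K T a b d α β γ)
    (hK : IsConvexBody K) (hT : IsConvexBody T) (hHT : IsDefiningFunction T HT)
    (hb : b ∈ interior T) {t : ℝ} (ht : (γ t).1 ∈ interior K) :
    HasDerivAt γ (-(d • gradient (gaugeAt T b) (γ t).2), 0) t ∧ ContDiffAt ℝ ∞ γ t := by
  obtain ⟨C, hC⟩ := h.lipschitz
  let I : Set ℝ := {t | (γ t).1 ∈ interior K}
  have hI : IsOpen I := isOpen_interior.preimage (continuous_fst.comp h.continuous)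
  let F : Phase n → Phase n := fun x => (-(d • gradient (gaugeAt T b) x.2), 0)
  have hF : ContDiffOn ℝ ∞ F {x | x.2 ≠ b} := fun x hx =>
    (((((contDiffAt_gradient_gaugeAt hT hHT hb hx).comp x contDiffAt_snd).const_smul d).neg).prodMk
      contDiffAt_const).contDiffWithinAt
  have hfr : ∀ t ∈ I, (γ t).2 ∈ frontier T := fun t ht => by
    have hd := disjoint_interior_frontier (s := K)
    rcases (mem_frontier_prod_iff hK hT).1 (h.mem_frontier t) with h1 | h1 | h1
    · exact h1.2
    · exact (hd.le_bot ⟨ht, h1.1⟩).elim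
    · exact h1.2
  obtain ⟨h1, h2⟩ := hasDerivAt_and_contDiffOn_of_ae hC hF hI
    (fun t ht => ne_of_mem_frontier hb (hfr t ht)) (by
      filter_upwards [h.ae] with t ⟨_, _, hsum, _, hβ, hd⟩ htI
      have hβ0 : β t = 0 := hβ.resolve_right fun hf =>
        (disjoint_interior_frontier (s := K)).le_bot ⟨htI, hf⟩
      rw [hβ0, add_zero] at hsum
      rw [hβ0, hsum, zero_smul] at hd
      exact hd)
  exact ⟨h1 t ht, h2.contDiffAt (hI.mem_nhds ht)⟩

theorem regular_of_snd_mem_interior (h : IsGeneralisedTrajectory K T a b d α β γ)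
    (hK : IsConvexBody K) (hT : IsConvexBody T) (hHK : IsDefiningFunction K HK)
    (ha : a ∈ interior K) {t : ℝ} (ht : (γ t).2 ∈ interior T) :
    HasDerivAt γ (0, d • gradient (gaugeAt K a) (γ t).1) t ∧ ContDiffAt ℝ ∞ γ t := by
  obtain ⟨C, hC⟩ := h.lipschitz
  let I : Set ℝ := {t | (γ t).2 ∈ interior T}
  have hI : IsOpen I := isOpen_interior.preimage (continuous_snd.comp h.continuous)
  let F : Phase n → Phase n := fun x => (0, d • gradient (gaugeAt K a) x.1)
  have hF : ContDiffOn ℝ ∞ F {x | x.1 ≠ a} := fun x hx =>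
    (contDiffAt_const.prodMk (((contDiffAt_gradient_gaugeAt hK hHK ha hx).comp x
      contDiffAt_fst).const_smul d)).contDiffWithinAt
  have hfr : ∀ t ∈ I, (γ t).1 ∈ frontier K := fun t ht => by
    have hd := disjoint_interior_frontier (s := T)
    rcases (mem_frontier_prod_iff hK hT).1 (h.mem_frontier t) with h1 | h1 | h1
    · exact (hd.le_bot ⟨ht, h1.2⟩).elim
    · exact h1.1
    · exact h1.1
  obtain ⟨h1, h2⟩ := hasDerivAt_and_contDiffOn_of_ae hC hF hI
    (fun t ht => ne_of_mem_frontier ha (hfr t ht)) (by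
      filter_upwards [h.ae] with t ⟨_, _, hsum, hα, _, hd⟩ htI
      have hα0 : α t = 0 := hα.resolve_right fun hf =>
        (disjoint_interior_frontier (s := T)).le_bot ⟨htI, hf⟩
      rw [hα0, zero_add] at hsum
      rw [hα0, hsum, zero_smul, neg_zero] at hd
      exact hd)
  exact ⟨h1 t ht, h2.contDiffAt (hI.mem_nhds ht)⟩

theorem eventually_ne (h : IsGeneralisedTrajectory K T a b d α β γ)
    (ha : a ∈ interior K) (hb : b ∈ interior T) {t₀ : ℝ} (hq : (γ t₀).1 ∈ frontier K)
    (hp : (γ t₀).2 ∈ frontier T) : ∀ᶠ t in 𝓝 t₀, (γ t).1 ≠ a ∧ (γ t).2 ≠ b :=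
  ((continuous_fst.comp h.continuous).continuousAt.eventually_ne (ne_of_mem_frontier ha hq)).and
    ((continuous_snd.comp h.continuous).continuousAt.eventually_ne (ne_of_mem_frontier hb hp))

/-- The one-sided derivatives at a corner from the vanishing of the coefficients. -/
theorem hasDerivWithinAt_of_coeff_snd_eq_zero (h : IsGeneralisedTrajectory K T a b d α β γ)
    (hT : IsConvexBody T) (hHT : IsDefiningFunction T HT) (hb : b ∈ interior T) {t₀ δ : ℝ}
    (hδ : 0 < δ) {S : Set ℝ} (hS : S.OrdConnected) (ht₀ : t₀ ∈ S)
    (hne : ∀ t ∈ Metric.ball t₀ δ, (γ t).2 ≠ b)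
    (hβ : ∀ᵐ t, t ∈ Metric.ball t₀ δ → t ∈ S → β t = 0) :
    HasDerivWithinAt γ (-(d • gradient (gaugeAt T b) (γ t₀).2), 0) S t₀ := by
  obtain ⟨C, hC⟩ := h.lipschitz
  refine hasDerivWithinAt_of_ae (G := fun t => (-(d • gradient (gaugeAt T b) (γ t).2), 0)) hC hδ hS
    ht₀ (fun t ht => ?_) ?_
  · have h1 : ContinuousAt (fun t => gradient (gaugeAt T b) (γ t).2) t :=
      ContinuousAt.comp (g := gradient (gaugeAt T b)) (f := fun t => (γ t).2)
        (contDiffAt_gradient_gaugeAt hT hHT hb (hne t ht)).continuousAt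
        (continuous_snd.comp h.continuous).continuousAt
    exact ((h1.const_smul d).neg.prodMk continuousAt_const).continuousWithinAt
  · filter_upwards [h.ae, hβ] with t ⟨_, _, hsum, _, _, hd⟩ hβt htb htS
    rw [hβt htb htS, add_zero] at hsum
    rw [hβt htb htS, hsum, zero_smul] at hd
    exact hd

theorem hasDerivWithinAt_of_coeff_fst_eq_zero (h : IsGeneralisedTrajectory K T a b d α β γ)
    (hK : IsConvexBody K) (hHK : IsDefiningFunction K HK) (ha : a ∈ interior K) {t₀ δ : ℝ}
    (hδ : 0 < δ) {S : Set ℝ} (hS : S.OrdConnected) (ht₀ : t₀ ∈ S)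
    (hne : ∀ t ∈ Metric.ball t₀ δ, (γ t).1 ≠ a)
    (hα : ∀ᵐ t, t ∈ Metric.ball t₀ δ → t ∈ S → α t = 0) :
    HasDerivWithinAt γ (0, d • gradient (gaugeAt K a) (γ t₀).1) S t₀ := by
  obtain ⟨C, hC⟩ := h.lipschitz
  refine hasDerivWithinAt_of_ae (G := fun t => (0, d • gradient (gaugeAt K a) (γ t).1)) hC hδ hS
    ht₀ (fun t ht => ?_) ?_
  · have h1 : ContinuousAt (fun t => gradient (gaugeAt K a) (γ t).1) t :=
      ContinuousAt.comp (g := gradient (gaugeAt K a)) (f := fun t => (γ t).1)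
        (contDiffAt_gradient_gaugeAt hK hHK ha (hne t ht)).continuousAt
        (continuous_fst.comp h.continuous).continuousAt
    exact (continuousAt_const.prodMk (h1.const_smul d)).continuousWithinAt
  · filter_upwards [h.ae, hα] with t ⟨_, _, hsum, _, _, hd⟩ hαt htb htS
    rw [hαt htb htS, zero_add] at hsum
    rw [hαt htb htS, hsum, zero_smul, neg_zero] at hd
    exact hd

theorem velocity_mem_cone (hd : 0 < d) (x : Phase n) :
    (-(d • gradient (gaugeAt T b) x.2), (0 : E n)) ∈ velocityCone K T a b x ∧
      ((0 : E n), d • gradient (gaugeAt K a) x.1) ∈ velocityCone K T a b x :=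
  ⟨⟨d, 0, hd.le, le_rfl, by simp [hd.ne'], by simp⟩, ⟨0, d, le_rfl, hd.le, by simp [hd.ne'], by simp⟩⟩

/-- The coefficients near a corner where the trajectory crosses transversally. -/
theorem exists_coeff_eq_zero (h : IsGeneralisedTrajectory K T a b d α β γ)
    (hK : IsConvexBody K) (hT : IsConvexBody T)
    (hHK : IsDefiningFunction K HK) (hHT : IsDefiningFunction T HT)
    (ha : a ∈ interior K) (hb : b ∈ interior T) {t₀ : ℝ} (hq : (γ t₀).1 ∈ frontier K)
    (hp : (γ t₀).2 ∈ frontier T) (hσ : normalProduct K T a b (γ t₀) ≠ 0) :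
    ∃ δ > 0, (∀ t ∈ Metric.ball t₀ δ, (γ t).1 ≠ a ∧ (γ t).2 ≠ b) ∧
      ((∀ᵐ t, t ∈ Metric.ball t₀ δ → (t₀ < t → β t = 0) ∧ (t < t₀ → α t = 0)) ∨
        ∀ᵐ t, t ∈ Metric.ball t₀ δ → (t₀ < t → α t = 0) ∧ (t < t₀ → β t = 0)) := by
  obtain ⟨C, hC⟩ := h.lipschitz
  have hqa := ne_of_mem_frontier ha hq
  have hpb := ne_of_mem_frontier hb hp
  have hf : ContDiffAt ℝ 1 (fun x : Phase n => gaugeAt K a x.1 - 1) (γ t₀) :=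
    ((((contDiffAt_gaugeAt hK hHK ha hqa).comp (γ t₀) contDiffAt_fst).sub
      contDiffAt_const)).of_le (by simp)
  have hg : ContDiffAt ℝ 1 (fun x : Phase n => gaugeAt T b x.2 - 1) (γ t₀) :=
    ((((contDiffAt_gaugeAt hT hHT hb hpb).comp (γ t₀) contDiffAt_snd).sub
      contDiffAt_const)).of_le (by simp)
  obtain ⟨C₁, hC₁⟩ := exists_lipschitzOn_ball hC hf
  obtain ⟨C₂, hC₂⟩ := exists_lipschitzOn_ball hC hg
  have hσc : ContinuousAt (fun t => normalProduct K T a b (γ t)) t₀ :=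
    ContinuousAt.comp (g := normalProduct K T a b)
      (contDiffAt_normalProduct hK hT hHK hHT ha hb hqa hpb).continuousAt h.continuous.continuousAt
  have hf0 : ∀ t, gaugeAt K a (γ t).1 - 1 ≤ 0 := fun t =>
    sub_nonpos.2 ((gaugeAt_le_one_iff hK ha).2 (h.mem hK hT t).1)
  have hg0 : ∀ t, gaugeAt T b (γ t).2 - 1 ≤ 0 := fun t =>
    sub_nonpos.2 ((gaugeAt_le_one_iff hT hb).2 (h.mem hK hT t).2)
  have hft : gaugeAt K a (γ t₀).1 - 1 = 0 := sub_eq_zero.2 ((gaugeAt_eq_one_iff hK ha).2 hq)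
  have hgt : gaugeAt T b (γ t₀).2 - 1 = 0 := sub_eq_zero.2 ((gaugeAt_eq_one_iff hT hb).2 hp)
  -- The sign of σ tells whether the trajectory arrives along ∂K and leaves along ∂T or conversely;
  -- for negative sign the two functions exchange roles.
  rcases lt_or_gt_of_ne hσ with hneg | hpos
  · obtain ⟨δ, ⟨⟨hL1, hL2⟩, hne, hσδ⟩, hδ⟩ := (((hC₁.and hC₂).and
      ((eventually_forall_ball (h.eventually_ne ha hb hq hp)).and
        (eventually_forall_ball (hσc.eventually_lt_const hneg)))).and self_mem_nhdsWithin).exists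
    refine ⟨δ, hδ, hne, .inr ?_⟩
    refine eq_zero_of_opposite_monotone (σ := fun t => -normalProduct K T a b (γ t)) hL2 hL1 hg0 hf0
      hgt hft (fun t ht => neg_pos.2 (hσδ t ht)) ?_
    filter_upwards [h.ae] with t ⟨hα, hβ, _, _, _, hd⟩ ht
    refine ⟨hβ, hα, ?_, ?_⟩
    · simpa using (hasDerivAt_gauge_snd hT hHT hb (hne t ht).2 hd).sub_const 1
    · simpa using (hasDerivAt_gauge_fst hK hHK ha (hne t ht).1 hd).sub_const 1
  · obtain ⟨δ, ⟨⟨hL1, hL2⟩, hne, hσδ⟩, hδ⟩ := (((hC₁.and hC₂).and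
      ((eventually_forall_ball (h.eventually_ne ha hb hq hp)).and
        (eventually_forall_ball (hσc.eventually_const_lt hpos)))).and self_mem_nhdsWithin).exists
    refine ⟨δ, hδ, hne, .inl ?_⟩
    refine eq_zero_of_opposite_monotone (σ := fun t => normalProduct K T a b (γ t)) hL1 hL2 hf0 hg0
      hft hgt hσδ ?_
    filter_upwards [h.ae] with t ⟨hα, hβ, _, _, _, hd⟩ ht
    exact ⟨hα, hβ, (hasDerivAt_gauge_fst hK hHK ha (hne t ht).1 hd).sub_const 1,
      (hasDerivAt_gauge_snd hT hHT hb (hne t ht).2 hd).sub_const 1⟩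

/-- The one-sided derivatives are the two pure velocities, which differ. Such times therefore belong
to the null set where γ is not differentiable. -/
theorem regular_of_normalProduct_ne_zero (h : IsGeneralisedTrajectory K T a b d α β γ)
    (hK : IsConvexBody K) (hT : IsConvexBody T)
    (hHK : IsDefiningFunction K HK) (hHT : IsDefiningFunction T HT)
    (ha : a ∈ interior K) (hb : b ∈ interior T) {t₀ : ℝ} (hq : (γ t₀).1 ∈ frontier K)
    (hp : (γ t₀).2 ∈ frontier T) (hσ : normalProduct K T a b (γ t₀) ≠ 0) :
    ¬ DifferentiableAt ℝ γ t₀ ∧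
      (∃ v ∈ velocityCone K T a b (γ t₀), HasDerivWithinAt γ v (Iic t₀) t₀) ∧
      ∃ v ∈ velocityCone K T a b (γ t₀), HasDerivWithinAt γ v (Ici t₀) t₀ := by
  obtain ⟨δ, hδ, hne, hco⟩ := h.exists_coeff_eq_zero hK hT hHK hHT ha hb hq hp hσ
  have hcone := velocity_mem_cone (K := K) (T := T) (a := a) (b := b) h.pos (γ t₀)
  have hgne : d • gradient (gaugeAt K a) (γ t₀).1 ≠ 0 :=
    smul_ne_zero h.pos.ne' (gradient_gaugeAt_ne_zero hK hHK ha (ne_of_mem_frontier ha hq))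
  have hae : ∀ᵐ t : ℝ, t ≠ t₀ := by simp [ae_iff, measure_singleton]
  have hnd : ∀ {S S' : Set ℝ}, UniqueDiffWithinAt ℝ S t₀ → UniqueDiffWithinAt ℝ S' t₀ →
      HasDerivWithinAt γ (-(d • gradient (gaugeAt T b) (γ t₀).2), 0) S t₀ →
      HasDerivWithinAt γ (0, d • gradient (gaugeAt K a) (γ t₀).1) S' t₀ →
      ¬ DifferentiableAt ℝ γ t₀ := by
    intro S S' hS hS' h1 h2 hdiff
    have e1 := hS.eq_deriv _ h1 hdiff.hasDerivAt.hasDerivWithinAt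
    have e2 := hS'.eq_deriv _ h2 hdiff.hasDerivAt.hasDerivWithinAt
    rw [← e1] at e2
    exact hgne (congrArg Prod.snd e2)
  rcases hco with hco | hco
  · have hR := h.hasDerivWithinAt_of_coeff_snd_eq_zero hT hHT hb hδ ordConnected_Ici
      (mem_Ici.2 le_rfl) (fun t ht => (hne t ht).2) (by
        filter_upwards [hco, hae] with t ht hne htb htS
        exact (ht htb).1 (lt_of_le_of_ne htS hne.symm))
    have hL := h.hasDerivWithinAt_of_coeff_fst_eq_zero hK hHK ha hδ ordConnected_Iic
      (mem_Iic.2 le_rfl) (fun t ht => (hne t ht).1) (by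
        filter_upwards [hco, hae] with t ht hne htb htS
        exact (ht htb).2 (lt_of_le_of_ne htS hne))
    exact ⟨hnd (uniqueDiffWithinAt_Ici t₀) (uniqueDiffWithinAt_Iic t₀) hR hL,
      ⟨_, hcone.2, hL⟩, _, hcone.1, hR⟩
  · have hR := h.hasDerivWithinAt_of_coeff_fst_eq_zero hK hHK ha hδ ordConnected_Ici
      (mem_Ici.2 le_rfl) (fun t ht => (hne t ht).1) (by
        filter_upwards [hco, hae] with t ht hne htb htS
        exact (ht htb).1 (lt_of_le_of_ne htS hne.symm))
    have hL := h.hasDerivWithinAt_of_coeff_snd_eq_zero hT hHT hb hδ ordConnected_Iic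
      (mem_Iic.2 le_rfl) (fun t ht => (hne t ht).2) (by
        filter_upwards [hco, hae] with t ht hne htb htS
        exact (ht htb).2 (lt_of_le_of_ne htS hne))
    exact ⟨hnd (uniqueDiffWithinAt_Iic t₀) (uniqueDiffWithinAt_Ici t₀) hL hR,
      ⟨_, hcone.1, hL⟩, _, hcone.2, hR⟩

end IsGeneralisedTrajectory

end Regularity

/-! ### Tangential corners -/

section Tangential

variable {n : ℕ} {K T : Set (E n)} {a b : E n} {HK HT : E n → ℝ} {d : ℝ} {α β : ℝ → ℝ}
  {γ : ℝ → Phase n}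

/-- The energy which controls the distance to `∂K × ∂T` near a tangential corner. -/
noncomputable def cornerEnergy (K T : Set (E n)) (a b : E n) (x : Phase n) : ℝ :=
  normalProduct K T a b x ^ 2 / 2 - normalHessian K T a b x.1 x.2 * (gaugeAt K a x.1 - 1)
    - normalHessian T K b a x.2 x.1 * (gaugeAt T b x.2 - 1)

theorem contDiffAt_normalHessian_swap (hK : IsConvexBody K) (hT : IsConvexBody T)
    (hHK : IsDefiningFunction K HK) (hHT : IsDefiningFunction T HT)
    (ha : a ∈ interior K) (hb : b ∈ interior T) {z : Phase n} (h1 : z.1 ≠ a) (h2 : z.2 ≠ b) :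
    ContDiffAt ℝ ∞ (fun z : Phase n => normalHessian T K b a z.2 z.1) z :=
  ContDiffAt.comp (g := fun z : Phase n => normalHessian T K b a z.1 z.2) z
    (contDiffAt_normalHessian (z := (z.2, z.1)) hT hK hHT hHK hb ha h2 h1)
    (contDiffAt_snd.prodMk contDiffAt_fst)

theorem contDiffAt_cornerEnergy (hK : IsConvexBody K) (hT : IsConvexBody T)
    (hHK : IsDefiningFunction K HK) (hHT : IsDefiningFunction T HT)
    (ha : a ∈ interior K) (hb : b ∈ interior T) {x : Phase n} (h1 : x.1 ≠ a) (h2 : x.2 ≠ b) :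
    ContDiffAt ℝ ∞ (cornerEnergy K T a b) x := by
  have e1 := contDiffAt_normalProduct hK hT hHK hHT ha hb h1 h2
  have e2 := contDiffAt_normalHessian hK hT hHK hHT ha hb h1 h2
  have e3 := contDiffAt_normalHessian_swap hK hT hHK hHT ha hb h1 h2
  have e4 : ContDiffAt ℝ ∞ (fun x : Phase n => gaugeAt K a x.1 - 1) x :=
    ((contDiffAt_gaugeAt hK hHK ha h1).comp x contDiffAt_fst).sub contDiffAt_const
  have e5 : ContDiffAt ℝ ∞ (fun x : Phase n => gaugeAt T b x.2 - 1) x :=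
    ((contDiffAt_gaugeAt hT hHT hb h2).comp x contDiffAt_snd).sub contDiffAt_const
  exact (((e1.pow 2).div_const 2).sub (e2.mul e4)).sub (e3.mul e5)

/-- Along billiard velocities, the energy changes only through the Hessians. -/
theorem hasDerivAt_cornerEnergy (hK : IsConvexBody K) (hT : IsConvexBody T)
    (hHK : IsDefiningFunction K HK) (hHT : IsDefiningFunction T HT)
    (ha : a ∈ interior K) (hb : b ∈ interior T) {t A B κ₁ κ₂ : ℝ} (h1 : (γ t).1 ≠ a)
    (h2 : (γ t).2 ≠ b)
    (hd : HasDerivAt γ (-(A • gradient (gaugeAt T b) (γ t).2),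
      B • gradient (gaugeAt K a) (γ t).1) t)
    (hκ₁ : HasDerivAt (fun t => normalHessian K T a b (γ t).1 (γ t).2) κ₁ t)
    (hκ₂ : HasDerivAt (fun t => normalHessian T K b a (γ t).2 (γ t).1) κ₂ t) :
    HasDerivAt (fun t => cornerEnergy K T a b (γ t))
      (-(κ₁ * (gaugeAt K a (γ t).1 - 1)) - κ₂ * (gaugeAt T b (γ t).2 - 1)) t := by
  have e1 := hasDerivAt_normalProduct hK hT hHK hHT ha hb h1 h2 hd
  have e4 := (hasDerivAt_gauge_fst hK hHK ha h1 hd).sub_const 1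
  have e5 := (hasDerivAt_gauge_snd hT hHT hb h2 hd).sub_const 1
  -- The terms σσ', κ₁f' and κ₂h' cancel exactly, whatever the coefficients A and B.
  refine ((((e1.fun_pow 2).div_const 2).fun_sub (hκ₁.fun_mul e4)).fun_sub
    (hκ₂.fun_mul e5)).congr_deriv ?_
  push_cast
  ring

/-- At a tangential corner the normal of D is a nonzero tangent vector of ∂C, where positive
curvature applies. -/
theorem normalHessian_pos {C D : Set (E n)} {c e : E n} {H H' : E n → ℝ} (hC : IsConvexBody C)
    (hD : IsConvexBody D) (hH : IsDefiningFunction C H) (hH' : IsDefiningFunction D H')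
    (hc : c ∈ interior C) (he : e ∈ interior D)
    (hcurv : ∀ x ∈ frontier C, 0 < gaussCurvature H x) {x y : E n} (hx : x ∈ frontier C)
    (hy : y ∈ frontier D) (hσ : fderiv ℝ (gaugeAt C c) x (gradient (gaugeAt D e) y) = 0) :
    0 < normalHessian C D c e x y :=
  fderiv_fderiv_gaugeAt_pos hC hH hc hx (hcurv x hx) hσ
    (gradient_gaugeAt_ne_zero hD hH' he (ne_of_mem_frontier he hy))

namespace IsGeneralisedTrajectory

/-- Near a tangential corner a generalised trajectory glides along `∂K × ∂T`. -/
theorem exists_glide (h : IsGeneralisedTrajectory K T a b d α β γ)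
    (hK : IsConvexBody K) (hT : IsConvexBody T)
    (hHK : IsDefiningFunction K HK) (hHT : IsDefiningFunction T HT)
    (ha : a ∈ interior K) (hb : b ∈ interior T)
    (hcK : ∀ x ∈ frontier K, 0 < gaussCurvature HK x)
    (hcT : ∀ x ∈ frontier T, 0 < gaussCurvature HT x) {t₀ : ℝ} (hq : (γ t₀).1 ∈ frontier K)
    (hp : (γ t₀).2 ∈ frontier T) (hσ : normalProduct K T a b (γ t₀) = 0) :
    ∃ δ > 0, ∀ t ∈ Metric.ball t₀ δ, ((γ t).1 ≠ a ∧ (γ t).2 ≠ b) ∧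
      0 < normalHessian K T a b (γ t).1 (γ t).2 ∧ 0 < normalHessian T K b a (γ t).2 (γ t).1 ∧
      normalProduct K T a b (γ t) = 0 := by
  obtain ⟨C, hC⟩ := h.lipschitz
  have hqa := ne_of_mem_frontier ha hq
  have hpb := ne_of_mem_frontier hb hp
  have hs1 := contDiffAt_normalHessian hK hT hHK hHT ha hb hqa hpb
  have hs2 := contDiffAt_normalHessian_swap hK hT hHK hHT ha hb hqa hpb
  have hs3 := contDiffAt_cornerEnergy hK hT hHK hHT ha hb hqa hpb
  have hk1 := normalHessian_pos hK hT hHK hHT ha hb hcK hq hp hσ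
  have hk2 := normalHessian_pos hT hK hHT hHK hb ha hcT hp hq (by rw [← normalProduct_eq, hσ])
  -- Half the smaller Hessian at the corner bounds both Hessians from below nearby, so the energy
  -- dominates σ²/2 + m(|f| + |h|).
  set m := min (normalHessian K T a b (γ t₀).1 (γ t₀).2)
    (normalHessian T K b a (γ t₀).2 (γ t₀).1) / 2 with hm
  have hm0 : 0 < m := half_pos (lt_min hk1 hk2)
  have hm1 : m < normalHessian K T a b (γ t₀).1 (γ t₀).2 := by
    have := min_le_left (normalHessian K T a b (γ t₀).1 (γ t₀).2)
      (normalHessian T K b a (γ t₀).2 (γ t₀).1)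
    linarith
  have hm2 : m < normalHessian T K b a (γ t₀).2 (γ t₀).1 := by
    have := min_le_right (normalHessian K T a b (γ t₀).1 (γ t₀).2)
      (normalHessian T K b a (γ t₀).2 (γ t₀).1)
    linarith
  have hc1 : ContinuousAt (fun t => normalHessian K T a b (γ t).1 (γ t).2) t₀ :=
    ContinuousAt.comp (g := fun z : Phase n => normalHessian K T a b z.1 z.2)
      hs1.continuousAt h.continuous.continuousAt
  have hc2 : ContinuousAt (fun t => normalHessian T K b a (γ t).2 (γ t).1) t₀ :=
    ContinuousAt.comp (g := fun z : Phase n => normalHessian T K b a z.2 z.1)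
      hs2.continuousAt h.continuous.continuousAt
  obtain ⟨C₁, hC₁⟩ := exists_lipschitzOn_ball hC (hs1.of_le (by simp))
  obtain ⟨C₂, hC₂⟩ := exists_lipschitzOn_ball hC (hs2.of_le (by simp))
  obtain ⟨C₃, hC₃⟩ := exists_lipschitzOn_ball hC (hs3.of_le (by simp))
  obtain ⟨δ, ⟨⟨hL1, hL2, hL3⟩, hne, hκ⟩, hδ⟩ := (((hC₁.and (hC₂.and hC₃)).and
    ((eventually_forall_ball (h.eventually_ne ha hb hq hp)).and
      (eventually_forall_ball ((hc1.eventually_const_lt hm1).and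
        (hc2.eventually_const_lt hm2))))).and self_mem_nhdsWithin).exists
  have hδ0 : 0 < δ := hδ
  have hf0 : ∀ t, gaugeAt K a (γ t).1 - 1 ≤ 0 := fun t =>
    sub_nonpos.2 ((gaugeAt_le_one_iff hK ha).2 (h.mem hK hT t).1)
  have hg0 : ∀ t, gaugeAt T b (γ t).2 - 1 ≤ 0 := fun t =>
    sub_nonpos.2 ((gaugeAt_le_one_iff hT hb).2 (h.mem hK hT t).2)
  have hlow : ∀ t ∈ Metric.ball t₀ δ, normalProduct K T a b (γ t) ^ 2 / 2
      + m * (-(gaugeAt K a (γ t).1 - 1) - (gaugeAt T b (γ t).2 - 1))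
        ≤ cornerEnergy K T a b (γ t) := by
    intro t ht
    rw [cornerEnergy]
    have e1 := mul_le_mul_of_nonneg_right (hκ t ht).1.le (neg_nonneg.2 (hf0 t))
    have e2 := mul_le_mul_of_nonneg_right (hκ t ht).2.le (neg_nonneg.2 (hg0 t))
    linarith
  have hnn : ∀ t, 0 ≤ m * (-(gaugeAt K a (γ t).1 - 1) - (gaugeAt T b (γ t).2 - 1)) := fun t =>
    mul_nonneg hm0.le (by linarith [hf0 t, hg0 t])
  -- With C₁, C₂ the Lipschitz constants of the Hessians along γ, the energy changes at rate at most
  -- C₁|f| + C₂|h|, hence at most (C₁ + C₂)/m times the energy.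
  obtain ⟨δ', hδ', hle, hzero⟩ := exists_eq_zero_of_abs_deriv_le
    (e := fun t => cornerEnergy K T a b (γ t)) (L := (C₁ + C₂) / m) hδ0 (by positivity) hL3
    (fun t ht => by linarith [hlow t ht, hnn t, sq_nonneg (normalProduct K T a b (γ t))])
    (by
      rw [cornerEnergy, hσ, (gaugeAt_eq_one_iff hK ha).2 hq, (gaugeAt_eq_one_iff hT hb).2 hp]
      ring) (by
      filter_upwards [h.ae] with t ⟨_, _, _, _, _, hd⟩ ht
      have hκ₁ : DifferentiableAt ℝ (fun t => normalHessian K T a b (γ t).1 (γ t).2) t :=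
        DifferentiableAt.comp (g := fun z : Phase n => normalHessian K T a b z.1 z.2) t
          ((contDiffAt_normalHessian hK hT hHK hHT ha hb (hne t ht).1
            (hne t ht).2).differentiableAt (by simp)) hd.differentiableAt
      have hκ₂ : DifferentiableAt ℝ (fun t => normalHessian T K b a (γ t).2 (γ t).1) t :=
        DifferentiableAt.comp (g := fun z : Phase n => normalHessian T K b a z.2 z.1) t
          ((contDiffAt_normalHessian_swap hK hT hHK hHT ha hb (hne t ht).1
            (hne t ht).2).differentiableAt (by simp)) hd.differentiableAt
      refine ⟨_, hasDerivAt_cornerEnergy hK hT hHK hHT ha hb (hne t ht).1 (hne t ht).2 hd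
        hκ₁.hasDerivAt hκ₂.hasDerivAt, ?_⟩
      have hb1 := hκ₁.hasDerivAt.le_of_lipschitzOn (Metric.isOpen_ball.mem_nhds ht) hL1
      have hb2 := hκ₂.hasDerivAt.le_of_lipschitzOn (Metric.isOpen_ball.mem_nhds ht) hL2
      rw [Real.norm_eq_abs] at hb1 hb2
      have hE : -(gaugeAt K a (γ t).1 - 1) - (gaugeAt T b (γ t).2 - 1)
          ≤ cornerEnergy K T a b (γ t) / m := by
        rw [le_div_iff₀ hm0]
        linarith [hlow t ht, sq_nonneg (normalProduct K T a b (γ t))]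
      have hE' := mul_le_mul_of_nonneg_left hE (add_nonneg C₁.2 C₂.2)
      rw [neg_sub_left, abs_neg]
      refine (abs_add_le _ _).trans ?_
      rw [abs_mul, abs_mul, abs_of_nonpos (hf0 t), abs_of_nonpos (hg0 t)]
      have e1 := mul_le_mul_of_nonneg_right hb1 (neg_nonneg.2 (hf0 t))
      have e2 := mul_le_mul_of_nonneg_right hb2 (neg_nonneg.2 (hg0 t))
      have e3 := mul_nonneg C₁.2 (neg_nonneg.2 (hg0 t))
      have e4 := mul_nonneg C₂.2 (neg_nonneg.2 (hf0 t))
      simp only [NNReal.val_eq_coe] at *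
      rw [div_mul_eq_mul_div, mul_div_assoc]
      linarith)
  refine ⟨δ', hδ', fun t ht => ?_⟩
  have ht' := Metric.ball_subset_ball hle ht
  refine ⟨hne t ht', hm0.trans (hκ t ht').1, hm0.trans (hκ t ht').2, ?_⟩
  have h1 := hlow t ht'
  have h2 : cornerEnergy K T a b (γ t) = 0 := hzero t ht
  have h3 := hnn t
  have h4 := sq_nonneg (normalProduct K T a b (γ t))
  exact pow_eq_zero_iff two_ne_zero |>.1 (le_antisymm (by linarith) h4)

/-- On the gliding interval σ vanishes identically. Its derivative gives ακ₁ = βκ₂, which together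
with α + β = d determines both coefficients as smooth functions of position. -/
theorem regular_of_normalProduct_eq_zero (h : IsGeneralisedTrajectory K T a b d α β γ)
    (hK : IsConvexBody K) (hT : IsConvexBody T)
    (hHK : IsDefiningFunction K HK) (hHT : IsDefiningFunction T HT)
    (ha : a ∈ interior K) (hb : b ∈ interior T)
    (hcK : ∀ x ∈ frontier K, 0 < gaussCurvature HK x)
    (hcT : ∀ x ∈ frontier T, 0 < gaussCurvature HT x) {t₀ : ℝ} (hq : (γ t₀).1 ∈ frontier K)
    (hp : (γ t₀).2 ∈ frontier T) (hσ : normalProduct K T a b (γ t₀) = 0) :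
    ContDiffAt ℝ ∞ γ t₀ ∧ ∃ v ∈ velocityCone K T a b (γ t₀), HasDerivAt γ v t₀ := by
  obtain ⟨C, hC⟩ := h.lipschitz
  obtain ⟨δ, hδ, hglide⟩ := h.exists_glide hK hT hHK hHT ha hb hcK hcT hq hp hσ
  let κ₁ : Phase n → ℝ := fun z => normalHessian K T a b z.1 z.2
  let κ₂ : Phase n → ℝ := fun z => normalHessian T K b a z.2 z.1
  let F : Phase n → Phase n := fun z =>
    (-((d * κ₂ z / (κ₁ z + κ₂ z)) • gradient (gaugeAt T b) z.2),
      (d * κ₁ z / (κ₁ z + κ₂ z)) • gradient (gaugeAt K a) z.1)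
  have hF : ContDiffOn ℝ ∞ F {z | (z.1 ≠ a ∧ z.2 ≠ b) ∧ κ₁ z + κ₂ z ≠ 0} := by
    rintro z ⟨⟨h1, h2⟩, h3⟩
    have e1 : ContDiffAt ℝ ∞ κ₁ z := contDiffAt_normalHessian hK hT hHK hHT ha hb h1 h2
    have e2 : ContDiffAt ℝ ∞ κ₂ z := contDiffAt_normalHessian_swap hK hT hHK hHT ha hb h1 h2
    have e3 : ContDiffAt ℝ ∞ (fun z : Phase n => gradient (gaugeAt K a) z.1) z :=
      (contDiffAt_gradient_gaugeAt hK hHK ha h1).comp z contDiffAt_fst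
    have e4 : ContDiffAt ℝ ∞ (fun z : Phase n => gradient (gaugeAt T b) z.2) z :=
      (contDiffAt_gradient_gaugeAt hT hHT hb h2).comp z contDiffAt_snd
    exact (((((contDiffAt_const.mul e2).div (e1.add e2) h3).smul e4).neg).prodMk
      (((contDiffAt_const.mul e1).div (e1.add e2) h3).smul e3)).contDiffWithinAt
  obtain ⟨h1, h2⟩ := hasDerivAt_and_contDiffOn_of_ae hC hF (Metric.isOpen_ball (x := t₀) (ε := δ))
    (fun t ht => ⟨(hglide t ht).1, (add_pos (hglide t ht).2.1 (hglide t ht).2.2.1).ne'⟩) (by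
      filter_upwards [h.ae] with t ⟨_, _, hsum, _, _, hd⟩ ht
      obtain ⟨⟨hta, htb⟩, hk1, hk2, -⟩ := hglide t ht
      have hder := hasDerivAt_normalProduct hK hT hHK hHT ha hb hta htb hd
      have hloc : (fun t => normalProduct K T a b (γ t)) =ᶠ[𝓝 t] fun _ => 0 := by
        filter_upwards [Metric.isOpen_ball.mem_nhds ht] with u hu using (hglide u hu).2.2.2
      have hbal := (hder.congr_of_eventuallyEq hloc.symm).unique (hasDerivAt_const t (0 : ℝ))
      have hs : κ₁ (γ t) + κ₂ (γ t) ≠ 0 := (add_pos hk1 hk2).ne'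
      have hbal' : -(α t * κ₁ (γ t)) + β t * κ₂ (γ t) = 0 := hbal
      have eα : α t = d * κ₂ (γ t) / (κ₁ (γ t) + κ₂ (γ t)) := by
        rw [eq_div_iff hs, ← hsum]; linarith
      have eβ : β t = d * κ₁ (γ t) / (κ₁ (γ t) + κ₂ (γ t)) := by
        rw [eq_div_iff hs, ← hsum]; linarith
      rw [eα, eβ] at hd
      exact hd)
  have ht₀ := Metric.mem_ball_self hδ (x := t₀)
  refine ⟨h2.contDiffAt (Metric.isOpen_ball.mem_nhds ht₀), _, ?_, h1 t₀ ht₀⟩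
  obtain ⟨-, hk1, hk2, -⟩ := hglide t₀ ht₀
  have hs : 0 < κ₁ (γ t₀) + κ₂ (γ t₀) := add_pos hk1 hk2
  have hA : 0 < d * κ₂ (γ t₀) / (κ₁ (γ t₀) + κ₂ (γ t₀)) := div_pos (mul_pos h.pos hk2) hs
  have hB : 0 < d * κ₁ (γ t₀) / (κ₁ (γ t₀) + κ₂ (γ t₀)) := div_pos (mul_pos h.pos hk1) hs
  refine ⟨_, _, hA.le, hB.le, ?_, ?_⟩
  · rw [Ne, Prod.mk.injEq]
    exact fun h0 => hA.ne' h0.1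
  · simp [F]

/-- Periodic generalised trajectories are billiard trajectories. -/
theorem isBilliardTrajectory (h : IsGeneralisedTrajectory K T a b d α β γ)
    (hper : Function.Periodic γ (2 * π)) (hK : IsConvexBody K) (hT : IsConvexBody T)
    (hHK : IsDefiningFunction K HK) (hHT : IsDefiningFunction T HT)
    (ha : a ∈ interior K) (hb : b ∈ interior T)
    (hcK : ∀ x ∈ frontier K, 0 < gaussCurvature HK x)
    (hcT : ∀ x ∈ frontier T, 0 < gaussCurvature HT x) : IsBilliardTrajectory K T a b γ := by
  have hcorner : ∀ t, (γ t).1 ∈ frontier K → (γ t).2 ∈ frontier T →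
      (DifferentiableAt ℝ γ t → ContDiffAt ℝ ∞ γ t) ∧
      (∃ v ∈ velocityCone K T a b (γ t), HasDerivWithinAt γ v (Iic t) t) ∧
      ∃ v ∈ velocityCone K T a b (γ t), HasDerivWithinAt γ v (Ici t) t := by
    intro t hq hp
    by_cases hσ : normalProduct K T a b (γ t) = 0
    · obtain ⟨h1, v, hv, hd⟩ :=
        h.regular_of_normalProduct_eq_zero hK hT hHK hHT ha hb hcK hcT hq hp hσ
      exact ⟨fun _ => h1, ⟨v, hv, hd.hasDerivWithinAt⟩, v, hv, hd.hasDerivWithinAt⟩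
    · obtain ⟨h1, h2⟩ := h.regular_of_normalProduct_ne_zero hK hT hHK hHT ha hb hq hp hσ
      exact ⟨fun h0 => (h1 h0).elim, h2⟩
  have hcases := fun t => (mem_frontier_prod_iff hK hT).1 (h.mem_frontier t)
  -- The exceptional set for smoothness is the set of non-differentiability: at every other time one
  -- of the regularity results yields smoothness.
  refine ⟨hper, ⟨h.continuous, fun t => ?_, fun t => ?_, {t | ¬ DifferentiableAt ℝ γ t}, ?_,
    fun t ht => ?_⟩, h.mem_frontier, ⟨d, h.pos, fun t h1 _ => ?_, fun t _ h2 => ?_⟩,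
    fun t hq hp => (hcorner t hq hp).2.1, fun t hq hp => (hcorner t hq hp).2.2⟩
  · rcases hcases t with ⟨h1, -⟩ | ⟨-, h2⟩ | ⟨h1, h2⟩
    · exact ⟨_, (h.regular_of_fst_mem_interior hK hT hHT hb h1).1.hasDerivWithinAt⟩
    · exact ⟨_, (h.regular_of_snd_mem_interior hK hT hHK ha h2).1.hasDerivWithinAt⟩
    · obtain ⟨v, -, hv⟩ := (hcorner t h1 h2).2.1
      exact ⟨v, hv⟩
  · rcases hcases t with ⟨h1, -⟩ | ⟨-, h2⟩ | ⟨h1, h2⟩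
    · exact ⟨_, (h.regular_of_fst_mem_interior hK hT hHT hb h1).1.hasDerivWithinAt⟩
    · exact ⟨_, (h.regular_of_snd_mem_interior hK hT hHK ha h2).1.hasDerivWithinAt⟩
    · obtain ⟨v, -, hv⟩ := (hcorner t h1 h2).2.2
      exact ⟨v, hv⟩
  · refine measure_eq_zero_iff_ae_notMem.2 ?_
    filter_upwards [h.ae] with t ⟨_, _, _, _, _, hd⟩ hn
    exact hn hd.differentiableAt
  · have hdiff : DifferentiableAt ℝ γ t := not_not.1 ht
    rcases hcases t with ⟨h1, -⟩ | ⟨-, h2⟩ | ⟨h1, h2⟩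
    · exact (h.regular_of_fst_mem_interior hK hT hHT hb h1).2
    · exact (h.regular_of_snd_mem_interior hK hT hHK ha h2).2
    · exact (hcorner t h1 h2).1 hdiff
  · simpa using (h.regular_of_fst_mem_interior hK hT hHT hb h1).1
  · simpa using (h.regular_of_snd_mem_interior hK hT hHK ha h2).1

end IsGeneralisedTrajectory

end Tangential

end MinkowskiBilliard

theorem mainTheorem1 (n : ℕ) (hn : 1 ≤ n)
    (K T : Set (MinkowskiBilliard.E n))
    (hK : MinkowskiBilliard.IsSmoothStrictlyConvexBody K)
    (hT : MinkowskiBilliard.IsSmoothStrictlyConvexBody T)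
    (a b : MinkowskiBilliard.E n) (ha : a ∈ interior K) (hb : b ∈ interior T) :
    MinkowskiBilliard.extendedCapacity (K ×ˢ T) ≠ ⊤ ∧
    IsLeast {s : ℝ | ∃ γ : ℝ → MinkowskiBilliard.Phase n,
        MinkowskiBilliard.IsBilliardTrajectory K T a b γ ∧ s = MinkowskiBilliard.action γ}
      (MinkowskiBilliard.extendedCapacity (K ×ˢ T)).toReal ∧
    IsLeast {l : ℝ | ∃ q : ℝ → MinkowskiBilliard.E n,
        MinkowskiBilliard.IsTableTrajectory K T a b q ∧ l = MinkowskiBilliard.tableLength T q}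
      (MinkowskiBilliard.extendedCapacity (K ×ˢ T)).toReal := by
  obtain ⟨hKb, HK, hHK, hcK⟩ := hK
  obtain ⟨hTb, HT, hHT, hcT⟩ := hT
  have hcap := MinkowskiBilliard.extendedCapacity_prod hn ⟨hKb, HK, hHK⟩ ⟨hTb, HT, hHT⟩ ha hb
  have hval : (MinkowskiBilliard.extendedCapacity (K ×ˢ T)).toReal
      = MinkowskiBilliard.minimalAction (K ×ˢ T) (a, b) := by
    rw [hcap, ENNReal.toReal_ofReal (MinkowskiBilliard.minimalAction_pos hn (hKb.prod hTb)
      (MinkowskiBilliard.mem_interior_prod ha hb)).le]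
  obtain ⟨d, α, β, γ, hgen, hper, hact⟩ :=
    MinkowskiBilliard.exists_isGeneralisedTrajectory hn hKb hTb hHK hHT ha hb
  have hγ := hgen.isBilliardTrajectory hper hKb hTb hHK hHT ha hb hcK hcT
  refine ⟨by rw [hcap]; exact ENNReal.ofReal_ne_top, ?_, ?_⟩
  · rw [hval]
    refine ⟨⟨γ, hγ, hact.symm⟩, ?_⟩
    rintro _ ⟨γ', hγ', rfl⟩
    exact hγ'.minimalAction_le_action hn hKb hTb hHK hHT ha hb
  · rw [hval]
    refine ⟨⟨_, ⟨γ, hγ, rfl⟩, ?_⟩, ?_⟩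
    · rw [hγ.tableLength_eq hKb hTb hHK hHT ha hb, hact]
    · rintro _ ⟨_, ⟨γ', hγ', rfl⟩, rfl⟩
      rw [hγ'.tableLength_eq hKb hTb hHK hHT ha hb]
      exact hγ'.minimalAction_le_action hn hKb hTb hHK hHT ha hb
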